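/- Let $N\ge 2$ be even, let $\mathcal A$ be the algebra of operators on the Fock space of $N/2$ fermionic modes with Majorana operators $\gamma_1,\dots,\gamma_N$, and for $X\subseteq[N]$ let $\gamma_X=i^{r_X}\prod_{x\in X}\gamma_x$ (increasing order; $r_X=0$ if $|X|\equiv 0,1 \bmod 4$ and $r_X=1$ otherwise) be the Hermitian Majorana strings. Every $A\in\mathcal A$ has a unique expansion $A=\sum_X a_X\gamma_X$ with $a_X\in\mathbb C$; put $\deg A=\max\{|X|:a_X\ne0\}$ (and $\deg 0=0$), $\mathrm{Trunc}_\ell(A)=\sum_{|X|\le\ell}a_X\gamma_X$, and $\|A\|_{\mathrm F}=\sqrt{\mathrm{tr}(A^*A)}$ with $\mathrm{tr}$ the normalized trace. Let $H=\sum_{X\in\mathcal X}h_X\gamma_X$ be Hermitian, where $\mathcal X=\{X: h_X\neq 0\}$ consists of sets of size $2$ or $4$ and $|h_X|\le1$, and let $H$ be $\Delta$-sparse: every $i\in[N]$ lies in at most $\Delta$ sets $X\in\mathcal X$. A valid colouring of $H$ is a partition $\mathcal X=\mathcal X^1\cup\dots\cup\mathcal X^G$ with $G\le4\Delta$ such that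 distinct sets in the same $\mathcal X^g$ are disjoint. Put $H^g=\sum_{X\in\mathcal X^g}h_X\gamma_X$, $\tau^g_s(B)=e^{isH^g}Be^{-isH^g}$ and $T_s=\tau^G_s\circ\dots\circ\tau^1_s$. For $A\in\mathcal A$, $t\ge0$, $\delta t>0$ and $\ell\ge\deg A$, Majorana Propagation outputs $$A_{\mathrm{MP}}=\mathrm{Trunc}_\ell\circ T_{t-\lfloor t/\delta t\rfloor\delta t}\circ(\mathrm{Trunc}_\ell\circ T_{\delta t})^{\lfloor t/\delta t\rfloor}(A).$$ (i) There is a single program (on a machine with unit-cost exact real arithmetic, including $\cos$, $\sin$ and comparisons, and pointer-structured list data) and for every $\Delta$ a constant $C$, depending only on $\Delta$, such that for every $N$ and $H$ as above the following holds. On input $N$, $H$, $A$, $t$, $\delta t$, $\ell$, with $H$ and $A$ given by the lists of their nonzero coefficients, the program outputs the list of nonzero coefficients of $A_{\mathrm{MP}}$, for a valid colouring that depends only on the given list of the coefficients of $H$, after at most $$\left(\frac{t}{\delta t}+1\right)N^{C\max(\ell,1)}$$ steps; that is, in time $\frac{t}{\delta t}N^{O(\ell)}$ for $t\ge\delta t$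 and $\ell\ge1$. (ii) For every valid colouring of $H$, $$\|A_{\mathrm{MP}}-A(t)\|_{\mathrm F}\le 34\,t\,\delta t\,\Delta^2(\ell+2)^2\|A\|_{\mathrm F}+\left\lceil\frac t{\delta t}\right\rceil\eta^\star_{\mathrm F}(H,A,t,\ell),$$ where $A(s)=e^{iHs}Ae^{-iHs}$ and $\eta^\star_{\mathrm F}(H,A,t,\ell)=\max_{s\in[0,t]}\ \min_{P\in\mathcal A,\ \deg P\le\ell}\|P-A(s)\|_{\mathrm F}$. -/

import Mathlib

open scoped BigOperators Matrix

noncomputable section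

namespace MajoranaProp

/-! ### The Majorana algebra on Fock space -/

/-- The algebra of operators on the Fock space of `n` fermionic modes (`N = 2 n` Majorana modes).
The occupation-number basis vector `|n_1, …, n_n⟩` is indexed by the finite set of occupied modes. -/
abbrev FockOp (n : ℕ) : Type := Matrix (Finset (Fin n)) (Finset (Fin n)) ℂ

/-- The annihilation operator `c_j`: it sends `|T⟩` to `(-1)^{#{k ∈ T : k < j}} |T \ {j}⟩`
if `j ∈ T`, and to `0` otherwise. -/
def annihilation {n : ℕ} (j : Fin n) : FockOp n :=
  Matrix.of fun S T =>
    if j ∈ T ∧ S = T.erase j then (-1 : ℂ) ^ (T.filter (fun k => k < j)).card else 0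

/-- The creation operator `c_j^*`, the adjoint of `c_j`. -/
def creation {n : ℕ} (j : Fin n) : FockOp n := (annihilation j)ᴴ

/-- The Majorana operators (indexed from `0`):
`γ_{2j} = c_j^* + c_j` and `γ_{2j+1} = i (c_j^* - c_j)` for `0 ≤ j < n`. -/
def majorana {n : ℕ} (x : Fin (2 * n)) : FockOp n :=
  let j : Fin n := ⟨x.val / 2, by have := x.isLt; omega⟩
  if x.val % 2 = 0 then creation j + annihilation j
  else Complex.I • (creation j - annihilation j)

/-- The Majorana string `γ_X = i^{r_X} ∏_{x ∈ X} γ_x` (product in increasing order), with `r_X = 0`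
if `|X| ≡ 0, 1 (mod 4)` and `r_X = 1` otherwise. -/
def majoranaString {n : ℕ} (X : Finset (Fin (2 * n))) : FockOp n :=
  (if X.card % 4 = 0 ∨ X.card % 4 = 1 then (1 : ℂ) else Complex.I) •
    ((X.sort (· ≤ ·)).map majorana).prod

/-- The normalized trace, `tr 1 = 1`. -/
def ntrace {n : ℕ} (A : FockOp n) : ℂ := A.trace / 2 ^ n

/-- The normalized Frobenius norm `‖A‖_F = √(tr (A^* A))`. -/
def frobNorm {n : ℕ} (A : FockOp n) : ℝ := Real.sqrt (ntrace (Aᴴ * A)).re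

/-- The coefficient `a_X` of `γ_X` in the expansion `A = ∑_X a_X γ_X`. The Majorana strings are
orthonormal for the normalized trace inner product, so `a_X = tr (γ_X A)`; see `sum_coeff_smul` and
`coeff_unique` below, which say that this is the unique expansion of `A`. -/
def coeff {n : ℕ} (A : FockOp n) (X : Finset (Fin (2 * n))) : ℂ := ntrace (majoranaString X * A)

section Expansion

open Finset

/-- The mode `j` to which the Majorana operators `γ_{2j}` and `γ_{2j+1}` belong. -/
abbrev modeOf {n : ℕ} (x : Fin (2 * n)) : Fin n := ⟨x.val / 2, by have := x.isLt; omega⟩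

/-- The sign `(-1)^{#{k ∈ T : k < j}}`. -/
def sgn {n : ℕ} (j : Fin n) (T : Finset (Fin n)) : ℂ :=
  (-1 : ℂ) ^ (T.filter (fun k => k < j)).card

/-- The phase in `γ_x |T⟩ = phase x T • |T ∆ {j}⟩`, where `x` belongs to mode `j`. -/
def phase {n : ℕ} (x : Fin (2 * n)) (T : Finset (Fin n)) : ℂ :=
  sgn (modeOf x) T *
    (if x.val % 2 = 0 then 1 else if modeOf x ∈ T then -Complex.I else Complex.I)

lemma phase_def {n : ℕ} (x : Fin (2 * n)) (T : Finset (Fin n)) : phase x T = sgn (modeOf x) T *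
  (if x.val % 2 = 0 then 1 else if modeOf x ∈ T then -Complex.I else Complex.I) := rfl

lemma sgn_erase {n : ℕ} (j : Fin n) (T : Finset (Fin n)) : sgn j (symmDiff T {j}) = sgn j T := by
  unfold sgn
  congr 2
  ext k
  simp only [mem_filter, mem_symmDiff, mem_singleton]
  constructor
  · rintro ⟨h, h2⟩; have := h2.ne; tauto
  · rintro ⟨h, h2⟩; have := h2.ne; tauto

lemma majorana_apply {n : ℕ} (x : Fin (2 * n)) (S T : Finset (Fin n)) :
    majorana x S T = if S = symmDiff T {modeOf x} then phase x T else 0 := by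
  have key : ∀ j : Fin n, (creation j : FockOp n) S T =
      if S = symmDiff T {j} ∧ j ∉ T then sgn j T else 0 := by
    intro j
    simp only [creation, annihilation, Matrix.conjTranspose_apply, Matrix.of_apply]
    have e : (j ∈ S ∧ T = S.erase j) ↔ (S = symmDiff T {j} ∧ j ∉ T) := by
      constructor
      · rintro ⟨h, rfl⟩
        refine ⟨?_, by simp⟩
        ext k; simp only [mem_symmDiff, mem_erase, mem_singleton]
        by_cases hk : k = j <;> simp [hk, h]
      · rintro ⟨rfl, h⟩
        refine ⟨by simp [mem_symmDiff, h], ?_⟩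
        ext k; simp only [mem_symmDiff, mem_erase, mem_singleton]
        by_cases hk : k = j <;> simp [hk, h]
    by_cases h : j ∈ S ∧ T = S.erase j
    · rw [if_pos h, if_pos (e.1 h)]
      have h' := (e.1 h).1
      rw [h']
      change star (sgn j _) = _
      rw [sgn_erase]; simp [sgn]
    · rw [if_neg h, if_neg (fun h' => h (e.2 h'))]; simp
  have key2 : ∀ j : Fin n, (annihilation j : FockOp n) S T =
      if S = symmDiff T {j} ∧ j ∈ T then sgn j T else 0 := by
    intro j
    simp only [annihilation, Matrix.of_apply]
    have e : (j ∈ T ∧ S = T.erase j) ↔ (S = symmDiff T {j} ∧ j ∈ T) := by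
      rw [and_comm]
      refine and_congr_left fun h => ?_
      have : T.erase j = symmDiff T {j} := by
        ext k; simp only [mem_symmDiff, mem_erase, mem_singleton]
        by_cases hk : k = j <;> simp [hk, h]
      rw [this]
    simp only [e]; rfl
  simp only [majorana, phase_def]
  by_cases hx : x.val % 2 = 0
  · simp only [hx, if_true, Matrix.add_apply, key, key2]
    by_cases h : S = symmDiff T {modeOf x} <;> by_cases h2 : modeOf x ∈ T <;> simp [h, h2]
  · simp only [hx, if_false, Matrix.smul_apply, Matrix.sub_apply, key, key2]
    by_cases h : S = symmDiff T {modeOf x} <;> by_cases h2 : modeOf x ∈ T <;> simp [h, h2, mul_comm]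

lemma majorana_mul_apply {n : ℕ} (x y : Fin (2 * n)) (S T : Finset (Fin n)) :
    (majorana x * majorana y) S T = if S = symmDiff (symmDiff T {modeOf y}) {modeOf x} then
      phase x (symmDiff T {modeOf y}) * phase y T else 0 := by
  rw [Matrix.mul_apply, Finset.sum_eq_single (symmDiff T {modeOf y})]
  · simp only [majorana_apply, if_true]; split_ifs <;> simp
  · intro b _ hb; simp [majorana_apply, hb]
  · simp

lemma sgn_mul_self {n : ℕ} (j : Fin n) (T : Finset (Fin n)) : sgn j T * sgn j T = 1 := by
  unfold sgn; rw [← mul_pow]; simp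

lemma sgn_ge {n : ℕ} {j m : Fin n} (h : j ≤ m) (T : Finset (Fin n)) :
    sgn j (symmDiff T {m}) = sgn j T := by
  unfold sgn
  congr 2
  ext k
  simp only [mem_filter, mem_symmDiff, mem_singleton]
  refine and_congr_left fun h2 => ?_
  have := (h2.trans_le h).ne; tauto

lemma sgn_lt {n : ℕ} {j m : Fin n} (h : m < j) (T : Finset (Fin n)) :
    sgn j (symmDiff T {m}) = - sgn j T := by
  unfold sgn
  by_cases hm : m ∈ T
  · have e : T.filter (fun k => k < j) = insert m ((symmDiff T {m}).filter (fun k => k < j)) := by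
      ext k
      simp only [mem_filter, mem_symmDiff, mem_singleton, mem_insert]
      by_cases hk : k = m <;> simp [hk, h, hm]
    rw [e, card_insert_of_notMem (by simp [mem_symmDiff, hm]), pow_succ]; ring
  · have e : (symmDiff T {m}).filter (fun k => k < j) = insert m (T.filter (fun k => k < j)) := by
      ext k
      simp only [mem_filter, mem_symmDiff, mem_singleton, mem_insert]
      by_cases hk : k = m <;> simp [hk, h, hm]
    rw [e, card_insert_of_notMem (by simp [hm]), pow_succ]; ring

lemma majorana_sq {n : ℕ} (x : Fin (2 * n)) : (majorana x * majorana x : FockOp n) = 1 := by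
  ext S T
  rw [majorana_mul_apply, symmDiff_symmDiff_cancel_right, Matrix.one_apply]
  split_ifs with h
  · rw [phase_def, phase_def, sgn_erase]
    have := sgn_mul_self (modeOf x) T
    by_cases hx : x.val % 2 = 0
    · simp [hx, this]
    · by_cases h2 : modeOf x ∈ T <;> simp [hx, h2, mem_symmDiff] <;> ring_nf <;>
        simp [sq, this]
  · rfl

lemma majorana_anticomm {n : ℕ} {x y : Fin (2 * n)} (hxy : x ≠ y) :
    (majorana x * majorana y : FockOp n) = - (majorana y * majorana x) := by
  wlog hlt : x < y generalizing x y
  · rw [this hxy.symm (lt_of_le_of_ne (not_lt.1 hlt) hxy.symm), neg_neg]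
  ext S T
  rw [Matrix.neg_apply, majorana_mul_apply, majorana_mul_apply, symmDiff_right_comm]
  split_ifs with h
  swap; · simp
  have hle : modeOf x ≤ modeOf y := by
    show x.val / 2 ≤ y.val / 2
    exact Nat.div_le_div_right hlt.le
  rcases hle.eq_or_lt with he | hl
  · have h0 : x.val / 2 = y.val / 2 := congrArg Fin.val he
    have h1 : x.val < y.val := hlt
    have hx : x.val % 2 = 0 := by omega
    have hy : ¬ y.val % 2 = 0 := by omega
    simp only [phase_def, he, sgn_erase, hx, hy, if_true, if_false]
    by_cases h2 : modeOf y ∈ T <;> simp [h2, mem_symmDiff] <;> ring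
  · have e1 := sgn_ge hl.le T
    have e2 := sgn_lt hl T
    simp only [phase_def, e1, e2, mem_symmDiff, mem_singleton, hl.ne, hl.ne', not_false_eq_true, and_true, or_false, false_and]
    ring

lemma majorana_mul_list {n : ℕ} (x : Fin (2 * n)) (l : List (Fin (2 * n))) :
    (majorana x * (l.map majorana).prod : FockOp n) =
      (-1 : ℂ) ^ (l.length + l.count x) • ((l.map majorana).prod * majorana x) := by
  induction l with
  | nil => simp
  | cons y l ih =>
    simp only [List.map_cons, List.prod_cons, List.length_cons]
    by_cases h : x = y
    · subst h
      rw [List.count_cons_self, mul_assoc, ih, mul_smul_comm]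
      congr 1
      ring
    · rw [List.count_cons_of_ne (Ne.symm h), ← mul_assoc, majorana_anticomm h, neg_mul, mul_assoc, ih, mul_smul_comm,
        mul_assoc, ← neg_smul]
      congr 1
      ring

lemma list_sq {n : ℕ} (l : List (Fin (2 * n))) (hl : l.Nodup) :
    ((l.map majorana).prod * (l.map majorana).prod : FockOp n) =
      (-1 : ℂ) ^ (l.length * (l.length - 1) / 2) • 1 := by
  induction l with
  | nil => simp
  | cons y l ih =>
    have hy := (List.nodup_cons.1 hl)
    have h := majorana_mul_list y l
    rw [List.count_eq_zero_of_not_mem hy.1, add_zero] at h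
    simp only [List.map_cons, List.prod_cons, List.length_cons]
    have h2 : ((l.map majorana).prod * majorana y : FockOp n) =
        (-1 : ℂ) ^ l.length • (majorana y * (l.map majorana).prod) := by
      rw [h, smul_smul, ← mul_pow]; simp
    rw [mul_assoc, ← mul_assoc _ (majorana y), h2, smul_mul_assoc, mul_smul_comm, mul_assoc, ih hy.2, ← mul_assoc,
      majorana_sq, one_mul, smul_smul, ← pow_add]
    congr 2
    rw [Nat.triangle_succ, add_comm]

lemma string_sq {n : ℕ} (X : Finset (Fin (2 * n))) :
    (majoranaString X * majoranaString X : FockOp n) = 1 := by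
  unfold majoranaString
  rw [smul_mul_smul_comm, list_sq _ (X.sort_nodup _), smul_smul, length_sort]
  obtain ⟨q, r, hr, hc⟩ : ∃ q r, r < 4 ∧ X.card = 4 * q + r :=
    ⟨X.card / 4, X.card % 4, Nat.mod_lt _ (by norm_num), (Nat.div_add_mod _ _).symm⟩
  have hr4 : X.card % 4 = r := by omega
  have hpar : (X.card * (X.card - 1) / 2) % 2 = if r = 0 ∨ r = 1 then 0 else 1 := by
    rw [hc]
    interval_cases r
    · rcases q with _ | q
      · simp
      · have : (4 * (q + 1) + 0) * (4 * (q + 1) + 0 - 1) = 2 * (2 * ((q + 1) * (4 * q + 3))) := by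
          rw [show 4 * (q + 1) + 0 - 1 = 4 * q + 3 by omega]; ring
        rw [this, Nat.mul_div_cancel_left _ (by norm_num)]; simp
    · have : (4 * q + 1) * (4 * q + 1 - 1) = 2 * (2 * ((4 * q + 1) * q)) := by
        rw [show 4 * q + 1 - 1 = 4 * q by omega]; ring
      rw [this, Nat.mul_div_cancel_left _ (by norm_num)]; simp
    · have : (4 * q + 2) * (4 * q + 2 - 1) = 2 * (2 * (4 * q * q + 3 * q) + 1) := by
        rw [show 4 * q + 2 - 1 = 4 * q + 1 by omega]; ring
      rw [this, Nat.mul_div_cancel_left _ (by norm_num)]; simp [Nat.add_mod]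
    · have : (4 * q + 3) * (4 * q + 3 - 1) = 2 * (2 * (4 * q * q + 5 * q + 1) + 1) := by
        rw [show 4 * q + 3 - 1 = 4 * q + 2 by omega]; ring
      rw [this, Nat.mul_div_cancel_left _ (by norm_num)]; simp [Nat.add_mod]
  rw [hr4]
  by_cases h : r = 0 ∨ r = 1
  · rw [if_pos h] at hpar ⊢
    rw [Even.neg_one_pow (Nat.even_iff.2 hpar)]; simp
  · rw [if_neg h] at hpar ⊢
    rw [Odd.neg_one_pow (Nat.odd_iff.2 hpar)]; simp

lemma ntrace_string_mul {n : ℕ} {X Y : Finset (Fin (2 * n))} (h : X ≠ Y) :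
    ntrace (majoranaString X * majoranaString Y : FockOp n) = 0 := by
  have hex : ∃ x : Fin (2 * n), Odd (X.card + Y.card + (X.sort (· ≤ ·)).count x + (Y.sort (· ≤ ·)).count x) := by
    have hc : ∀ (Z : Finset (Fin (2 * n))) x, (Z.sort (· ≤ ·)).count x = if x ∈ Z then 1 else 0 := by
      intro Z x
      rw [List.Nodup.count (Z.sort_nodup _)]; simp
    simp only [hc]
    have hs : (symmDiff X Y).card + 2 * (X ∩ Y).card = X.card + Y.card := by
      rw [symmDiff_def, sup_eq_union, card_union_of_disjoint disjoint_sdiff_sdiff]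
      have := card_sdiff_add_card_inter X Y
      have := card_sdiff_add_card_inter Y X
      rw [inter_comm Y X] at this
      omega
    by_cases ho : Odd (X.card + Y.card)
    · have : symmDiff X Y ≠ univ := by
        intro hu; rw [hu, card_univ, Fintype.card_fin] at hs
        rw [← hs] at ho
        rw [Nat.odd_iff] at ho; omega
      obtain ⟨x, hx⟩ : ∃ x, x ∉ symmDiff X Y := by
        by_contra hcon; push Not at hcon; exact this (eq_univ_iff_forall.2 hcon)
      refine ⟨x, ?_⟩
      rw [mem_symmDiff] at hx
      rw [Nat.odd_iff] at ho ⊢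
      split_ifs <;> first | omega | tauto
    · obtain ⟨x, hx⟩ : (symmDiff X Y).Nonempty := by
        rw [nonempty_iff_ne_empty]; simpa using h
      refine ⟨x, ?_⟩
      rw [mem_symmDiff] at hx
      rw [Nat.odd_iff] at ho ⊢
      split_ifs <;> first | omega | tauto
  obtain ⟨x, hx⟩ := hex
  set P : FockOp n := ((X.sort (· ≤ ·) ++ Y.sort (· ≤ ·)).map majorana).prod with hP
  have h1 : majorana x * P = - (P * majorana x) := by
    rw [hP, majorana_mul_list, Odd.neg_one_pow]
    · simp
    · simpa [List.count_append, add_assoc] using hx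
  have h2 : P.trace = 0 := by
    have : (majorana x * P * majorana x).trace = - P.trace := by
      rw [h1, neg_mul, mul_assoc, majorana_sq, mul_one, Matrix.trace_neg]
    rw [Matrix.trace_mul_comm, ← mul_assoc, majorana_sq, one_mul] at this
    exact self_eq_neg.1 this
  unfold majoranaString ntrace
  rw [smul_mul_smul_comm, ← List.prod_append, ← List.map_append, Matrix.trace_smul, ← hP, h2]; simp

/-- Uniqueness of the expansion in Majorana strings. -/
lemma coeff_unique {n : ℕ} (b : Finset (Fin (2 * n)) → ℂ) (X : Finset (Fin (2 * n))) :
    coeff (∑ Y, b Y • majoranaString Y : FockOp n) X = b X := by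
  have : coeff (∑ Y, b Y • majoranaString Y : FockOp n) X =
      ∑ Y, b Y * ntrace (majoranaString X * majoranaString Y : FockOp n) := by
    simp [coeff, ntrace, Matrix.mul_sum, Matrix.trace_sum, Finset.sum_div, mul_div_assoc]
  rw [this, Finset.sum_eq_single X]
  · rw [string_sq]; simp [ntrace, Matrix.trace_one]
  · intro Y _ hY; rw [ntrace_string_mul hY.symm, mul_zero]
  · simp

/-- Existence of the expansion: `A = ∑_X a_X γ_X` with `a_X = coeff A X`. -/
lemma sum_coeff_smul {n : ℕ} (A : FockOp n) : ∑ X, coeff A X • majoranaString X = A := by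
  have li : LinearIndependent ℂ (majoranaString : Finset (Fin (2 * n)) → FockOp n) := by
    rw [Fintype.linearIndependent_iff]
    intro g hg X
    rw [← coeff_unique g X, hg]; simp [coeff, ntrace]
  have hc : Fintype.card (Finset (Fin (2 * n))) = Module.finrank ℂ (FockOp n) := by
    rw [Module.finrank_matrix]; simp; ring
  have hs := li.span_eq_top_of_card_eq_finrank' hc
  have hA : A ∈ Submodule.span ℂ (Set.range (majoranaString : Finset (Fin (2 * n)) → FockOp n)) := by
    rw [hs]; trivial
  obtain ⟨b, rfl⟩ := (Submodule.mem_span_range_iff_exists_fun ℂ).1 hA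
  simp only [coeff_unique]

end Expansion

/-- The degree of `A`: the largest `|X|` with `a_X ≠ 0` (and `0` if `A = 0`). -/
def degree {n : ℕ} (A : FockOp n) : ℕ :=
  (Finset.univ.filter (fun X : Finset (Fin (2 * n)) => coeff A X ≠ 0)).sup Finset.card

/-- `Trunc_ℓ (A) = ∑_{|X| ≤ ℓ} a_X γ_X`. -/
def trunc {n : ℕ} (ℓ : ℕ) (A : FockOp n) : FockOp n :=
  ∑ X : Finset (Fin (2 * n)) with X.card ≤ ℓ, coeff A X • majoranaString X

/-! ### Hamiltonians and their evolution -/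

/-- The operator `∑_X h_X γ_X` with coefficients `h`. -/
def hamiltonian {n : ℕ} (h : Finset (Fin (2 * n)) → ℂ) : FockOp n :=
  ∑ X, h X • majoranaString X

/-- The terms of the Hamiltonian: the sets `X` with `h_X ≠ 0`. -/
def terms {n : ℕ} (h : Finset (Fin (2 * n)) → ℂ) : Finset (Finset (Fin (2 * n))) :=
  Finset.univ.filter (fun X => h X ≠ 0)

/-- `∑_X h_X γ_X` is a Hamiltonian with quartic interactions: it is Hermitian, `|h_X| ≤ 1`, and all
its terms have degree two or four. -/
structure IsQuartic {n : ℕ} (h : Finset (Fin (2 * n)) → ℂ) : Prop where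
  hermitian : (hamiltonian h).IsHermitian
  norm_le_one : ∀ X, ‖h X‖ ≤ 1
  card_eq : ∀ X ∈ terms h, X.card = 2 ∨ X.card = 4

/-- `Δ`-sparsity: every Majorana mode is present in at most `Δ` terms. -/
def IsSparse {n : ℕ} (Δ : ℕ) (h : Finset (Fin (2 * n)) → ℂ) : Prop :=
  ∀ i : Fin (2 * n), ((terms h).filter (fun X => i ∈ X)).card ≤ Δ

/-- `c` partitions the terms into the groups `{X : c X = g}`, `g < G`, such that distinct terms of
the same group are disjoint. -/
def IsColouring {n : ℕ} (h : Finset (Fin (2 * n)) → ℂ) (G : ℕ)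
    (c : Finset (Fin (2 * n)) → ℕ) : Prop :=
  (∀ X ∈ terms h, c X < G) ∧
    ∀ X ∈ terms h, ∀ Y ∈ terms h, X ≠ Y → c X = c Y → Disjoint X Y

/-- The part `H^g` of the Hamiltonian that consists of the terms of colour `g`. -/
def groupHam {n : ℕ} (h : Finset (Fin (2 * n)) → ℂ) (c : Finset (Fin (2 * n)) → ℕ) (g : ℕ) :
    FockOp n :=
  ∑ X ∈ (terms h).filter (fun X => c X = g), h X • majoranaString X

/-- The Heisenberg evolution `e^{i s H} A e^{-i s H}`. -/
def evolve {n : ℕ} (H : FockOp n) (s : ℝ) (A : FockOp n) : FockOp n :=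
  NormedSpace.exp ((Complex.I * (s : ℂ)) • H) * A * NormedSpace.exp (-(Complex.I * (s : ℂ)) • H)

/-- The Trotter step: the evolution for time `s` under `H^0`, then under `H^1`, …, and finally under
`H^{G-1}`. -/
def trotter {n : ℕ} (h : Finset (Fin (2 * n)) → ℂ) (G : ℕ) (c : Finset (Fin (2 * n)) → ℕ)
    (s : ℝ) (A : FockOp n) : FockOp n :=
  (List.range G).foldl (fun B g => evolve (groupHam h c g) s B) A

/-- The output of Majorana Propagation: `⌊t/δt⌋` steps `Trunc_ℓ ∘ Trotter_{δt}`, then one step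
with the remaining time `t - ⌊t/δt⌋ δt` (which does nothing if `t/δt` is an integer, because the
observable then already has degree at most `ℓ`). -/
def majoranaPropagation {n : ℕ} (h : Finset (Fin (2 * n)) → ℂ) (G : ℕ)
    (c : Finset (Fin (2 * n)) → ℕ) (A : FockOp n) (t δt : ℝ) (ℓ : ℕ) : FockOp n :=
  trunc ℓ (trotter h G c (t - ⌊t / δt⌋₊ * δt)
    ((fun B => trunc ℓ (trotter h G c δt B))^[⌊t / δt⌋₊] A))

/-- `max_{s ∈ [0,t]} min_{deg P ≤ ℓ} ‖P - A(s)‖_F`: the error of the best degree-`ℓ`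
approximation, where `A(s)` is the evolution of `A` under `H`. For `t ≥ 0` the index sets are
non-empty and the values lie in `[0, ‖A‖_F]`. -/
def bestError {n : ℕ} (H A : FockOp n) (t : ℝ) (ℓ : ℕ) : ℝ :=
  ⨆ s : Set.Icc (0 : ℝ) t, ⨅ P : {P : FockOp n // degree P ≤ ℓ},
    frobNorm (P.1 - evolve H s.1 A)

/-! ### The machine model

Programs of a finite first-order language that act on S-expressions (binary trees) whose atoms are
real numbers. This is a WHILE language on trees with unit-cost exact real arithmetic: one step is
one constructor or projection, one real operation (`0`, `1`, `+`, `-`, `*`, `cos`, `sin`, `≤`), or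
one control step. -/

/-- The data: S-expressions with real atoms. -/
inductive Value : Type
  | nil : Value
  | num : ℝ → Value
  | cons : Value → Value → Value

/-- The programs. A program is a finite object, and its only numerical constants are `0` and `1`. -/
inductive Program : Type
  | id : Program
  | nil : Program
  | zero : Program
  | one : Program
  | fst : Program
  | snd : Program
  | add : Program
  | sub : Program
  | mul : Program
  | cos : Program
  | sin : Program
  | le : Program
  | pair : Program → Program → Program
  | comp : Program → Program → Program
  | cond : Program → Program → Program → Program
  | loop : Program → Program → Program

/-- `Runs p v w k`: the program `p`, started on `v`, halts with the result `w` after exactly `k`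
steps. `nil` plays the role of the truth value `false`. A program that applies an operation to data
of the wrong shape is stuck. -/
inductive Runs : Program → Value → Value → ℕ → Prop
  | id (v : Value) : Runs .id v v 1
  | nil (v : Value) : Runs .nil v .nil 1
  | zero (v : Value) : Runs .zero v (.num 0) 1
  | one (v : Value) : Runs .one v (.num 1) 1
  | fst (a b : Value) : Runs .fst (.cons a b) a 1
  | snd (a b : Value) : Runs .snd (.cons a b) b 1
  | add (x y : ℝ) : Runs .add (.cons (.num x) (.num y)) (.num (x + y)) 1
  | sub (x y : ℝ) : Runs .sub (.cons (.num x) (.num y)) (.num (x - y)) 1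
  | mul (x y : ℝ) : Runs .mul (.cons (.num x) (.num y)) (.num (x * y)) 1
  | cos (x : ℝ) : Runs .cos (.num x) (.num (Real.cos x)) 1
  | sin (x : ℝ) : Runs .sin (.num x) (.num (Real.sin x)) 1
  | le_true (x y : ℝ) : x ≤ y → Runs .le (.cons (.num x) (.num y)) (.num 1) 1
  | le_false (x y : ℝ) : ¬ x ≤ y → Runs .le (.cons (.num x) (.num y)) .nil 1
  | pair {p q : Program} {v a b : Value} {i j : ℕ} :
      Runs p v a i → Runs q v b j → Runs (.pair p q) v (.cons a b) (i + j + 1)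
  | comp {p q : Program} {v a b : Value} {i j : ℕ} :
      Runs p v a i → Runs q a b j → Runs (.comp q p) v b (i + j + 1)
  | cond_true {c p q : Program} {v r a : Value} {i j : ℕ} :
      Runs c v r i → r ≠ .nil → Runs p v a j → Runs (.cond c p q) v a (i + j + 1)
  | cond_false {c p q : Program} {v a : Value} {i j : ℕ} :
      Runs c v .nil i → Runs q v a j → Runs (.cond c p q) v a (i + j + 1)
  | loop_done {c b : Program} {v : Value} {i : ℕ} :
      Runs c v .nil i → Runs (.loop c b) v v (i + 1)
  | loop_step {c b : Program} {v r w u : Value} {i j k : ℕ} :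
      Runs c v r i → r ≠ .nil → Runs b v w j → Runs (.loop c b) w u k →
        Runs (.loop c b) v u (i + j + k + 1)

/-! ### Encoding of inputs and outputs -/

/-- A finite list as an S-expression. -/
def encodeList {α : Type} (f : α → Value) : List α → Value
  | [] => .nil
  | a :: l => .cons (f a) (encodeList f l)

/-- A set of Majorana modes is written as the increasing list of its elements. -/
def encodeSet {n : ℕ} (X : Finset (Fin (2 * n))) : Value :=
  encodeList (fun x : Fin (2 * n) => .num (x.val : ℝ)) (X.sort (· ≤ ·))

/-- A Majorana polynomial is written as a list of pairs of a set of modes and a coefficient, the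
latter given by its real and imaginary parts. -/
def encodePoly {n : ℕ} (L : List (Finset (Fin (2 * n)) × ℂ)) : Value :=
  encodeList (fun m : Finset (Fin (2 * n)) × ℂ =>
    .cons (encodeSet m.1) (.cons (.num m.2.re) (.num m.2.im))) L

/-- `L` lists, in some order and each exactly once, the pairs `(X, a_X)` with `a_X ≠ 0`. -/
def IsMonomialList {n : ℕ} (L : List (Finset (Fin (2 * n)) × ℂ))
    (a : Finset (Fin (2 * n)) → ℂ) : Prop :=
  L.Nodup ∧ ∀ X z, (X, z) ∈ L ↔ z = a X ∧ z ≠ 0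

/-- The input `(N, H, A, t, δt, ℓ)` of the algorithm, with `N = 2 n`. -/
def encodeInput {n : ℕ} (LH LA : List (Finset (Fin (2 * n)) × ℂ)) (t δt : ℝ) (ℓ : ℕ) : Value :=
  .cons (.num ((2 * n : ℕ) : ℝ)) (.cons (encodePoly LH) (.cons (encodePoly LA)
    (.cons (.num t) (.cons (.num δt) (.num (ℓ : ℝ))))))

end MajoranaProp

end

/-! # Running time and error of Majorana Propagation

**The error bound.** Write `𝓛_K = i [K, ·]` for the generator of the Heisenberg evolution under `K`.
The Majorana strings are an orthonormal basis for the normalized trace, and up to a phase `γ_X γ_Y`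
is `γ_{X ∆ Y}`. In this basis, `𝓛_K` has entries of modulus at most `2`, between `Y` and `X ∆ Y` for
the terms `X` of `K` that meet `Y` in an odd number of modes. As `|X| ≤ 4`, such a term adds at most
two modes, and if every mode lies in at most `κ` terms, then at most `κ |Y|` of them occur. By the
Schur test, `𝓛_K` has norm at most `2 κ (d + 1)` on operators of degree at most `d`
(`frobNorm_adj_le`).

Taylor's formula compares both the exact evolution and the product of the evolutions under the
groups of a colouring with `1 + s 𝓛_H` (`frobNorm_evolve_sub_sub_le`,
`frobNorm_evolveList_sub_sub_le`). The remainders contain only products of two generators, which can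
be arranged to act on the operator before any (isometric) evolution, that is, on operators of degree
at most `ℓ` and `ℓ + 2`. The groups have `κ = 1` and the full Hamiltonian has `κ = Δ`; with `4 Δ`
groups the two remainders contribute `32` and `2` to the constant `34` of
`frobNorm_trotter_sub_evolve_le`. Truncation is an orthogonal projection: it does not amplify
earlier errors, and on the exact evolution its error is at most the best approximation error. The
errors of the steps therefore add up (`frobNorm_majoranaPropagation_sub_le`).

**The running time.** The terms within a group commute, so that a Trotter step is a product of
rotations, each generated by one string; on a string such a rotation is the identity or gives
`cos φ γ_Y ± sin φ γ_{X ∆ Y}` (`evolve_string`). Polynomials are lists of monomials with distinct sets, and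
everything is a fold over lists, down to the product of two strings, which toggles the modes of the
one in the increasing list of the other. The lists stay short: only the terms of a group that meet a
string can enlarge it, so that a group at most triples the degree (`spread_flatten_le`), and during
a step all degrees are at most `3 ^ (4 Δ) ℓ`. Hence the lists have length at most
`(N + 1) ^ (3 ^ (4 Δ) ℓ)`. A colouring is found by repeatedly splitting off a maximal family of disjoint terms; a term
that is left over meets a term of every family so far, and since it meets at most `4 Δ` terms
including itself, at most `4 Δ` families arise (`selectRound_iterate`, `exists_colouring`). The
programs are verified with the relation `Ev`, which bounds the number of steps from above. -/

noncomputable section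

namespace MajoranaProp

open Finset

/-! ### Toggling an index in an increasing list -/

/-- Toggle the membership of `x` in an increasing list. -/
def toggle {α : Type*} [LinearOrder α] (x : α) : List α → List α
  | [] => [x]
  | y :: l => if x ≤ y then (if y ≤ x then l else x :: y :: l) else y :: toggle x l

/-- The sign `(-1)^k`, where `k` is the number of elements of an increasing list that precede
`x`. -/
def toggleSign {α : Type*} [LinearOrder α] (x : α) : List α → ℝ
  | [] => 1
  | y :: l => if x ≤ y then 1 else -toggleSign x l

/-- `1` if toggling `x` removes an element of the increasing list, and `0` if it adds one. -/
def toggleCount {α : Type*} [LinearOrder α] (x : α) : List α → ℕ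
  | [] => 0
  | y :: l => if x ≤ y then (if y ≤ x then 1 else 0) else toggleCount x l

/-- The ordered product of the Majorana operators of a list of modes. -/
def majProd {n : ℕ} (l : List (Fin (2 * n))) : FockOp n := (l.map majorana).prod

lemma toggleSign_sq {α : Type*} [LinearOrder α] (x : α) (l : List α) :
    toggleSign x l * toggleSign x l = 1 := by
  induction l with
  | nil => simp [toggleSign]
  | cons y l ih => simp only [toggleSign]; split_ifs <;> simp [ih]

lemma majorana_mul_majProd {n : ℕ} (x : Fin (2 * n)) (l : List (Fin (2 * n))) :
    majorana x * majProd l = (toggleSign x l : ℂ) • majProd (toggle x l) := by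
  induction l with
  | nil => simp [majProd, toggle, toggleSign]
  | cons y l ih =>
    simp only [toggle, toggleSign]
    split_ifs with h1 h2
    · obtain rfl := le_antisymm h1 h2
      simp [majProd, ← mul_assoc, majorana_sq]
    · simp [majProd]
    · have hne : x ≠ y := fun h => h1 h.le
      have e : ∀ l', majProd (y :: l') = majorana y * majProd l' := fun l' => by simp [majProd]
      rw [e, e, ← mul_assoc, majorana_anticomm hne, neg_mul, mul_assoc, ih]
      simp

lemma toggle_spec {α : Type*} [LinearOrder α] (x : α) (l : List α) (hl : l.Pairwise (· < ·)) :
    (toggle x l).Pairwise (· < ·) ∧ (∀ z, z ∈ toggle x l ↔ (z ∈ l ∧ z ≠ x ∨ z = x ∧ x ∉ l)) ∧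
      toggleCount x l = if x ∈ l then 1 else 0 := by
  induction l with
  | nil => simp [toggle, toggleCount]
  | cons y l ih =>
    obtain ⟨hy, hl'⟩ := List.pairwise_cons.1 hl
    clear hl
    obtain ⟨i1, i2, i3⟩ := ih hl'
    simp only [toggle, toggleCount]
    by_cases h1 : x ≤ y
    · rw [if_pos h1]
      by_cases h2 : y ≤ x
      · obtain rfl := le_antisymm h1 h2
        simp only [le_refl, if_true, List.mem_cons, true_or, not_true, and_false, or_false]
        refine ⟨hl', fun z => ⟨fun hz => ⟨Or.inr hz, (hy z hz).ne'⟩, ?_⟩, trivial⟩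
        rintro ⟨rfl | h, h'⟩
        · exact absurd rfl h'
        · exact h
      · have hlt : x < y := lt_of_not_ge h2
        have hx : x ∉ l := fun hx => (hlt.trans (hy x hx)).false
        simp only [h1, h2, if_true, if_false, List.mem_cons, hlt.ne, hx, or_self]
        refine ⟨?_, fun z => ?_, trivial⟩
        · refine List.pairwise_cons.2 ⟨?_, List.pairwise_cons.2 ⟨hy, hl'⟩⟩
          intro a ha
          rcases List.mem_cons.1 ha with rfl | ha
          · exact hlt
          · exact hlt.trans (hy a ha)
        · constructor
          · rintro (rfl | rfl | h)
            · simp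
            · left; exact ⟨Or.inl rfl, hlt.ne'⟩
            · left; exact ⟨Or.inr h, fun e => hx (e ▸ h)⟩
          · tauto
    · have hlt : y < x := lt_of_not_ge h1
      simp only [h1, if_false, List.mem_cons, hlt.ne', false_or]
      refine ⟨List.pairwise_cons.2 ⟨fun a ha => ?_, i1⟩, fun z => ?_, i3⟩
      · rcases (i2 a).1 ha with ⟨h, _⟩ | ⟨rfl, _⟩
        · exact hy a h
        · exact hlt
      · rw [i2]
        constructor
        · rintro (rfl | h | h)
          · left; exact ⟨Or.inl rfl, hlt.ne⟩
          · tauto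
          · tauto
        · tauto

lemma toggle_sort {n : ℕ} (x : Fin (2 * n)) (Y : Finset (Fin (2 * n))) :
    toggle x (Y.sort (· ≤ ·)) = (symmDiff Y {x}).sort (· ≤ ·) ∧
      toggleCount x (Y.sort (· ≤ ·)) = if x ∈ Y then 1 else 0 := by
  obtain ⟨h1, h2, h3⟩ := toggle_spec x (Y.sort (· ≤ ·)) (Y.sortedLT_sort).pairwise
  refine ⟨?_, by simpa using h3⟩
  have : (toggle x (Y.sort (· ≤ ·))).toFinset = symmDiff Y {x} := by
    ext z
    simp only [List.mem_toFinset, h2, mem_sort, mem_symmDiff, mem_singleton]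
    by_cases hz : z = x
    · subst hz; simp
    · simp [hz]
  rw [← this]
  exact ((List.toFinset_sort (r := (· ≤ ·)) (h1.imp ne_of_lt)).2 (h1.imp le_of_lt)).symm

/-! ### Multiplication of Majorana strings -/

/-- Toggle all elements of a list, one after the other, and record the accumulated sign and the
number of removals. -/
def toggleList {α : Type*} [LinearOrder α] (lx : List α) (st : List α × ℝ × ℕ) :
    List α × ℝ × ℕ :=
  lx.foldl (fun st x => (toggle x st.1, st.2.1 * toggleSign x st.1, st.2.2 + toggleCount x st.1)) st

/-- The sign `s` with `(∏_{x ∈ X} γ_x)^* (∏_{y ∈ Y} γ_y) = s ∏_{z ∈ X ∆ Y} γ_z`. -/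
def mulSign {n : ℕ} (X Y : Finset (Fin (2 * n))) : ℝ :=
  (toggleList (X.sort (· ≤ ·)) (Y.sort (· ≤ ·), 1, 0)).2.1

/-- Multiplying by the modes of `lx` from the left, one at a time, toggles them in the list; the
first mode of `lx` acts first, whence the reversal. -/
lemma majProd_reverse_mul {n : ℕ} (lx : List (Fin (2 * n))) (st : List (Fin (2 * n)) × ℝ × ℕ) :
    (st.2.1 : ℂ) • (majProd lx.reverse * majProd st.1) =
      ((toggleList lx st).2.1 : ℂ) • majProd (toggleList lx st).1 := by
  induction lx generalizing st with
  | nil => simp [toggleList, majProd]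
  | cons x lx ih =>
    have e : majProd (x :: lx).reverse = majProd lx.reverse * majorana x := by simp [majProd]
    rw [e, mul_assoc, majorana_mul_majProd]
    have := ih (toggle x st.1, st.2.1 * toggleSign x st.1, st.2.2 + toggleCount x st.1)
    rw [show toggleList (x :: lx) st = toggleList lx (toggle x st.1, st.2.1 * toggleSign x st.1,
      st.2.2 + toggleCount x st.1) from rfl, ← this]
    simp only [mul_smul_comm, smul_smul, Complex.ofReal_mul]

lemma toggleList_sort {n : ℕ} (lx : List (Fin (2 * n))) (hlx : lx.Nodup)
    (Y : Finset (Fin (2 * n))) (s : ℝ) (m : ℕ) :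
    (toggleList lx (Y.sort (· ≤ ·), s, m)).1 = (symmDiff lx.toFinset Y).sort (· ≤ ·) ∧
      (toggleList lx (Y.sort (· ≤ ·), s, m)).2.2 = m + (lx.toFinset ∩ Y).card ∧
      (toggleList lx (Y.sort (· ≤ ·), s, m)).2.1 * (toggleList lx (Y.sort (· ≤ ·), s, m)).2.1
        = s * s := by
  induction lx generalizing Y s m with
  | nil => exact ⟨congrArg (Finset.sort · (· ≤ ·)) (by ext; simp [mem_symmDiff]),
      by simp [toggleList], rfl⟩
  | cons x lx ih =>
    obtain ⟨hx, hlx⟩ := List.nodup_cons.1 hlx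
    have := ih hlx (symmDiff Y {x}) (s * toggleSign x (Y.sort (· ≤ ·)))
      (m + if x ∈ Y then 1 else 0)
    have e : toggleList (x :: lx) (Y.sort (· ≤ ·), s, m) = toggleList lx
      ((symmDiff Y {x}).sort (· ≤ ·), s * toggleSign x (Y.sort (· ≤ ·)),
        m + if x ∈ Y then 1 else 0) := by
      rw [← (toggle_sort x Y).1, ← (toggle_sort x Y).2]; rfl
    rw [e]
    refine ⟨?_, ?_, ?_⟩
    · rw [this.1]; congr 1
      ext z
      simp only [List.toFinset_cons, mem_symmDiff, mem_insert, mem_singleton, List.mem_toFinset]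
      by_cases hz : z = x
      · subst hz; simp [hx]
      · simp [hz]
    · rw [this.2.1, add_assoc]; congr 1
      have e2 : lx.toFinset ∩ symmDiff Y {x} = lx.toFinset ∩ Y := by
        ext z
        simp only [mem_inter, List.mem_toFinset, mem_symmDiff, mem_singleton]
        by_cases hz : z = x
        · subst hz; simp [hx]
        · simp [hz]
      rw [e2, List.toFinset_cons]
      by_cases hY : x ∈ Y
      · rw [insert_inter_of_mem hY, card_insert_of_notMem (by simp [hx]), if_pos hY, add_comm]
      · rw [insert_inter_of_notMem hY, if_neg hY, zero_add]
    · rw [this.2.2]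
      have := toggleSign_sq x (Y.sort (· ≤ ·))
      linear_combination s * s * this

lemma toggleList_finset {n : ℕ} (X Y : Finset (Fin (2 * n))) :
    toggleList (X.sort (· ≤ ·)) (Y.sort (· ≤ ·), 1, 0) =
      ((symmDiff X Y).sort (· ≤ ·), mulSign X Y, (X ∩ Y).card) := by
  obtain ⟨h1, h2, -⟩ := toggleList_sort (X.sort (· ≤ ·)) (X.sort_nodup _) Y 1 0
  rw [sort_toFinset] at h1 h2
  refine Prod.ext h1 (Prod.ext rfl ?_)
  rw [h2, zero_add]

lemma mulSign_sq {n : ℕ} (X Y : Finset (Fin (2 * n))) : mulSign X Y * mulSign X Y = 1 := by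
  have := (toggleList_sort (X.sort (· ≤ ·)) (X.sort_nodup _) Y 1 0).2.2
  simpa [mulSign] using this

/-- The exponent `r_X` of the Majorana string `γ_X`, as a function of `|X|`. -/
def phaseExp (k : ℕ) : ℕ := if k % 4 = 0 ∨ k % 4 = 1 then 0 else 1

lemma majoranaString_eq {n : ℕ} (X : Finset (Fin (2 * n))) :
    majoranaString X = (Complex.I ^ phaseExp X.card) • majProd (X.sort (· ≤ ·)) := by
  unfold majoranaString phaseExp majProd
  split_ifs <;> simp

lemma majProd_mul_reverse {n : ℕ} (l : List (Fin (2 * n))) :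
    majProd l * majProd l.reverse = 1 := by
  induction l with
  | nil => simp [majProd]
  | cons x l ih =>
    have e1 : majProd (x :: l) = majorana x * majProd l := by simp [majProd]
    have e2 : majProd (x :: l).reverse = majProd l.reverse * majorana x := by simp [majProd]
    rw [e1, e2, mul_assoc, ← mul_assoc (majProd l), ih, one_mul, majorana_sq]

/-- The Majorana strings are Hermitian, written with the reversed product. -/
lemma majoranaString_eq_reverse {n : ℕ} (X : Finset (Fin (2 * n))) :
    majoranaString X =
      ((-Complex.I) ^ phaseExp X.card) • majProd (X.sort (· ≤ ·)).reverse := by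
  set R := ((-Complex.I) ^ phaseExp X.card) • majProd (X.sort (· ≤ ·)).reverse with hR
  have h1 : majoranaString X * R = 1 := by
    rw [majoranaString_eq, hR, smul_mul_smul_comm, majProd_mul_reverse, ← mul_pow]
    simp
  calc majoranaString X = majoranaString X * (majoranaString X * R) := by rw [h1, mul_one]
    _ = R := by rw [← mul_assoc, string_sq, one_mul]

lemma majorana_isHermitian {n : ℕ} (x : Fin (2 * n)) : (majorana x : FockOp n)ᴴ = majorana x := by
  simp only [majorana]
  split_ifs
  · rw [Matrix.conjTranspose_add, add_comm]; simp [creation]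
  · rw [Matrix.conjTranspose_smul, Matrix.conjTranspose_sub]
    simp only [creation, Matrix.conjTranspose_conjTranspose, Complex.star_def, Complex.conj_I,
      neg_smul, ← smul_neg, neg_sub]

lemma majProd_conjTranspose {n : ℕ} (l : List (Fin (2 * n))) :
    (majProd l)ᴴ = majProd l.reverse := by
  induction l with
  | nil => simp [majProd]
  | cons x l ih =>
    have e1 : majProd (x :: l) = majorana x * majProd l := by simp [majProd]
    have e2 : majProd (x :: l).reverse = majProd l.reverse * majorana x := by simp [majProd]
    rw [e1, e2, Matrix.conjTranspose_mul, ih, majorana_isHermitian]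

lemma majoranaString_isHermitian {n : ℕ} (X : Finset (Fin (2 * n))) :
    (majoranaString X : FockOp n)ᴴ = majoranaString X := by
  conv_rhs => rw [majoranaString_eq_reverse]
  rw [majoranaString_eq, Matrix.conjTranspose_smul, majProd_conjTranspose]
  simp

/-- The phase in `γ_X γ_Y = mulPhase X Y • γ_{X ∆ Y}`. -/
def mulPhase {n : ℕ} (X Y : Finset (Fin (2 * n))) : ℂ :=
  (-Complex.I) ^ phaseExp X.card * Complex.I ^ phaseExp Y.card *
    (-Complex.I) ^ phaseExp (symmDiff X Y).card * mulSign X Y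

lemma majoranaString_mul {n : ℕ} (X Y : Finset (Fin (2 * n))) :
    (majoranaString X * majoranaString Y : FockOp n) =
      mulPhase X Y • majoranaString (symmDiff X Y) := by
  have h := majProd_reverse_mul (X.sort (· ≤ ·)) (Y.sort (· ≤ ·), 1, 0)
  rw [toggleList_finset] at h
  simp only [Complex.ofReal_one, one_smul] at h
  rw [majoranaString_eq_reverse X, majoranaString_eq Y, smul_mul_smul_comm, h,
    majoranaString_eq (symmDiff X Y), smul_smul, smul_smul, mulPhase]
  congr 1
  have : (-Complex.I) ^ phaseExp (symmDiff X Y).card * Complex.I ^ phaseExp (symmDiff X Y).card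
      = 1 := by rw [← mul_pow]; simp
  linear_combination -((-Complex.I) ^ phaseExp X.card * Complex.I ^ phaseExp Y.card
    * (mulSign X Y : ℂ)) * this

lemma norm_mulPhase {n : ℕ} (X Y : Finset (Fin (2 * n))) : ‖mulPhase X Y‖ = 1 := by
  have h : |mulSign X Y| = 1 := by
    have := mulSign_sq X Y
    rcases mul_self_eq_one_iff.1 this with h | h <;> rw [h] <;> simp
  simp [mulPhase, h]

lemma majProd_mul_comm {n : ℕ} (l : List (Fin (2 * n))) (l' : List (Fin (2 * n))) :
    majProd l * majProd l' = (-1 : ℂ) ^ (l.length * l'.length + (l.map (l'.count ·)).sum) •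
      (majProd l' * majProd l) := by
  induction l with
  | nil => simp [majProd]
  | cons x l ih =>
    have e1 : majProd (x :: l) = majorana x * majProd l := by simp [majProd]
    have h := majorana_mul_list x l'
    change majorana x * majProd l' = _ • (majProd l' * majorana x) at h
    rw [e1, mul_assoc, ih, mul_smul_comm, ← mul_assoc, h, smul_mul_assoc, smul_smul, mul_assoc]
    congr 1
    rw [← pow_add]; congr 1
    simp; ring

lemma majoranaString_comm {n : ℕ} (X Y : Finset (Fin (2 * n))) (hX : Even X.card) :
    (majoranaString X * majoranaString Y : FockOp n) =
      (-1 : ℂ) ^ (X ∩ Y).card • (majoranaString Y * majoranaString X) := by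
  have hc : ((X.sort (· ≤ ·)).map ((Y.sort (· ≤ ·)).count ·)).sum = (X ∩ Y).card := by
    have : ∀ x, (Y.sort (· ≤ ·)).count x = if x ∈ Y then 1 else 0 := by
      intro x; rw [List.Nodup.count (Y.sort_nodup _)]; simp
    simp only [this]
    rw [← List.sum_toFinset _ (X.sort_nodup _), sort_toFinset]
    simp
  rw [majoranaString_eq X, majoranaString_eq Y, smul_mul_smul_comm, smul_mul_smul_comm,
    majProd_mul_comm, hc, length_sort, length_sort, pow_add, (hX.mul_right _).neg_one_pow,
    one_mul, smul_smul, smul_smul]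
  congr 1; ring

/-! ### The Frobenius norm -/

/-- The coefficients in the Majorana string basis, as a vector with the Euclidean norm. -/
def coeffVec {n : ℕ} : FockOp n →ₗ[ℂ] EuclideanSpace ℂ (Finset (Fin (2 * n))) where
  toFun A := WithLp.toLp 2 (coeff A)
  map_add' A B := by
    ext X; simp [coeff, ntrace, mul_add, Matrix.trace_add, add_div]
  map_smul' c A := by
    ext X; simp [coeff, ntrace, Matrix.trace_smul, mul_div_assoc]

@[simp] lemma coeffVec_apply {n : ℕ} (A : FockOp n) (X : Finset (Fin (2 * n))) :
    coeffVec A X = coeff A X := rfl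

lemma coeff_add {n : ℕ} (A B : FockOp n) (X : Finset (Fin (2 * n))) :
    coeff (A + B) X = coeff A X + coeff B X := by simp [← coeffVec_apply]

lemma coeff_sub {n : ℕ} (A B : FockOp n) (X : Finset (Fin (2 * n))) :
    coeff (A - B) X = coeff A X - coeff B X := by simp [← coeffVec_apply]

lemma coeff_smul {n : ℕ} (c : ℂ) (A : FockOp n) (X : Finset (Fin (2 * n))) :
    coeff (c • A) X = c * coeff A X := by simp [← coeffVec_apply]

lemma coeff_sum {n : ℕ} {ι : Type*} (s : Finset ι) (A : ι → FockOp n)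
    (X : Finset (Fin (2 * n))) : coeff (∑ i ∈ s, A i) X = ∑ i ∈ s, coeff (A i) X := by
  simp [← coeffVec_apply]

lemma coeff_string {n : ℕ} (X Y : Finset (Fin (2 * n))) :
    coeff (majoranaString X) Y = if Y = X then 1 else 0 := by
  have := coeff_unique (fun Z => if Z = X then 1 else 0) Y
  simpa using this

lemma coeff_ext {n : ℕ} {A B : FockOp n} (h : ∀ X, coeff A X = coeff B X) : A = B := by
  rw [← sum_coeff_smul A, ← sum_coeff_smul B]; simp [h]

/-- The Majorana strings are orthonormal for the normalized trace. -/
lemma frobNorm_eq {n : ℕ} (A : FockOp n) : frobNorm A = ‖coeffVec A‖ := by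
  have h : ntrace (Aᴴ * A) = ∑ X, (starRingEnd ℂ) (coeff A X) * coeff A X := by
    have e : Aᴴ = ∑ X, (starRingEnd ℂ) (coeff A X) • majoranaString X := by
      conv_lhs => rw [← sum_coeff_smul A]
      simp [Matrix.conjTranspose_sum, Matrix.conjTranspose_smul, majoranaString_isHermitian]
    rw [e]
    simp only [Finset.sum_mul, smul_mul_assoc, ntrace, Matrix.trace_sum, Matrix.trace_smul,
      Finset.sum_div, smul_eq_mul, mul_div_assoc]
    rfl
  rw [frobNorm, h, EuclideanSpace.norm_eq]
  congr 1
  rw [Complex.re_sum]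
  refine Finset.sum_congr rfl fun X _ => ?_
  rw [coeffVec_apply, mul_comm, Complex.mul_conj, ← Complex.normSq_eq_norm_sq]
  simp

lemma frobNorm_sq {n : ℕ} (A : FockOp n) : frobNorm A ^ 2 = ∑ X, ‖coeff A X‖ ^ 2 := by
  rw [frobNorm_eq, EuclideanSpace.norm_sq_eq]; rfl

lemma frobNorm_nonneg {n : ℕ} (A : FockOp n) : 0 ≤ frobNorm A := Real.sqrt_nonneg _

lemma frobNorm_add_le {n : ℕ} (A B : FockOp n) : frobNorm (A + B) ≤ frobNorm A + frobNorm B := by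
  simp only [frobNorm_eq, map_add]; exact norm_add_le _ _

lemma frobNorm_smul {n : ℕ} (c : ℂ) (A : FockOp n) : frobNorm (c • A) = ‖c‖ * frobNorm A := by
  simp only [frobNorm_eq, map_smul, norm_smul]

/-! ### Degree and truncation -/

lemma degree_le_iff {n : ℕ} {A : FockOp n} {d : ℕ} :
    degree A ≤ d ↔ ∀ X, coeff A X ≠ 0 → X.card ≤ d := by
  simp [degree, Finset.sup_le_iff]

lemma coeff_trunc {n : ℕ} (ℓ : ℕ) (A : FockOp n) (X : Finset (Fin (2 * n))) :
    coeff (trunc ℓ A) X = if X.card ≤ ℓ then coeff A X else 0 := by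
  simp only [trunc, coeff_sum, coeff_smul, coeff_string, mul_ite, mul_one, mul_zero,
    Finset.sum_ite_eq, mem_filter, mem_univ, true_and]

lemma degree_trunc_le {n : ℕ} (ℓ : ℕ) (A : FockOp n) : degree (trunc ℓ A) ≤ ℓ := by
  rw [degree_le_iff]; intro X; rw [coeff_trunc]; split_ifs <;> simp [*]

lemma trunc_eq_self {n : ℕ} {ℓ : ℕ} {A : FockOp n} (h : degree A ≤ ℓ) : trunc ℓ A = A := by
  refine coeff_ext fun X => ?_
  rw [coeff_trunc]
  split_ifs with hX
  · rfl
  · by_contra hne; exact hX (degree_le_iff.1 h X (Ne.symm hne))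

lemma trunc_sub {n : ℕ} (ℓ : ℕ) (A B : FockOp n) : trunc ℓ (A - B) = trunc ℓ A - trunc ℓ B := by
  refine coeff_ext fun X => ?_
  rw [coeff_trunc, coeff_sub, coeff_sub, coeff_trunc, coeff_trunc]; split_ifs <;> simp

lemma frobNorm_trunc_le {n : ℕ} (ℓ : ℕ) (A : FockOp n) : frobNorm (trunc ℓ A) ≤ frobNorm A := by
  refine le_of_sq_le_sq ?_ (frobNorm_nonneg _)
  rw [frobNorm_sq, frobNorm_sq]
  refine Finset.sum_le_sum fun X _ => ?_
  rw [coeff_trunc]; split_ifs <;> simp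

/-- Truncation is the best approximation of bounded degree. -/
lemma frobNorm_trunc_sub_le {n : ℕ} {ℓ : ℕ} (A P : FockOp n) (hP : degree P ≤ ℓ) :
    frobNorm (trunc ℓ A - A) ≤ frobNorm (P - A) := by
  refine le_of_sq_le_sq ?_ (frobNorm_nonneg _)
  rw [frobNorm_sq, frobNorm_sq]
  refine Finset.sum_le_sum fun X _ => ?_
  rw [coeff_sub, coeff_sub, coeff_trunc]
  split_ifs with h
  · simp
  · have : coeff P X = 0 := by
      by_contra hne; exact h (degree_le_iff.1 hP X hne)
    rw [this]

/-! ### Unitary evolution -/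

/-- The generator `i [H, ·]` of the Heisenberg evolution. -/
def adj {n : ℕ} (H A : FockOp n) : FockOp n := Complex.I • (H * A - A * H)

lemma evolve_add {n : ℕ} (H : FockOp n) (s : ℝ) (A B : FockOp n) :
    evolve H s (A + B) = evolve H s A + evolve H s B := by
  simp [evolve, mul_add, add_mul]

lemma evolve_smul {n : ℕ} (H : FockOp n) (s : ℝ) (c : ℂ) (A : FockOp n) :
    evolve H s (c • A) = c • evolve H s A := by
  simp [evolve]

lemma evolve_zero {n : ℕ} (H : FockOp n) (A : FockOp n) : evolve H 0 A = A := by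
  simp [evolve]

lemma evolve_comp_of_commute {n : ℕ} {H K : FockOp n} (h : Commute H K) (s : ℝ) (A : FockOp n) :
    evolve (H + K) s A = evolve K s (evolve H s A) := by
  have hc : ∀ z : ℂ, Commute (z • H) (z • K) := fun z => (h.smul_left z).smul_right z
  simp only [evolve]
  rw [smul_add (-(Complex.I * (s : ℂ))), Matrix.exp_add_of_commute _ _ (hc _), add_comm H K,
    smul_add, Matrix.exp_add_of_commute _ _ (hc _).symm]
  simp only [mul_assoc]

lemma evolve_evolve {n : ℕ} (H : FockOp n) (s s' : ℝ) (A : FockOp n) :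
    evolve H (s + s') A = evolve H s (evolve H s' A) := by
  have h1 : ∀ a b : ℂ, NormedSpace.exp ((a + b) • H) =
      NormedSpace.exp (a • H) * NormedSpace.exp (b • H) := fun a b => by
    rw [add_smul, Matrix.exp_add_of_commute]
    exact ((Commute.refl H).smul_left a).smul_right b
  have e1 : Complex.I * ((s + s' : ℝ) : ℂ) = Complex.I * s + Complex.I * s' := by
    push_cast; ring
  have e2 : -(Complex.I * ((s + s' : ℝ) : ℂ)) = -(Complex.I * s') + -(Complex.I * s) := by
    push_cast; ring
  simp only [evolve]
  rw [e2, h1, e1, h1]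
  simp only [mul_assoc]

lemma frobNorm_evolve {n : ℕ} {H : FockOp n} (hH : H.IsHermitian) (s : ℝ) (A : FockOp n) :
    frobNorm (evolve H s A) = frobNorm A := by
  set U := NormedSpace.exp ((Complex.I * (s : ℂ)) • H) with hU
  set V := NormedSpace.exp (-(Complex.I * (s : ℂ)) • H) with hV
  have hUV : V * U = 1 := by
    rw [hU, hV, ← Matrix.exp_add_of_commute]
    · simp
    · exact ((Commute.refl H).smul_left _).smul_right _
  have hUc : Uᴴ = V := by
    rw [hU, hV, ← Matrix.exp_conjTranspose, Matrix.conjTranspose_smul, hH.eq]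
    simp
  have hVc : Vᴴ = U := by rw [← hUc, Matrix.conjTranspose_conjTranspose]
  have he : evolve H s A = U * A * V := rfl
  have hm : (U * A * V)ᴴ * (U * A * V) = U * (Aᴴ * A) * V := by
    rw [Matrix.conjTranspose_mul, Matrix.conjTranspose_mul, hUc, hVc]
    calc U * (Aᴴ * V) * (U * A * V) = U * Aᴴ * (V * U) * A * V := by simp only [mul_assoc]
      _ = _ := by rw [hUV]; simp only [mul_assoc, one_mul]
  rw [frobNorm, frobNorm, he, hm, ntrace, Matrix.trace_mul_comm, ← mul_assoc, hUV, one_mul]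
  rfl

section Deriv

attribute [local instance] Matrix.linftyOpNormedRing Matrix.linftyOpNormedAlgebra

lemma hasDerivAt_evolve {n : ℕ} (H A : FockOp n) (s : ℝ) :
    HasDerivAt (fun s => coeffVec (evolve H s A)) (coeffVec (evolve H s (adj H A))) s := by
  have e1 : ∀ s : ℝ, (Complex.I * (s : ℂ)) • H = s • (Complex.I • H) := fun s => by
    ext; simp; ring
  have e2 : ∀ s : ℝ, -(Complex.I * (s : ℂ)) • H = s • (-Complex.I • H) := fun s => by
    ext; simp; ring
  have h1 := hasDerivAt_exp_smul_const (𝕂 := ℝ) (Complex.I • H) s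
  have h2 := hasDerivAt_exp_smul_const' (𝕂 := ℝ) (-Complex.I • H) s
  have h3 := (h1.mul_const A).mul h2
  have h4 : HasDerivAt (fun s => evolve H s A) (evolve H s (adj H A)) s := by
    simp only [evolve, e1, e2]
    refine h3.congr_deriv ?_
    simp only [adj, smul_mul_assoc, mul_smul_comm, mul_sub, sub_mul, neg_smul, neg_mul, mul_neg,
      smul_sub, mul_assoc]
    abel
  exact ((LinearMap.toContinuousLinearMap
    (coeffVec (n := n).restrictScalars ℝ)).hasFDerivAt.comp_hasDerivAt s h4)

end Deriv

/-- The Taylor estimate of order zero: the derivative of the evolution of `A` is the evolution of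
`i [H, A]`, and evolution preserves the norm. -/
lemma frobNorm_evolve_sub_le {n : ℕ} {H : FockOp n} (hH : H.IsHermitian) {s : ℝ} (hs : 0 ≤ s)
    (A : FockOp n) : frobNorm (evolve H s A - A) ≤ s * frobNorm (adj H A) := by
  have := norm_image_sub_le_of_norm_deriv_le_segment' (a := 0) (b := s)
    (f := fun s => coeffVec (evolve H s A)) (C := frobNorm (adj H A))
    (fun x _ => (hasDerivAt_evolve H A x).hasDerivWithinAt)
    (fun x _ => by rw [← frobNorm_eq, frobNorm_evolve hH]) s ⟨hs, le_rfl⟩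
  rw [frobNorm_eq, map_sub]
  simpa [evolve_zero, mul_comm] using this

/-- The Taylor estimate of order one. -/
lemma frobNorm_evolve_sub_sub_le {n : ℕ} {H : FockOp n} (hH : H.IsHermitian) {s : ℝ} (hs : 0 ≤ s)
    (A : FockOp n) : frobNorm (evolve H s A - A - (s : ℂ) • adj H A) ≤
      s ^ 2 / 2 * frobNorm (adj H (adj H A)) := by
  set C := frobNorm (adj H (adj H A)) with hC
  have hd : ∀ x : ℝ, HasDerivAt
      (fun s : ℝ => coeffVec (evolve H s A) - coeffVec A - s • coeffVec (adj H A))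
      (coeffVec (evolve H x (adj H A)) - coeffVec (adj H A)) x := fun x => by
    have h := ((hasDerivAt_evolve H A x).sub_const (coeffVec A)).sub
      ((hasDerivAt_id x).smul_const (coeffVec (adj H A)))
    rw [one_smul] at h
    exact h
  have := image_norm_le_of_norm_deriv_right_le_deriv_boundary' (a := 0) (b := s)
    (f := fun s : ℝ => coeffVec (evolve H s A) - coeffVec A - s • coeffVec (adj H A))
    (B := fun x => x ^ 2 / 2 * C) (B' := fun x => x * C)
    (fun x _ => (hd x).continuousAt.continuousWithinAt)
    (fun x _ => (hd x).hasDerivWithinAt) (by simp [evolve_zero])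
    (by fun_prop)
    (fun x _ => by
      have h := (((hasDerivAt_id x).pow 2).div_const 2).mul_const C
      refine HasDerivAt.hasDerivWithinAt (h.congr_deriv ?_)
      simp)
    (fun x hx => by
      rw [← map_sub, ← frobNorm_eq]; exact frobNorm_evolve_sub_le hH hx.1 _)
    (x := s) ⟨hs, le_rfl⟩
  rw [frobNorm_eq, map_sub, map_sub, map_smul]
  exact this

/-! ### The generator on operators of bounded degree -/

lemma odd_inter_symmDiff {n : ℕ} {X : Finset (Fin (2 * n))} (hX : Even X.card)
    (Z : Finset (Fin (2 * n))) : Odd (X ∩ symmDiff X Z).card ↔ Odd (X ∩ Z).card := by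
  have h1 : X ∩ symmDiff X Z = X \ Z := by
    ext z; simp only [mem_inter, mem_symmDiff, mem_sdiff]; tauto
  have h2 := card_sdiff_add_card_inter X Z
  rw [h1, Nat.odd_iff, Nat.odd_iff]
  rw [Nat.even_iff] at hX
  omega

lemma neg_one_pow_inter_symmDiff {n : ℕ} {X : Finset (Fin (2 * n))} (hX : Even X.card)
    (Z : Finset (Fin (2 * n))) :
    (-1 : ℂ) ^ (X ∩ symmDiff X Z).card = (-1 : ℂ) ^ (X ∩ Z).card := by
  have h := odd_inter_symmDiff hX Z
  by_cases ho : Odd (X ∩ Z).card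
  · rw [ho.neg_one_pow, (h.2 ho).neg_one_pow]
  · rw [(Nat.not_odd_iff_even.1 ho).neg_one_pow,
      (Nat.not_odd_iff_even.1 (fun h' => ho (h.1 h'))).neg_one_pow]

lemma sum_symmDiff_odd {n : ℕ} {X : Finset (Fin (2 * n))} (hX : Even X.card)
    (f : Finset (Fin (2 * n)) → ℝ) :
    ∑ Z, (if Odd (X ∩ Z).card then f (symmDiff X Z) else 0) =
      ∑ Y, if Odd (X ∩ Y).card then f Y else 0 := by
  refine Fintype.sum_equiv (symmDiff_right_involutive X).toPerm _ _ fun Z => ?_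
  rw [Function.Involutive.coe_toPerm]
  simp only [odd_inter_symmDiff hX]

lemma card_symmDiff_add {n : ℕ} (X Y : Finset (Fin (2 * n))) :
    (symmDiff X Y).card + 2 * (X ∩ Y).card = X.card + Y.card := by
  rw [symmDiff_def, sup_eq_union, card_union_of_disjoint disjoint_sdiff_sdiff]
  have := card_sdiff_add_card_inter X Y
  have := card_sdiff_add_card_inter Y X
  rw [inter_comm Y X] at this
  omega

lemma coeff_adj_string {n : ℕ} {X : Finset (Fin (2 * n))} (hX : Even X.card) (B : FockOp n)
    (Z : Finset (Fin (2 * n))) : coeff (adj (majoranaString X) B) Z =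
      Complex.I * (1 - (-1 : ℂ) ^ (X ∩ Z).card) * mulPhase X (symmDiff X Z) *
        coeff B (symmDiff X Z) := by
  have h : adj (majoranaString X) B = ∑ Y, (Complex.I * (1 - (-1 : ℂ) ^ (X ∩ Y).card) *
      mulPhase X Y * coeff B Y) • majoranaString (symmDiff X Y) := by
    conv_lhs => rw [← sum_coeff_smul B]
    simp only [adj, Finset.mul_sum, Finset.sum_mul, mul_smul_comm, smul_mul_assoc,
      ← Finset.sum_sub_distrib, Finset.smul_sum]
    refine Finset.sum_congr rfl fun Y _ => ?_
    have hc : (majoranaString Y * majoranaString X : FockOp n) =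
        (-1 : ℂ) ^ (X ∩ Y).card • (majoranaString X * majoranaString Y) := by
      rw [majoranaString_comm X Y hX, smul_smul, ← mul_pow]; simp
    rw [hc, majoranaString_mul, smul_smul, smul_smul, smul_smul, ← sub_smul, smul_smul]
    congr 1; ring
  rw [h, coeff_sum, Finset.sum_eq_single (symmDiff X Z)]
  · rw [coeff_smul, coeff_string, symmDiff_symmDiff_cancel_left, if_pos rfl, mul_one,
      neg_one_pow_inter_symmDiff hX]
  · intro Y _ hY
    rw [coeff_smul, coeff_string, if_neg, mul_zero]
    rintro rfl; exact hY (symmDiff_symmDiff_cancel_left X Y).symm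
  · simp

lemma adj_sum {n : ℕ} {ι : Type*} (s : Finset ι) (H : ι → FockOp n) (A : FockOp n) :
    adj (∑ i ∈ s, H i) A = ∑ i ∈ s, adj (H i) A := by
  simp only [adj, Finset.sum_mul, Finset.mul_sum, ← Finset.sum_sub_distrib, Finset.smul_sum]

lemma adj_smul_left {n : ℕ} (c : ℂ) (H A : FockOp n) : adj (c • H) A = c • adj H A := by
  simp only [adj, smul_mul_assoc, mul_smul_comm, ← smul_sub]; rw [smul_comm]

/-- At most `κ |Z|` terms anticommute with `γ_Z`. -/
lemma card_filter_odd_inter_le {n κ : ℕ} (S : Finset (Finset (Fin (2 * n))))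
    (hS : ∀ i, (S.filter (fun X => i ∈ X)).card ≤ κ) (Z : Finset (Fin (2 * n))) :
    (S.filter (fun X => Odd (X ∩ Z).card)).card ≤ κ * Z.card := by
  have hsub : S.filter (fun X => Odd (X ∩ Z).card) ⊆
      Z.biUnion (fun i => S.filter (fun X => i ∈ X)) := by
    intro X hX
    obtain ⟨h1, h2⟩ := mem_filter.1 hX
    obtain ⟨i, hi⟩ := card_pos.1 h2.pos
    obtain ⟨h3, h4⟩ := mem_inter.1 hi
    exact mem_biUnion.2 ⟨i, h4, mem_filter.2 ⟨h1, h3⟩⟩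
  refine (card_le_card hsub).trans (card_biUnion_le.trans ?_)
  refine (Finset.sum_le_sum fun i _ => hS i).trans ?_
  simp [mul_comm]

lemma norm_coeff_adj_le {n : ℕ} (S : Finset (Finset (Fin (2 * n))))
    (h : Finset (Fin (2 * n)) → ℂ) (hh : ∀ X ∈ S, ‖h X‖ ≤ 1) (hc : ∀ X ∈ S, Even X.card)
    (B : FockOp n) (Z : Finset (Fin (2 * n))) :
    ‖coeff (adj (∑ X ∈ S, h X • majoranaString X) B) Z‖ ≤
      ∑ X ∈ S with Odd (X ∩ Z).card, 2 * ‖coeff B (symmDiff X Z)‖ := by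
  rw [adj_sum, coeff_sum, Finset.sum_filter]
  refine (norm_sum_le _ _).trans (Finset.sum_le_sum fun X hX => ?_)
  rw [adj_smul_left, coeff_smul, coeff_adj_string (hc X hX)]
  split_ifs with ho
  · rw [ho.neg_one_pow]
    simp only [norm_mul, norm_mulPhase, Complex.norm_I]
    have : ‖(1 - -1 : ℂ)‖ = 2 := by norm_num
    rw [this]
    have := hh X hX
    have := norm_nonneg (coeff B (symmDiff X Z))
    nlinarith
  · rw [(Nat.not_odd_iff_even.1 ho).neg_one_pow]; simp

/-- A term anticommutes with a string only if it meets it in an odd number of modes, hence it can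
add at most two modes to it. -/
lemma degree_adj_le {n d : ℕ} (S : Finset (Finset (Fin (2 * n))))
    (h : Finset (Fin (2 * n)) → ℂ) (hh : ∀ X ∈ S, ‖h X‖ ≤ 1)
    (hc : ∀ X ∈ S, X.card = 2 ∨ X.card = 4) (B : FockOp n) (hB : degree B ≤ d) :
    degree (adj (∑ X ∈ S, h X • majoranaString X) B) ≤ d + 2 := by
  rw [degree_le_iff]
  intro Z hZ
  have hev : ∀ X ∈ S, Even X.card := fun X hX => by
    rcases hc X hX with h | h <;> rw [h] <;> decide
  by_contra hlt
  apply hZ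
  rw [← norm_le_zero_iff]
  refine (norm_coeff_adj_le S h hh hev B Z).trans (le_of_eq (Finset.sum_eq_zero fun X hX => ?_))
  obtain ⟨h1, h2⟩ := mem_filter.1 hX
  have h3 := card_symmDiff_add X Z
  have : coeff B (symmDiff X Z) = 0 := by
    by_contra hne
    have h4 := degree_le_iff.1 hB _ hne
    have h5 : (X ∩ Z).card ≤ X.card := card_le_card inter_subset_left
    obtain ⟨k, hk⟩ := h2
    rcases hc X h1 with h6 | h6 <;> omega
  simp [this]

/-- If every mode lies in at most `κ` terms, the generator has norm at most `2 κ (d + 1)` on the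
operators of degree at most `d`: its matrix in the string basis has entries of modulus at most `2`,
at most `κ d` of them nonzero in each relevant column and at most `κ (d + 2)` in each relevant row,
and `d (d + 2) ≤ (d + 1) ^ 2`. -/
lemma frobNorm_adj_le {n d κ : ℕ} (S : Finset (Finset (Fin (2 * n))))
    (h : Finset (Fin (2 * n)) → ℂ) (hh : ∀ X ∈ S, ‖h X‖ ≤ 1)
    (hc : ∀ X ∈ S, X.card = 2 ∨ X.card = 4) (hS : ∀ i, (S.filter (fun X => i ∈ X)).card ≤ κ)
    (B : FockOp n) (hB : degree B ≤ d) :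
    frobNorm (adj (∑ X ∈ S, h X • majoranaString X) B) ≤ 2 * κ * (d + 1) * frobNorm B := by
  have hev : ∀ X ∈ S, Even X.card := fun X hX => by
    rcases hc X hX with h | h <;> rw [h] <;> decide
  refine le_of_sq_le_sq ?_ (by have := frobNorm_nonneg B; positivity)
  rw [frobNorm_sq]
  have hdeg := degree_le_iff.1 (degree_adj_le S h hh hc B hB)
  set D := adj (∑ X ∈ S, h X • majoranaString X) B with hD
  have h1 : ∀ Z, ‖coeff D Z‖ ^ 2 ≤
      4 * (κ * (d + 2)) * ∑ X ∈ S with Odd (X ∩ Z).card, ‖coeff B (symmDiff X Z)‖ ^ 2 := by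
    intro Z
    by_cases hZ : coeff D Z = 0
    · rw [hZ]; simp only [norm_zero, ne_eq, OfNat.ofNat_ne_zero, not_false_eq_true, zero_pow]
      positivity
    · have hcard : ((S.filter (fun X => Odd (X ∩ Z).card)).card : ℝ) ≤ κ * (d + 2) := by
        have := (card_filter_odd_inter_le S hS Z).trans (Nat.mul_le_mul_left κ (hdeg Z hZ))
        exact_mod_cast this
      calc ‖coeff D Z‖ ^ 2
          ≤ (∑ X ∈ S with Odd (X ∩ Z).card, 2 * ‖coeff B (symmDiff X Z)‖) ^ 2 := by
            gcongr; exact norm_coeff_adj_le S h hh hev B Z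
        _ ≤ _ := sq_sum_le_card_mul_sum_sq
        _ = 4 * (S.filter (fun X => Odd (X ∩ Z).card)).card *
              ∑ X ∈ S with Odd (X ∩ Z).card, ‖coeff B (symmDiff X Z)‖ ^ 2 := by
            simp only [mul_pow, ← Finset.mul_sum]; ring
        _ ≤ _ := mul_le_mul_of_nonneg_right (mul_le_mul_of_nonneg_left hcard (by norm_num))
            (Finset.sum_nonneg fun _ _ => sq_nonneg _)
  have h2 : ∑ Z, ∑ X ∈ S with Odd (X ∩ Z).card, ‖coeff B (symmDiff X Z)‖ ^ 2 ≤
      κ * d * ∑ Y, ‖coeff B Y‖ ^ 2 := by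
    simp only [Finset.sum_filter]
    rw [Finset.sum_comm, Finset.sum_congr rfl fun X hX =>
      sum_symmDiff_odd (hev X hX) (fun Y => ‖coeff B Y‖ ^ 2), Finset.sum_comm, Finset.mul_sum]
    refine Finset.sum_le_sum fun Y _ => ?_
    rw [← Finset.sum_filter, Finset.sum_const, nsmul_eq_mul]
    by_cases hY : coeff B Y = 0
    · simp [hY]
    · gcongr
      have := (card_filter_odd_inter_le S hS Y).trans
        (Nat.mul_le_mul_left κ (degree_le_iff.1 hB Y hY))
      exact_mod_cast this
  calc ∑ Z, ‖coeff D Z‖ ^ 2 ≤ ∑ Z, 4 * (κ * (d + 2)) *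
        ∑ X ∈ S with Odd (X ∩ Z).card, ‖coeff B (symmDiff X Z)‖ ^ 2 :=
        Finset.sum_le_sum fun Z _ => h1 Z
    _ = 4 * (κ * (d + 2)) *
        ∑ Z, ∑ X ∈ S with Odd (X ∩ Z).card, ‖coeff B (symmDiff X Z)‖ ^ 2 := by
        rw [Finset.mul_sum]
    _ ≤ 4 * (κ * (d + 2)) * (κ * d * ∑ Y, ‖coeff B Y‖ ^ 2) := by gcongr
    _ = 4 * κ ^ 2 * (d * (d + 2)) * frobNorm B ^ 2 := by rw [frobNorm_sq]; ring
    _ ≤ 4 * κ ^ 2 * ((d + 1) * (d + 1)) * frobNorm B ^ 2 := by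
        have : (d : ℝ) * (d + 2) ≤ (d + 1) * (d + 1) := by nlinarith
        exact mul_le_mul_of_nonneg_right (mul_le_mul_of_nonneg_left this (by positivity))
          (sq_nonneg _)
    _ = _ := by ring

/-! ### The error of one Trotter step -/

/-- `H` is Hermitian, and `i [H, ·]` raises the degree by at most two and has norm at most
`c (d + 1)` on operators of degree at most `d`. -/
structure AdjBound {n : ℕ} (c : ℝ) (H : FockOp n) : Prop where
  hermitian : H.IsHermitian
  degree_le : ∀ (d : ℕ) (B : FockOp n), degree B ≤ d → degree (adj H B) ≤ d + 2
  norm_le : ∀ (d : ℕ) (B : FockOp n), degree B ≤ d → frobNorm (adj H B) ≤ c * (d + 1) * frobNorm B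

lemma AdjBound.adj_adj_le {n ℓ : ℕ} {a b : ℝ} (ha : 0 ≤ a) (hb : 0 ≤ b) {H K : FockOp n}
    (hH : AdjBound a H) (hK : AdjBound b K) {B : FockOp n} (hB : degree B ≤ ℓ) :
    frobNorm (adj H (adj K B)) ≤ a * b * (ℓ + 2) ^ 2 * frobNorm B := by
  have h1 := hK.norm_le ℓ B hB
  have h2 := hH.norm_le (ℓ + 2) _ (hK.degree_le ℓ B hB)
  push_cast at h2
  calc frobNorm (adj H (adj K B)) ≤ a * (ℓ + 2 + 1) * (b * (ℓ + 1) * frobNorm B) := by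
        refine h2.trans ?_; gcongr
    _ = a * b * ((ℓ + 1) * (ℓ + 3)) * frobNorm B := by ring
    _ ≤ _ := by
        have := frobNorm_nonneg B
        gcongr; nlinarith

/-- Composition of the evolutions under the Hamiltonians of a list, the first one innermost. -/
def evolveList {n : ℕ} (Hs : List (FockOp n)) (s : ℝ) (A : FockOp n) : FockOp n :=
  Hs.foldl (fun B H => evolve H s B) A

lemma evolveList_add {n : ℕ} (Hs : List (FockOp n)) (s : ℝ) (A B : FockOp n) :
    evolveList Hs s (A + B) = evolveList Hs s A + evolveList Hs s B := by
  induction Hs generalizing A B with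
  | nil => rfl
  | cons H Hs ih => simp only [evolveList, List.foldl_cons] at ih ⊢; rw [evolve_add, ih]

lemma evolveList_smul {n : ℕ} (Hs : List (FockOp n)) (s : ℝ) (c : ℂ) (A : FockOp n) :
    evolveList Hs s (c • A) = c • evolveList Hs s A := by
  induction Hs generalizing A with
  | nil => rfl
  | cons H Hs ih => simp only [evolveList, List.foldl_cons] at ih ⊢; rw [evolve_smul, ih]

lemma frobNorm_evolveList {n : ℕ} {Hs : List (FockOp n)} (h : ∀ H ∈ Hs, H.IsHermitian) (s : ℝ)
    (A : FockOp n) : frobNorm (evolveList Hs s A) = frobNorm A := by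
  induction Hs generalizing A with
  | nil => rfl
  | cons H Hs ih =>
    change frobNorm (evolveList Hs s (evolve H s A)) = _
    rw [ih (fun K hK => h K (List.mem_cons_of_mem _ hK)), frobNorm_evolve (h H List.mem_cons_self)]

lemma frobNorm_evolveList_sub_le {n : ℕ} {Hs : List (FockOp n)} (h : ∀ H ∈ Hs, H.IsHermitian)
    {s : ℝ} (hs : 0 ≤ s) (A : FockOp n) (M : ℝ) (hM : ∀ H ∈ Hs, frobNorm (adj H A) ≤ M) :
    frobNorm (evolveList Hs s A - A) ≤ s * (Hs.length * M) := by
  induction Hs with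
  | nil => simp [evolveList, frobNorm, ntrace]
  | cons H Hs ih =>
    have hl : ∀ K ∈ Hs, K.IsHermitian := fun K hK => h K (List.mem_cons_of_mem _ hK)
    have e : evolveList (H :: Hs) s A - A =
        evolveList Hs s (evolve H s A - A) + (evolveList Hs s A - A) := by
      change evolveList Hs s (evolve H s A) - A = _
      conv_lhs => rw [← sub_add_cancel (evolve H s A) A, evolveList_add]
      abel
    rw [e]
    refine (frobNorm_add_le _ _).trans ?_
    rw [frobNorm_evolveList hl]
    have h1 := (frobNorm_evolve_sub_le (h H List.mem_cons_self) hs A)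
    have h2 := mul_le_mul_of_nonneg_left (hM H List.mem_cons_self) hs
    have h3 := ih hl (fun K hK => hM K (List.mem_cons_of_mem _ hK))
    push_cast [List.length_cons]
    linarith

/-- The composition of the evolutions agrees to first order with the evolution of the sum. The
generators are always applied to `B` before the evolutions, so that only their norms on operators of
low degree enter. -/
lemma frobNorm_evolveList_sub_sub_le {n ℓ : ℕ} {c : ℝ} (hc : 0 ≤ c) {Hs : List (FockOp n)}
    (h : ∀ H ∈ Hs, AdjBound c H) {s : ℝ} (hs : 0 ≤ s) {B : FockOp n} (hB : degree B ≤ ℓ) :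
    frobNorm (evolveList Hs s B - B - (s : ℂ) • adj Hs.sum B) ≤
      s ^ 2 * ((Hs.length : ℝ) ^ 2 / 2) * (c ^ 2 * (ℓ + 2) ^ 2 * frobNorm B) := by
  induction Hs with
  | nil => simp [evolveList, frobNorm, ntrace, adj]
  | cons H Hs ih =>
    have hl : ∀ K ∈ Hs, AdjBound c K := fun K hK => h K (List.mem_cons_of_mem _ hK)
    have hH := h H List.mem_cons_self
    have hh : ∀ K ∈ Hs, K.IsHermitian := fun K hK => (hl K hK).hermitian
    have e : evolveList (H :: Hs) s B - B - (s : ℂ) • adj (H :: Hs).sum B =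
        evolveList Hs s (evolve H s B - B - (s : ℂ) • adj H B) +
        ((evolveList Hs s B - B - (s : ℂ) • adj Hs.sum B) +
        (s : ℂ) • (evolveList Hs s (adj H B) - adj H B)) := by
      have e1 : evolveList (H :: Hs) s B = evolveList Hs s (evolve H s B - B - (s : ℂ) • adj H B) +
          (evolveList Hs s B + (s : ℂ) • evolveList Hs s (adj H B)) := by
        change evolveList Hs s (evolve H s B) = _
        rw [← evolveList_smul, ← evolveList_add, ← evolveList_add]
        congr 1; abel
      have e2 : adj (H :: Hs).sum B = adj H B + adj Hs.sum B := by
        simp only [adj, List.sum_cons, add_mul, mul_add, ← smul_add]; congr 1; abel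
      rw [e1, e2, smul_add, smul_sub]; abel
    rw [e]
    have hbd : ∀ K, AdjBound c K → frobNorm (adj K (adj H B)) ≤
        c ^ 2 * (ℓ + 2) ^ 2 * frobNorm B := fun K hK => by
      rw [pow_two c]; exact hK.adj_adj_le hc hc hH hB
    have h1 : frobNorm (evolveList Hs s (evolve H s B - B - (s : ℂ) • adj H B)) ≤
        s ^ 2 / 2 * (c ^ 2 * (ℓ + 2) ^ 2 * frobNorm B) := by
      rw [frobNorm_evolveList hh]
      refine (frobNorm_evolve_sub_sub_le hH.hermitian hs B).trans ?_
      gcongr; exact hbd H hH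
    have h2 := ih hl
    have h3 : frobNorm ((s : ℂ) • (evolveList Hs s (adj H B) - adj H B)) ≤
        s * (s * (Hs.length * (c ^ 2 * (ℓ + 2) ^ 2 * frobNorm B))) := by
      rw [frobNorm_smul, Complex.norm_real, Real.norm_of_nonneg hs]
      gcongr
      exact frobNorm_evolveList_sub_le hh hs _ _ fun K hK => hbd K (hl K hK)
    refine (frobNorm_add_le _ _).trans ((add_le_add h1 ((frobNorm_add_le _ _).trans
      (add_le_add h2 h3))).trans (le_of_eq ?_))
    push_cast [List.length_cons]
    ring

/-! ### The error bound -/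

lemma coeff_hamiltonian {n : ℕ} (h : Finset (Fin (2 * n)) → ℂ) (X : Finset (Fin (2 * n))) :
    coeff (hamiltonian h) X = h X := coeff_unique h X

lemma coeff_conjTranspose {n : ℕ} (A : FockOp n) (X : Finset (Fin (2 * n))) :
    coeff Aᴴ X = (starRingEnd ℂ) (coeff A X) := by
  have e : Aᴴ = ∑ X, (starRingEnd ℂ) (coeff A X) • majoranaString X := by
    conv_lhs => rw [← sum_coeff_smul A]
    simp [Matrix.conjTranspose_sum, Matrix.conjTranspose_smul, majoranaString_isHermitian]
  rw [e, coeff_unique]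

lemma IsQuartic.conj_eq {n : ℕ} {h : Finset (Fin (2 * n)) → ℂ} (hq : IsQuartic h)
    (X : Finset (Fin (2 * n))) : (starRingEnd ℂ) (h X) = h X := by
  rw [← coeff_hamiltonian h X, ← coeff_conjTranspose, hq.hermitian.eq]

lemma hamiltonian_eq_sum_terms {n : ℕ} (h : Finset (Fin (2 * n)) → ℂ) :
    hamiltonian h = ∑ X ∈ terms h, h X • majoranaString X := by
  rw [hamiltonian, terms, Finset.sum_filter]
  refine Finset.sum_congr rfl fun X _ => ?_
  split_ifs with hX
  · rfl
  · rw [not_not.1 hX, zero_smul]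

lemma IsQuartic.adjBound {n κ : ℕ} {h : Finset (Fin (2 * n)) → ℂ} (hq : IsQuartic h)
    {S : Finset (Finset (Fin (2 * n)))} (hS : S ⊆ terms h)
    (hκ : ∀ i, (S.filter (fun X => i ∈ X)).card ≤ κ) :
    AdjBound (2 * κ) (∑ X ∈ S, h X • majoranaString X : FockOp n) where
  hermitian := by
    rw [Matrix.IsHermitian, Matrix.conjTranspose_sum]
    refine Finset.sum_congr rfl fun X _ => ?_
    rw [Matrix.conjTranspose_smul, majoranaString_isHermitian]
    congr 1; exact hq.conj_eq X
  degree_le d B hB := degree_adj_le S h (fun X _ => hq.norm_le_one X)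
    (fun X hX => hq.card_eq X (hS hX)) B hB
  norm_le d B hB := frobNorm_adj_le S h (fun X _ => hq.norm_le_one X)
    (fun X hX => hq.card_eq X (hS hX)) hκ B hB

lemma IsColouring.card_group_le_one {n G : ℕ} {h : Finset (Fin (2 * n)) → ℂ}
    {c : Finset (Fin (2 * n)) → ℕ} (hc : IsColouring h G c) (g : ℕ) (i : Fin (2 * n)) :
    (((terms h).filter (fun X => c X = g)).filter (fun X => i ∈ X)).card ≤ 1 := by
  rw [card_le_one]
  intro X hX Y hY
  simp only [mem_filter] at hX hY
  by_contra hne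
  exact (disjoint_left.1 (hc.2 X hX.1.1 Y hY.1.1 hne (hX.1.2.trans hY.1.2.symm)) hX.2) hY.2

lemma sum_groupHam {n G : ℕ} {h : Finset (Fin (2 * n)) → ℂ}
    {c : Finset (Fin (2 * n)) → ℕ} (hc : IsColouring h G c) :
    ((List.range G).map (groupHam h c)).sum = hamiltonian h := by
  rw [hamiltonian_eq_sum_terms, ← Finset.sum_fiberwise_of_maps_to (g := c) (t := range G)
    (fun X hX => mem_range.2 (hc.1 X hX))]
  rfl

lemma trotter_eq {n : ℕ} (h : Finset (Fin (2 * n)) → ℂ) (G : ℕ) (c : Finset (Fin (2 * n)) → ℕ)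
    (s : ℝ) (A : FockOp n) :
    trotter h G c s A = evolveList ((List.range G).map (groupHam h c)) s A := by
  rw [trotter, evolveList, List.foldl_map]

lemma frobNorm_sub_le_add {n : ℕ} (A B C : FockOp n) :
    frobNorm (A - C) ≤ frobNorm (A - B) + frobNorm (B - C) := by
  rw [← sub_add_sub_cancel A B C]; exact frobNorm_add_le _ _

/-- One Trotter step agrees with the exact evolution to second order on operators of degree at most
`ℓ`. Of the constant, `32 = 4 ^ 2 * 2 ^ 2 / 2` comes from the `4 Δ` groups and `2 = 2 ^ 2 / 2` from
the exact evolution. -/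
lemma frobNorm_trotter_sub_evolve_le {n Δ G ℓ : ℕ} {h : Finset (Fin (2 * n)) → ℂ}
    {c : Finset (Fin (2 * n)) → ℕ} (hq : IsQuartic h) (hs : IsSparse Δ h) (hG : G ≤ 4 * Δ)
    (hc : IsColouring h G c) {s : ℝ} (h0 : 0 ≤ s) {B : FockOp n} (hB : degree B ≤ ℓ) :
    frobNorm (trotter h G c s B - evolve (hamiltonian h) s B) ≤
      34 * s ^ 2 * (Δ : ℝ) ^ 2 * ((ℓ : ℝ) + 2) ^ 2 * frobNorm B := by
  set Hs := (List.range G).map (groupHam h c) with hHs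
  have h1 := frobNorm_evolveList_sub_sub_le (c := 2) (by norm_num) (Hs := Hs) (fun H hH => by
    obtain ⟨g, -, rfl⟩ := List.mem_map.1 hH
    have := hq.adjBound (κ := 1) (filter_subset _ _) (hc.card_group_le_one g)
    rw [Nat.cast_one, mul_one] at this
    exact this) h0 hB
  have hH : AdjBound (2 * Δ) (hamiltonian h) := by
    rw [hamiltonian_eq_sum_terms]; exact hq.adjBound (Subset.refl _) hs
  rw [sum_groupHam hc, ← trotter_eq] at h1
  have h2 := frobNorm_evolve_sub_sub_le hq.hermitian h0 B
  have h3 := hH.adj_adj_le (by positivity) (by positivity) hH hB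
  have hlen : (Hs.length : ℝ) ≤ 4 * Δ := by
    rw [hHs, List.length_map, List.length_range]; exact_mod_cast hG
  have hn := frobNorm_nonneg B
  set T := trotter h G c s B
  set E := evolve (hamiltonian h) s B
  set D := (s : ℂ) • adj (hamiltonian h) B
  have e : T - E = (T - B - D) + (-1 : ℂ) • (E - B - D) := by
    rw [neg_one_smul]; abel
  rw [e]
  refine (frobNorm_add_le _ _).trans ?_
  rw [frobNorm_smul, norm_neg, norm_one, one_mul]
  calc frobNorm (T - B - D) + frobNorm (E - B - D)
      ≤ s ^ 2 * ((4 * Δ : ℝ) ^ 2 / 2) * (2 ^ 2 * (ℓ + 2) ^ 2 * frobNorm B) +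
        s ^ 2 / 2 * (2 * Δ * (2 * Δ) * (ℓ + 2) ^ 2 * frobNorm B) := by
        refine add_le_add (h1.trans ?_) (h2.trans ?_)
        · gcongr
        · gcongr
    _ = _ := by ring

lemma le_bestError {n ℓ : ℕ} {H : FockOp n} (hH : H.IsHermitian) (A : FockOp n) {s t : ℝ}
    (h0 : 0 ≤ s) (hst : s ≤ t) :
    frobNorm (trunc ℓ (evolve H s A) - evolve H s A) ≤ bestError H A t ℓ := by
  have hbdd : ∀ s, BddBelow (Set.range fun P : {P : FockOp n // degree P ≤ ℓ} =>
      frobNorm (P.1 - evolve H s A)) := fun s =>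
    ⟨0, by rintro _ ⟨P, rfl⟩; exact frobNorm_nonneg _⟩
  have hz : degree (0 : FockOp n) ≤ ℓ := by
    rw [degree_le_iff]; intro X hX; simp [coeff, ntrace] at hX
  have : Nonempty {P : FockOp n // degree P ≤ ℓ} := ⟨⟨0, hz⟩⟩
  have hsup : BddAbove (Set.range fun s : Set.Icc (0 : ℝ) t =>
      ⨅ P : {P : FockOp n // degree P ≤ ℓ}, frobNorm (P.1 - evolve H s.1 A)) := by
    refine ⟨frobNorm A, ?_⟩
    rintro _ ⟨s, rfl⟩
    refine (ciInf_le (hbdd s.1) ⟨0, hz⟩).trans (le_of_eq ?_)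
    rw [← frobNorm_evolve hH s.1 A, zero_sub, ← neg_one_smul ℂ (evolve H s.1 A), frobNorm_smul]
    simp
  refine le_trans ?_ (le_ciSup hsup ⟨s, h0, hst⟩)
  exact le_ciInf fun P => frobNorm_trunc_sub_le _ _ P.2

/-- The error grows by the Trotter error and the truncation error of the exact evolution in each
step: truncation is a contraction, so that the earlier error is not amplified. -/
lemma frobNorm_step_le {n Δ G ℓ : ℕ} {h : Finset (Fin (2 * n)) → ℂ}
    {c : Finset (Fin (2 * n)) → ℕ} (hq : IsQuartic h) (hs : IsSparse Δ h) (hG : G ≤ 4 * Δ)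
    (hc : IsColouring h G c) {A B : FockOp n} {r s t : ℝ} (hr : 0 ≤ r) (h0 : 0 ≤ s)
    (hst : s + r ≤ t) (hB : degree B ≤ ℓ) :
    frobNorm (trunc ℓ (trotter h G c s B) - evolve (hamiltonian h) (s + r) A) ≤
      34 * s ^ 2 * (Δ : ℝ) ^ 2 * ((ℓ : ℝ) + 2) ^ 2 * frobNorm B +
        frobNorm (B - evolve (hamiltonian h) r A) + bestError (hamiltonian h) A t ℓ := by
  set H := hamiltonian h
  refine (frobNorm_sub_le_add _ (trunc ℓ (evolve H (s + r) A)) _).trans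
    (add_le_add ?_ (le_bestError hq.hermitian A (by linarith) hst))
  rw [← trunc_sub]
  refine (frobNorm_trunc_le _ _).trans ((frobNorm_sub_le_add _ (evolve H s B) _).trans
    (add_le_add (frobNorm_trotter_sub_evolve_le hq hs hG hc h0 hB) (le_of_eq ?_)))
  have : evolve H s B - evolve H s (evolve H r A) = evolve H s (B - evolve H r A) := by
    conv_lhs => rw [← sub_add_cancel B (evolve H r A), evolve_add]
    abel
  rw [evolve_evolve, this, frobNorm_evolve hq.hermitian]

lemma IsQuartic.groupHam_isHermitian {n : ℕ} {h : Finset (Fin (2 * n)) → ℂ} (hq : IsQuartic h)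
    (c : Finset (Fin (2 * n)) → ℕ) (g : ℕ) : (groupHam h c g).IsHermitian :=
  (hq.adjBound (filter_subset _ _) (fun _ => card_le_univ _)).hermitian

lemma frobNorm_trotter {n : ℕ} {h : Finset (Fin (2 * n)) → ℂ} (hq : IsQuartic h) (G : ℕ)
    (c : Finset (Fin (2 * n)) → ℕ) (s : ℝ) (A : FockOp n) :
    frobNorm (trotter h G c s A) = frobNorm A := by
  rw [trotter_eq]
  refine frobNorm_evolveList (fun H hH => ?_) s A
  obtain ⟨g, -, rfl⟩ := List.mem_map.1 hH
  exact hq.groupHam_isHermitian c g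

/-- The errors of the `⌊t / δt⌋` full steps and of the shorter last one add up. The last step is
counted only if its length is positive, which makes `⌈t / δt⌉` the number of steps. -/
theorem frobNorm_majoranaPropagation_sub_le (n Δ : ℕ) (h : Finset (Fin (2 * n)) → ℂ) (G : ℕ)
    (c : Finset (Fin (2 * n)) → ℕ) (A : FockOp n) (t δt : ℝ) (ℓ : ℕ) (hq : IsQuartic h)
    (hs : IsSparse Δ h) (hG : G ≤ 4 * Δ) (hc : IsColouring h G c) (ht : 0 ≤ t) (hδ : 0 < δt)
    (hA : degree A ≤ ℓ) :
    frobNorm (majoranaPropagation h G c A t δt ℓ - evolve (hamiltonian h) t A) ≤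
      34 * t * δt * (Δ : ℝ) ^ 2 * ((ℓ : ℝ) + 2) ^ 2 * frobNorm A +
        (⌈t / δt⌉₊ : ℝ) * bestError (hamiltonian h) A t ℓ := by
  set H := hamiltonian h with hHdef
  set η := bestError H A t ℓ with hη
  set W := 34 * (Δ : ℝ) ^ 2 * ((ℓ : ℝ) + 2) ^ 2 with hW
  set F := fun B => trunc ℓ (trotter h G c δt B) with hF
  have hfr := frobNorm_nonneg A
  have hη0 : 0 ≤ η := (frobNorm_nonneg _).trans (le_bestError hq.hermitian A (s := 0) le_rfl ht)
  have hdeg : ∀ k, degree (F^[k] A) ≤ ℓ := fun k => by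
    cases k with
    | zero => exact hA
    | succ k => rw [Function.iterate_succ_apply']; exact degree_trunc_le _ _
  have hnorm : ∀ k, frobNorm (F^[k] A) ≤ frobNorm A := fun k => by
    induction k with
    | zero => exact le_rfl
    | succ k ih =>
      rw [Function.iterate_succ_apply']
      refine (frobNorm_trunc_le _ _).trans ?_
      rwa [frobNorm_trotter hq]
  have hiter : ∀ k : ℕ, k * δt ≤ t →
      frobNorm (F^[k] A - evolve H (k * δt) A) ≤ k * (W * δt ^ 2 * frobNorm A + η) := by
    intro k
    induction k with
    | zero => intro _; simp [evolve_zero, frobNorm, ntrace]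
    | succ k ih =>
      intro hk
      push_cast at hk
      have h1 := ih (by nlinarith)
      have h2 := frobNorm_step_le (A := A) hq hs hG hc (r := k * δt) (by positivity) hδ.le
        (t := t) (by linarith) (hdeg k)
      rw [Function.iterate_succ_apply']
      have e : ((k + 1 : ℕ) : ℝ) * δt = δt + k * δt := by push_cast; ring
      rw [e]
      refine h2.trans ?_
      have h3 : 34 * δt ^ 2 * (Δ : ℝ) ^ 2 * ((ℓ : ℝ) + 2) ^ 2 * frobNorm (F^[k] A) ≤
          W * δt ^ 2 * frobNorm A := by
        rw [show 34 * δt ^ 2 * (Δ : ℝ) ^ 2 * ((ℓ : ℝ) + 2) ^ 2 = W * δt ^ 2 by rw [hW]; ring]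
        exact mul_le_mul_of_nonneg_left (hnorm k) (by positivity)
      push_cast
      linarith
  set K := ⌊t / δt⌋₊ with hK
  have hKt : K * δt ≤ t := by
    rw [← le_div_iff₀ hδ]; exact Nat.floor_le (by positivity)
  have hKt' : t < (K + 1) * δt := by
    rw [← div_lt_iff₀ hδ]; exact Nat.lt_floor_add_one _
  have hlast := hiter K hKt
  have hMP : majoranaPropagation h G c A t δt ℓ =
      trunc ℓ (trotter h G c (t - K * δt) (F^[K] A)) := rfl
  set r := t - K * δt with hr
  have hr0 : 0 ≤ r := by linarith
  have hrδ : r ≤ δt := by linarith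
  have hWn : 0 ≤ W * frobNorm A := by positivity
  rw [show 34 * t * δt * (Δ : ℝ) ^ 2 * ((ℓ : ℝ) + 2) ^ 2 * frobNorm A =
    t * δt * (W * frobNorm A) by rw [hW]; ring]
  rcases hr0.eq_or_lt with h0 | hpos
  -- If the remaining time vanishes, the last step does nothing and contributes no error.
  · have hid : trotter h G c r (F^[K] A) = F^[K] A := by
      rw [← h0, trotter]
      generalize List.range G = l
      generalize F^[K] A = B
      induction l generalizing B with
      | nil => rfl
      | cons g l ih => rw [List.foldl_cons, evolve_zero, ih]
    rw [hMP, hid, trunc_eq_self (hdeg K)]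
    have e : (K : ℝ) * δt = t := by linarith
    rw [e] at hlast
    have hKc : (K : ℝ) ≤ ⌈t / δt⌉₊ := by exact_mod_cast Nat.floor_le_ceil _
    calc _ ≤ _ := hlast
      _ = (K * δt) * δt * (W * frobNorm A) + K * η := by ring
      _ ≤ _ := by rw [e]; gcongr
  · have hceil : (K : ℝ) + 1 ≤ ⌈t / δt⌉₊ := by
      have : K < ⌈t / δt⌉₊ := by
        rw [Nat.lt_ceil, lt_div_iff₀ hδ]; linarith
      exact_mod_cast this
    have h2 := frobNorm_step_le (A := A) hq hs hG hc (r := K * δt) (by positivity) hr0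
      (t := t) (by linarith) (hdeg K)
    rw [show r + K * δt = t by rw [hr]; ring] at h2
    rw [hMP]
    refine h2.trans ?_
    have h3 : 34 * r ^ 2 * (Δ : ℝ) ^ 2 * ((ℓ : ℝ) + 2) ^ 2 * frobNorm (F^[K] A) ≤
        r * δt * (W * frobNorm A) := by
      rw [show 34 * r ^ 2 * (Δ : ℝ) ^ 2 * ((ℓ : ℝ) + 2) ^ 2 = W * r ^ 2 by rw [hW]; ring]
      calc W * r ^ 2 * frobNorm (F^[K] A) ≤ W * r ^ 2 * frobNorm A :=
            mul_le_mul_of_nonneg_left (hnorm K) (by positivity)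
        _ = r * r * (W * frobNorm A) := by ring
        _ ≤ _ := by gcongr
    have h4 : (K + 1) * η ≤ ⌈t / δt⌉₊ * η := by gcongr
    calc _ ≤ r * δt * (W * frobNorm A) + K * (W * δt ^ 2 * frobNorm A + η) + η := by
          gcongr
      _ = (r + K * δt) * δt * (W * frobNorm A) + (K + 1) * η := by ring
      _ = t * δt * (W * frobNorm A) + (K + 1) * η := by rw [hr]; ring
      _ ≤ _ := by gcongr

/-! ### Rotations generated by a Majorana string -/

section Exp

attribute [local instance] Matrix.linftyOpNormedRing Matrix.linftyOpNormedAlgebra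

lemma exp_smul_of_sq_eq_one {n : ℕ} {γ : FockOp n} (hγ : γ * γ = 1) (z : ℂ) :
    NormedSpace.exp (z • γ) = Complex.cosh z • (1 : FockOp n) + Complex.sinh z • γ := by
  have h := NormedSpace.exp_series_hasSum_exp' (𝕂 := ℂ) (z • γ)
  have hev : ∀ k : ℕ, γ ^ (2 * k) = 1 := fun k => by rw [pow_mul, pow_two, hγ, one_pow]
  have h1 := (Complex.hasSum_cosh z).smul_const (1 : FockOp n)
  have h2 := (Complex.hasSum_sinh z).smul_const γ
  refine h.unique (HasSum.even_add_odd ?_ ?_)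
  · have e : ∀ k : ℕ, (((2 * k).factorial : ℂ)⁻¹ • (z • γ) ^ (2 * k) : FockOp n) =
        (z ^ (2 * k) / ((2 * k).factorial : ℂ)) • 1 := fun k => by
      rw [smul_pow, hev, smul_smul]; congr 1; ring
    simp_rw [e]; exact h1
  · have e : ∀ k : ℕ, (((2 * k + 1).factorial : ℂ)⁻¹ • (z • γ) ^ (2 * k + 1) : FockOp n) =
        (z ^ (2 * k + 1) / ((2 * k + 1).factorial : ℂ)) • γ := fun k => by
      rw [smul_pow, pow_succ γ, hev, one_mul, smul_smul]; congr 1; ring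
    simp_rw [e]; exact h2

end Exp

lemma evolve_smul_of_commute {n : ℕ} {γ B : FockOp n} (hγ : γ * γ = 1) (hB : γ * B = B * γ)
    (x s : ℝ) : evolve ((x : ℂ) • γ) s B = B := by
  set z : ℂ := Complex.I * s * x with hz
  have e1 : evolve ((x : ℂ) • γ) s B = NormedSpace.exp (z • γ) * B * NormedSpace.exp (-z • γ) := by
    simp only [evolve, smul_smul, hz]; congr 3; ring
  rw [e1, exp_smul_of_sq_eq_one hγ, exp_smul_of_sq_eq_one hγ, Complex.cosh_neg, Complex.sinh_neg]
  have hcs := Complex.cosh_sq_sub_sinh_sq z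
  generalize Complex.cosh z = a at *
  generalize Complex.sinh z = b at *
  have e2 : (a • (1 : FockOp n) + b • γ) * B = B * (a • 1 + b • γ) := by
    simp [add_mul, mul_add, hB]
  have e3 : (a • (1 : FockOp n) + b • γ) * (a • 1 + -b • γ) = 1 := by
    simp only [add_mul, mul_add, smul_mul_assoc, mul_smul_comm, one_mul, mul_one, hγ, smul_add,
      smul_smul]
    have : (a ^ 2 - b ^ 2) • (1 : FockOp n) = 1 := by rw [hcs, one_smul]
    refine Eq.trans ?_ this
    module
  rw [e2, mul_assoc, e3, mul_one]

/-- Evolution under `x γ` for a time `s` is a rotation by the angle `2 s x`, written `s x + s x`,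
which is the form in which the program computes it. -/
lemma evolve_smul_of_anticommute {n : ℕ} {γ B : FockOp n} (hγ : γ * γ = 1)
    (hB : γ * B = -(B * γ)) (x s : ℝ) : evolve ((x : ℂ) • γ) s B =
      (Real.cos (s * x + s * x) : ℂ) • B +
        (Real.sin (s * x + s * x) : ℂ) • (Complex.I • (γ * B)) := by
  set z : ℂ := Complex.I * s * x with hz
  have e1 : evolve ((x : ℂ) • γ) s B = NormedSpace.exp (z • γ) * B * NormedSpace.exp (-z • γ) := by
    simp only [evolve, smul_smul, hz]; congr 3; ring
  have hc : (Real.cos (s * x + s * x) : ℂ) = Complex.cosh (2 * z) := by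
    rw [Complex.ofReal_cos, ← Complex.cosh_mul_I, hz]; congr 1; push_cast; ring
  have hs : (Real.sin (s * x + s * x) : ℂ) * Complex.I = Complex.sinh (2 * z) := by
    rw [Complex.ofReal_sin, ← Complex.sinh_mul_I, hz]; congr 1; push_cast; ring
  rw [smul_smul, hs, hc, e1, exp_smul_of_sq_eq_one hγ, exp_smul_of_sq_eq_one hγ, Complex.cosh_neg,
    Complex.sinh_neg, Complex.cosh_two_mul, Complex.sinh_two_mul]
  generalize Complex.cosh z = a at *
  generalize Complex.sinh z = b at *
  have hB' : γ * B * γ = -B := by rw [hB, neg_mul, mul_assoc, hγ, mul_one]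
  have hB'' : B * γ = -(γ * B) := by rw [hB, neg_neg]
  simp only [add_mul, mul_add, smul_mul_assoc, mul_smul_comm, one_mul, mul_one, smul_add,
    smul_smul, hB', hB'']
  module

/-- The sign `f` with `i γ_X γ_Y = f γ_{X ∆ Y}`, for `|X|` equal to `2` or `4` and anticommuting
`γ_X` and `γ_Y`. -/
def rotSign {n : ℕ} (X Y : Finset (Fin (2 * n))) : ℝ :=
  mulSign X Y * ((phaseExp X.card : ℝ) - phaseExp Y.card + phaseExp (symmDiff X Y).card)

lemma I_mul_mulPhase {n : ℕ} {X Y : Finset (Fin (2 * n))} (hX : X.card = 2 ∨ X.card = 4)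
    (ho : Odd (X ∩ Y).card) : Complex.I * mulPhase X Y = rotSign X Y := by
  have h1 := card_symmDiff_add X Y
  have h2 : (X ∩ Y).card ≤ X.card := card_le_card inter_subset_left
  obtain ⟨k, hk⟩ := ho
  unfold mulPhase rotSign
  rcases hX with hX | hX
  · have e : (symmDiff X Y).card = Y.card := by omega
    have e2 : Complex.I ^ phaseExp Y.card * (-Complex.I) ^ phaseExp Y.card = 1 := by
      rw [← mul_pow]; simp
    rw [e, hX]
    have e3 : phaseExp 2 = 1 := rfl
    rw [e3]
    push_cast
    linear_combination (-Complex.I ^ 2 * (mulSign X Y : ℂ)) * e2 -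
      (mulSign X Y : ℂ) * Complex.I_sq
  · have e3 : phaseExp 4 = 0 := rfl
    rw [hX, e3]
    by_cases hY : Y.card % 4 = 0 ∨ Y.card % 4 = 1
    · have e1 : phaseExp Y.card = 0 := if_pos hY
      have e2 : phaseExp (symmDiff X Y).card = 1 := if_neg (by omega)
      rw [e1, e2]; push_cast
      linear_combination (-(mulSign X Y : ℂ)) * Complex.I_sq
    · have e1 : phaseExp Y.card = 1 := if_neg hY
      have e2 : phaseExp (symmDiff X Y).card = 0 := if_pos (by omega)
      rw [e1, e2]; push_cast
      linear_combination (mulSign X Y : ℂ) * Complex.I_sq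

lemma evolve_string {n : ℕ} {X : Finset (Fin (2 * n))} (hX : X.card = 2 ∨ X.card = 4) (x s : ℝ)
    (Y : Finset (Fin (2 * n))) : evolve ((x : ℂ) • majoranaString X) s (majoranaString Y) =
      if Odd (X ∩ Y).card then (Real.cos (s * x + s * x) : ℂ) • majoranaString Y +
        ((Real.sin (s * x + s * x) * rotSign X Y : ℝ) : ℂ) • majoranaString (symmDiff X Y)
      else majoranaString Y := by
  have hev : Even X.card := by rcases hX with h | h <;> rw [h] <;> decide
  have hc := majoranaString_comm X Y hev
  split_ifs with ho
  · rw [ho.neg_one_pow, neg_one_smul] at hc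
    rw [evolve_smul_of_anticommute (string_sq X) hc, majoranaString_mul, smul_smul Complex.I,
      I_mul_mulPhase hX ho, smul_smul, ← Complex.ofReal_mul]
  · rw [(Nat.not_odd_iff_even.1 ho).neg_one_pow, one_smul] at hc
    exact evolve_smul_of_commute (string_sq X) hc x s

/-! ### Majorana polynomials as lists -/

/-- The operator `∑ z γ_X` given by a list of pairs `(X, z)`. -/
def denote {n : ℕ} (L : List (Finset (Fin (2 * n)) × ℂ)) : FockOp n :=
  (L.map fun m => m.2 • majoranaString m.1).sum

@[simp] lemma denote_nil {n : ℕ} : denote ([] : List (Finset (Fin (2 * n)) × ℂ)) = 0 := rfl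

@[simp] lemma denote_cons {n : ℕ} (m : Finset (Fin (2 * n)) × ℂ)
    (L : List (Finset (Fin (2 * n)) × ℂ)) :
    denote (m :: L) = m.2 • majoranaString m.1 + denote L := by simp [denote]

lemma denote_perm {n : ℕ} {L L' : List (Finset (Fin (2 * n)) × ℂ)} (h : L.Perm L') :
    denote L = denote L' := (h.map _).sum_eq

/-- One step of the insertion of a monomial: like terms are collected in the first component. -/
def addStep {n : ℕ} (st : (Finset (Fin (2 * n)) × ℂ) × List (Finset (Fin (2 * n)) × ℂ))
    (m : Finset (Fin (2 * n)) × ℂ) :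
    (Finset (Fin (2 * n)) × ℂ) × List (Finset (Fin (2 * n)) × ℂ) :=
  if m.1 = st.1.1 then ((st.1.1, st.1.2 + m.2), st.2) else (st.1, m :: st.2)

/-- Add a monomial to a polynomial without creating a second term for the same set. -/
def addMono {n : ℕ} (L : List (Finset (Fin (2 * n)) × ℂ)) (m : Finset (Fin (2 * n)) × ℂ) :
    List (Finset (Fin (2 * n)) × ℂ) :=
  let st := L.foldl addStep (m, [])
  st.1 :: st.2

lemma foldl_addStep {n : ℕ} (L : List (Finset (Fin (2 * n)) × ℂ))
    (st : (Finset (Fin (2 * n)) × ℂ) × List (Finset (Fin (2 * n)) × ℂ)) :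
    (L.foldl addStep st).1.1 = st.1.1 ∧
      (L.foldl addStep st).2 = (L.filter (fun m => m.1 ≠ st.1.1)).reverse ++ st.2 ∧
      (L.foldl addStep st).1.2 • majoranaString (L.foldl addStep st).1.1 +
        denote (L.foldl addStep st).2 =
        st.1.2 • majoranaString st.1.1 + denote st.2 + denote L := by
  induction L generalizing st with
  | nil => simp
  | cons m L ih =>
    obtain ⟨i1, i2, i3⟩ := ih (addStep st m)
    rw [List.foldl_cons, i3, i1, i2]
    by_cases h : m.1 = st.1.1
    · simp only [addStep, h, if_true, denote_cons]
      refine ⟨trivial, by simp [h], ?_⟩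
      module
    · simp only [addStep, h, if_false, denote_cons]
      refine ⟨trivial, by simp [h], ?_⟩
      module

lemma denote_addMono {n : ℕ} (L : List (Finset (Fin (2 * n)) × ℂ))
    (m : Finset (Fin (2 * n)) × ℂ) :
    denote (addMono L m) = m.2 • majoranaString m.1 + denote L := by
  simp only [addMono, denote_cons]
  rw [(foldl_addStep L (m, [])).2.2]; simp

lemma map_fst_addMono {n : ℕ} (L : List (Finset (Fin (2 * n)) × ℂ))
    (m : Finset (Fin (2 * n)) × ℂ) : (addMono L m).map Prod.fst =
      m.1 :: ((L.filter (fun m' => m'.1 ≠ m.1)).map Prod.fst).reverse := by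
  obtain ⟨h1, h2, -⟩ := foldl_addStep L (m, [])
  simp only [addMono, List.map_cons, h1, h2, List.append_nil, List.map_reverse]

lemma nodup_addMono {n : ℕ} {L : List (Finset (Fin (2 * n)) × ℂ)}
    (h : (L.map Prod.fst).Nodup) (m : Finset (Fin (2 * n)) × ℂ) :
    ((addMono L m).map Prod.fst).Nodup := by
  rw [map_fst_addMono, List.nodup_cons, List.nodup_reverse]
  refine ⟨by simp, h.sublist ((List.filter_sublist).map _)⟩

lemma mem_addMono {n : ℕ} {L : List (Finset (Fin (2 * n)) × ℂ)}
    {m : Finset (Fin (2 * n)) × ℂ} {X : Finset (Fin (2 * n))}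
    (h : X ∈ (addMono L m).map Prod.fst) : X = m.1 ∨ X ∈ L.map Prod.fst := by
  rw [map_fst_addMono, List.mem_cons, List.mem_reverse] at h
  exact h.imp_right fun h => List.Sublist.subset ((List.filter_sublist).map _) h

lemma length_addMono_le {n : ℕ} (L : List (Finset (Fin (2 * n)) × ℂ))
    (m : Finset (Fin (2 * n)) × ℂ) : (addMono L m).length ≤ L.length + 1 := by
  have h := congrArg List.length (map_fst_addMono L m)
  simp only [List.length_map, List.length_cons, List.length_reverse] at h
  rw [h]
  exact Nat.succ_le_succ (List.length_filter_le _ _)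

/-- The contribution of one monomial to a rotated polynomial. -/
def rotateStep {n : ℕ} (X : Finset (Fin (2 * n))) (φ : ℝ)
    (acc : List (Finset (Fin (2 * n)) × ℂ)) (m : Finset (Fin (2 * n)) × ℂ) :
    List (Finset (Fin (2 * n)) × ℂ) :=
  if Odd (X ∩ m.1).card then
    addMono (addMono acc (m.1, (Real.cos φ : ℂ) * m.2))
      (symmDiff X m.1, ((Real.sin φ * rotSign X m.1 : ℝ) : ℂ) * m.2)
  else addMono acc m

/-- The rotation with angle `φ` about `γ_X`, applied to a polynomial. -/
def rotate {n : ℕ} (X : Finset (Fin (2 * n))) (φ : ℝ) (L : List (Finset (Fin (2 * n)) × ℂ)) :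
    List (Finset (Fin (2 * n)) × ℂ) := L.foldl (rotateStep X φ) []

lemma denote_foldl_rotateStep {n : ℕ} {X : Finset (Fin (2 * n))} (hX : X.card = 2 ∨ X.card = 4)
    (x s : ℝ) (L acc : List (Finset (Fin (2 * n)) × ℂ)) :
    denote (L.foldl (rotateStep X (s * x + s * x)) acc) =
      denote acc + evolve ((x : ℂ) • majoranaString X) s (denote L) := by
  induction L generalizing acc with
  | nil => simp [evolve]
  | cons m L ih =>
    rw [List.foldl_cons, ih, denote_cons, evolve_add, evolve_smul, evolve_string hX]
    unfold rotateStep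
    split_ifs with ho
    · simp only [denote_addMono]
      module
    · simp only [denote_addMono]
      module

lemma denote_rotate {n : ℕ} {X : Finset (Fin (2 * n))} (hX : X.card = 2 ∨ X.card = 4)
    (x s : ℝ) (L : List (Finset (Fin (2 * n)) × ℂ)) :
    denote (rotate X (s * x + s * x) L) =
      evolve ((x : ℂ) • majoranaString X) s (denote L) := by
  rw [rotate, denote_foldl_rotateStep hX, denote_nil, zero_add]

lemma nodup_rotate {n : ℕ} (X : Finset (Fin (2 * n))) (φ : ℝ)
    (L : List (Finset (Fin (2 * n)) × ℂ)) : ((rotate X φ L).map Prod.fst).Nodup := by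
  have : ∀ acc : List (Finset (Fin (2 * n)) × ℂ), (acc.map Prod.fst).Nodup →
      ((L.foldl (rotateStep X φ) acc).map Prod.fst).Nodup := by
    induction L with
    | nil => exact fun acc h => h
    | cons m L ih =>
      intro acc h
      refine ih _ ?_
      unfold rotateStep
      split_ifs
      · exact nodup_addMono (nodup_addMono h _) _
      · exact nodup_addMono h _
  exact this [] (by simp)

lemma length_rotateStep_le {n : ℕ} (X : Finset (Fin (2 * n))) (φ : ℝ)
    (acc : List (Finset (Fin (2 * n)) × ℂ)) (m : Finset (Fin (2 * n)) × ℂ) :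
    (rotateStep X φ acc m).length ≤ acc.length + 2 := by
  unfold rotateStep
  split_ifs
  · exact (length_addMono_le _ _).trans (Nat.succ_le_succ (length_addMono_le _ _))
  · exact (length_addMono_le _ _).trans (Nat.le_succ _)

lemma mem_rotate {n : ℕ} {X : Finset (Fin (2 * n))} {φ : ℝ}
    {L : List (Finset (Fin (2 * n)) × ℂ)} {Z : Finset (Fin (2 * n))}
    (h : Z ∈ (rotate X φ L).map Prod.fst) :
    ∃ Y ∈ L.map Prod.fst, Z = Y ∨ (Odd (X ∩ Y).card ∧ Z = symmDiff X Y) := by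
  have : ∀ acc : List (Finset (Fin (2 * n)) × ℂ),
      Z ∈ (L.foldl (rotateStep X φ) acc).map Prod.fst → Z ∈ acc.map Prod.fst ∨
      ∃ Y ∈ L.map Prod.fst, Z = Y ∨ (Odd (X ∩ Y).card ∧ Z = symmDiff X Y) := by
    clear h
    induction L with
    | nil => exact fun acc h => Or.inl h
    | cons m L ih =>
      intro acc h
      rcases ih _ h with h | ⟨Y, hY, h⟩
      · unfold rotateStep at h
        split_ifs at h with ho
        · rcases mem_addMono h with h | h
          · exact Or.inr ⟨m.1, by simp, Or.inr ⟨ho, h⟩⟩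
          · rcases mem_addMono h with h | h
            · exact Or.inr ⟨m.1, by simp, Or.inl h⟩
            · exact Or.inl h
        · rcases mem_addMono h with h | h
          · exact Or.inr ⟨m.1, by simp, Or.inl h⟩
          · exact Or.inl h
      · exact Or.inr ⟨Y, List.mem_cons_of_mem _ hY, h⟩
  exact (this [] h).resolve_left (by simp)

/-- One step of the truncation: keep a monomial if it is nonzero and of degree at most `ℓ`. -/
def truncStep {n : ℕ} (ℓ : ℕ) (acc : List (Finset (Fin (2 * n)) × ℂ))
    (m : Finset (Fin (2 * n)) × ℂ) : List (Finset (Fin (2 * n)) × ℂ) :=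
  if m.1.card ≤ ℓ ∧ m.2 ≠ 0 then m :: acc else acc

/-- Truncation of a polynomial to degree `ℓ`, and deletion of the zero terms. -/
def truncList {n : ℕ} (ℓ : ℕ) (L : List (Finset (Fin (2 * n)) × ℂ)) :
    List (Finset (Fin (2 * n)) × ℂ) := L.foldl (truncStep ℓ) []

lemma truncList_eq {n : ℕ} (ℓ : ℕ) (L : List (Finset (Fin (2 * n)) × ℂ)) :
    truncList ℓ L = (L.filter (fun m => m.1.card ≤ ℓ ∧ m.2 ≠ 0)).reverse := by
  have : ∀ acc, L.foldl (truncStep ℓ) acc =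
      (L.filter (fun m => m.1.card ≤ ℓ ∧ m.2 ≠ 0)).reverse ++ acc := by
    induction L with
    | nil => simp
    | cons m L ih =>
      intro acc
      rw [List.foldl_cons, ih, truncStep, List.filter_cons]
      by_cases h : m.1.card ≤ ℓ ∧ m.2 ≠ 0
      · rw [if_pos h, if_pos (by simpa using h)]; simp
      · rw [if_neg h, if_neg (by simpa using h)]
  rw [truncList, this, List.append_nil]

lemma nodup_truncList {n ℓ : ℕ} {L : List (Finset (Fin (2 * n)) × ℂ)}
    (h : (L.map Prod.fst).Nodup) : ((truncList ℓ L).map Prod.fst).Nodup := by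
  rw [truncList_eq, List.map_reverse, List.nodup_reverse]
  exact h.sublist ((List.filter_sublist).map _)

lemma mem_truncList {n ℓ : ℕ} {L : List (Finset (Fin (2 * n)) × ℂ)}
    {m : Finset (Fin (2 * n)) × ℂ} (h : m ∈ truncList ℓ L) : m.1.card ≤ ℓ ∧ m.2 ≠ 0 := by
  rw [truncList_eq, List.mem_reverse, List.mem_filter] at h
  simpa using h.2

lemma trunc_add {n : ℕ} (ℓ : ℕ) (A B : FockOp n) : trunc ℓ (A + B) = trunc ℓ A + trunc ℓ B := by
  refine coeff_ext fun X => ?_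
  simp only [coeff_trunc, coeff_add]; split_ifs <;> simp

lemma trunc_smul_string {n : ℕ} (ℓ : ℕ) (z : ℂ) (X : Finset (Fin (2 * n))) :
    trunc ℓ (z • majoranaString X) = if X.card ≤ ℓ then z • majoranaString X else 0 := by
  refine coeff_ext fun Y => ?_
  rw [coeff_trunc, coeff_smul, coeff_string]
  split_ifs with h1 h2 h3 h3 h2
  · subst h2; rw [coeff_smul, coeff_string, if_pos rfl]
  · subst h2; exact absurd h1 h3
  · rw [coeff_smul, coeff_string, if_neg h2]
  · simp [coeff, ntrace]
  · rw [coeff_smul, coeff_string, if_neg, mul_zero]; rintro rfl; exact h1 h2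
  · simp [coeff, ntrace]

lemma denote_truncList {n : ℕ} (ℓ : ℕ) (L : List (Finset (Fin (2 * n)) × ℂ)) :
    denote (truncList ℓ L) = trunc ℓ (denote L) := by
  rw [truncList_eq, denote_perm (List.reverse_perm _)]
  induction L with
  | nil =>
    refine coeff_ext fun X => ?_
    rw [coeff_trunc]; simp [coeff, ntrace]
  | cons m L ih =>
    rw [denote_cons, trunc_add, ← ih, trunc_smul_string, List.filter_cons]
    by_cases h1 : m.1.card ≤ ℓ
    · by_cases h2 : m.2 = 0
      · simp [h1, h2]
      · simp [h1, h2]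
    · simp [h1]

lemma coeff_denote_of_notMem {n : ℕ} {L : List (Finset (Fin (2 * n)) × ℂ)}
    {X : Finset (Fin (2 * n))} (h : X ∉ L.map Prod.fst) : coeff (denote L) X = 0 := by
  induction L with
  | nil => simp [coeff, ntrace]
  | cons m L ih =>
    simp only [List.map_cons, List.mem_cons, not_or] at h
    rw [denote_cons, coeff_add, coeff_smul, coeff_string, if_neg h.1, mul_zero, zero_add]
    exact ih h.2

lemma coeff_denote {n : ℕ} {L : List (Finset (Fin (2 * n)) × ℂ)} (h : (L.map Prod.fst).Nodup)
    {X : Finset (Fin (2 * n))} {z : ℂ} (hm : (X, z) ∈ L) : coeff (denote L) X = z := by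
  induction L with
  | nil => simp at hm
  | cons m L ih =>
    rw [List.map_cons, List.nodup_cons] at h
    rw [denote_cons, coeff_add, coeff_smul, coeff_string]
    rcases List.mem_cons.1 hm with rfl | hm
    · rw [if_pos rfl, mul_one, coeff_denote_of_notMem h.1, add_zero]
    · have : X ≠ m.1 := fun e => h.1 (e ▸ List.mem_map.2 ⟨_, hm, rfl⟩)
      rw [if_neg this, mul_zero, zero_add, ih h.2 hm]

lemma isMonomialList_denote {n : ℕ} {L : List (Finset (Fin (2 * n)) × ℂ)}
    (h : (L.map Prod.fst).Nodup) (h0 : ∀ m ∈ L, m.2 ≠ 0) :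
    IsMonomialList L (coeff (denote L)) := by
  refine ⟨h.of_map _, fun X z => ⟨fun hm => ⟨(coeff_denote h hm).symm, h0 _ hm⟩, ?_⟩⟩
  rintro ⟨hz, hz0⟩
  have hX : X ∈ L.map Prod.fst := by
    by_contra hX
    apply hz0
    rw [hz, coeff_denote_of_notMem hX]
  obtain ⟨⟨X', w⟩, hm, rfl⟩ := List.mem_map.1 hX
  have := coeff_denote h hm
  rw [hz, this]; exact hm

lemma IsMonomialList.nodup_keys {n : ℕ} {L : List (Finset (Fin (2 * n)) × ℂ)}
    {a : Finset (Fin (2 * n)) → ℂ} (h : IsMonomialList L a) : (L.map Prod.fst).Nodup := by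
  refine h.1.map_on fun x hx y hy e => ?_
  obtain ⟨X, z⟩ := x
  obtain ⟨Y, w⟩ := y
  obtain rfl : X = Y := e
  rw [((h.2 X z).1 hx).1, ((h.2 X w).1 hy).1]

lemma IsMonomialList.denote_eq {n : ℕ} {L : List (Finset (Fin (2 * n)) × ℂ)} {A : FockOp n}
    (h : IsMonomialList L (coeff A)) : denote L = A := by
  refine coeff_ext fun X => ?_
  by_cases hX : coeff A X = 0
  · by_contra hne
    have h2 := isMonomialList_denote h.nodup_keys (fun m hm => ((h.2 m.1 m.2).1 hm).2)
    have h3 := (h2.2 X (coeff (denote L) X)).2 ⟨rfl, fun h0 => hne (h0.trans hX.symm)⟩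
    exact hne ((h.2 _ _).1 h3).1
  · exact coeff_denote h.nodup_keys ((h.2 X _).2 ⟨rfl, hX⟩)

/-! ### Growth of the degree within a Trotter step -/

/-- The largest degree of a monomial that can arise from `γ_Z` by the rotations about the strings of
a list. -/
def spread {n : ℕ} : List (Finset (Fin (2 * n))) → Finset (Fin (2 * n)) → ℕ
  | [], Z => Z.card
  | X :: R, Z => if Odd (X ∩ Z).card then max (spread R Z) (spread R (symmDiff X Z)) else spread R Z

lemma card_le_spread {n : ℕ} (R : List (Finset (Fin (2 * n)))) (Z : Finset (Fin (2 * n))) :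
    Z.card ≤ spread R Z := by
  induction R generalizing Z with
  | nil => exact le_rfl
  | cons X R ih =>
    rw [spread]
    split_ifs
    · exact (ih Z).trans (le_max_left _ _)
    · exact ih Z

lemma spread_rotate_le {n D : ℕ} {X : Finset (Fin (2 * n))} {R : List (Finset (Fin (2 * n)))}
    {φ : ℝ} {L : List (Finset (Fin (2 * n)) × ℂ)}
    (h : ∀ Y ∈ L.map Prod.fst, spread (X :: R) Y ≤ D) :
    ∀ Z ∈ (rotate X φ L).map Prod.fst, spread R Z ≤ D := by
  intro Z hZ
  obtain ⟨Y, hY, hZY⟩ := mem_rotate hZ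
  have := h Y hY
  rw [spread] at this
  rcases hZY with rfl | ⟨ho, rfl⟩
  · split_ifs at this
    · exact (le_max_left _ _).trans this
    · exact this
  · rw [if_pos ho] at this
    exact (le_max_right _ _).trans this

open Classical in
lemma countP_not_disjoint_le {n : ℕ} (g : List (Finset (Fin (2 * n))))
    (hg : g.Pairwise Disjoint) (Z : Finset (Fin (2 * n))) :
    g.countP (fun X => ¬ Disjoint X Z) ≤ Z.card := by
  induction g generalizing Z with
  | nil => simp
  | cons X g ih =>
    obtain ⟨hX, hg⟩ := List.pairwise_cons.1 hg
    rw [List.countP_cons]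
    have e : g.countP (fun Y => ¬ Disjoint Y Z) = g.countP (fun Y => ¬ Disjoint Y (Z \ X)) := by
      refine List.countP_congr fun Y hY => ?_
      have hd := hX Y hY
      simp only [decide_eq_true_eq, not_iff_not, disjoint_left, mem_sdiff]
      refine forall₂_congr fun a ha => ?_
      have : a ∉ X := fun h => (disjoint_left.1 hd h) ha
      tauto
    by_cases hd : Disjoint X Z
    · simpa [hd] using ih hg Z
    · have h1 := ih hg (Z \ X)
      have h2 : (Z \ X).card < Z.card := by
        refine card_lt_card ?_
        obtain ⟨a, ha, hb⟩ := not_disjoint_iff.1 hd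
        exact (ssubset_iff_of_subset sdiff_subset).2 ⟨a, hb, by simp [ha]⟩
      rw [e]
      simp only [hd, not_false_eq_true, decide_true, if_true]
      omega

open Classical in
/-- Within a group of disjoint terms, every rotation that affects a monomial raises its degree by at
most two, and uses up one of the terms that meet it. -/
lemma spread_append_le {n K : ℕ} {R : List (Finset (Fin (2 * n)))}
    (hR : ∀ Z, spread R Z ≤ K * Z.card) (g : List (Finset (Fin (2 * n))))
    (hg : g.Pairwise Disjoint) (hc : ∀ X ∈ g, X.card ≤ 4) (Z : Finset (Fin (2 * n))) :
    spread (g ++ R) Z ≤ K * (Z.card + 2 * g.countP (fun X => ¬ Disjoint X Z)) := by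
  induction g generalizing Z with
  | nil => simpa using hR Z
  | cons X g ih =>
    obtain ⟨hX, hg⟩ := List.pairwise_cons.1 hg
    have hc' : ∀ X ∈ g, X.card ≤ 4 := fun Y hY => hc Y (List.mem_cons_of_mem _ hY)
    have i1 := ih hg hc' Z
    have i2 := ih hg hc' (symmDiff X Z)
    have hle : g.countP (fun X => ¬ Disjoint X Z) ≤
        (X :: g).countP (fun X => ¬ Disjoint X Z) := by
      rw [List.countP_cons]; exact Nat.le_add_right _ _
    rw [List.cons_append, spread]
    have j1 : spread (g ++ R) Z ≤ K * (Z.card + 2 * (X :: g).countP fun X => ¬ Disjoint X Z) :=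
      i1.trans (Nat.mul_le_mul_left _ (by omega))
    split_ifs with ho
    · refine max_le j1 (i2.trans (Nat.mul_le_mul_left _ ?_))
      have e : g.countP (fun Y => ¬ Disjoint Y (symmDiff X Z)) =
          g.countP (fun Y => ¬ Disjoint Y Z) := by
        refine List.countP_congr fun Y hY => ?_
        have hd := hX Y hY
        simp only [decide_eq_true_eq, not_iff_not, disjoint_left, mem_symmDiff]
        refine forall₂_congr fun a ha => ?_
        have : a ∉ X := fun h => (disjoint_left.1 hd h) ha
        tauto
      have hnd : ¬ Disjoint X Z := by
        intro hd
        rw [disjoint_iff_inter_eq_empty.1 hd] at ho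
        simp at ho
      have h1 := card_symmDiff_add X Z
      have h2 := hc X List.mem_cons_self
      obtain ⟨k, hk⟩ := ho
      rw [e, List.countP_cons]
      simp only [hnd, not_false_eq_true, decide_true, if_true]
      omega
    · exact j1

/-- A group of disjoint terms at most triples the degree: at most `|Z|` of its terms meet `Z`, and
each of them adds at most two modes. -/
lemma spread_flatten_le {n : ℕ} (gs : List (List (Finset (Fin (2 * n)))))
    (hg : ∀ g ∈ gs, g.Pairwise Disjoint) (hc : ∀ g ∈ gs, ∀ X ∈ g, X.card ≤ 4)
    (Z : Finset (Fin (2 * n))) : spread gs.flatten Z ≤ 3 ^ gs.length * Z.card := by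
  classical
  induction gs generalizing Z with
  | nil => simp [spread]
  | cons g gs ih =>
    rw [List.flatten_cons]
    have h1 := spread_append_le (ih (fun g' h => hg g' (List.mem_cons_of_mem _ h))
      (fun g' h => hc g' (List.mem_cons_of_mem _ h))) g (hg g List.mem_cons_self)
      (hc g List.mem_cons_self) Z
    have h2 := countP_not_disjoint_le g (hg g List.mem_cons_self) Z
    refine h1.trans ?_
    rw [List.length_cons, pow_succ, mul_assoc]
    exact Nat.mul_le_mul_left _ (by omega)

lemma card_filter_card_le (N D : ℕ) :
    (univ.filter (fun X : Finset (Fin N) => X.card ≤ D)).card ≤ (N + 1) ^ D := by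
  classical
  induction D with
  | zero =>
    rw [pow_zero, card_le_one]
    intro X hX Y hY
    simp only [mem_filter, mem_univ, true_and, Nat.le_zero, card_eq_zero] at hX hY
    rw [hX, hY]
  | succ D ih =>
    have hsub : univ.filter (fun X : Finset (Fin N) => X.card ≤ D + 1) ⊆
        ((univ.filter (fun X : Finset (Fin N) => X.card ≤ D)) ×ˢ
          (univ : Finset (Option (Fin N)))).image
          (fun p => p.2.elim p.1 (fun i => insert i p.1)) := by
      intro X hX
      have hX := (mem_filter.1 hX).2
      rcases X.eq_empty_or_nonempty with rfl | ⟨i, hi⟩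
      · exact mem_image.2 ⟨(∅, none), by simp, rfl⟩
      · refine mem_image.2 ⟨(X.erase i, some i), ?_, insert_erase hi⟩
        simp only [mem_product, mem_filter, mem_univ, true_and, and_true, card_erase_of_mem hi]
        omega
    refine (card_le_card hsub).trans (card_image_le.trans ?_)
    rw [card_product, card_univ, Fintype.card_option, Fintype.card_fin, pow_succ]
    exact Nat.mul_le_mul_right _ ih

lemma length_le_of_card_le {n D : ℕ} {L : List (Finset (Fin (2 * n)) × ℂ)}
    (h : (L.map Prod.fst).Nodup) (hD : ∀ X ∈ L.map Prod.fst, X.card ≤ D) :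
    L.length ≤ (2 * n + 1) ^ D := by
  rw [← List.length_map (f := Prod.fst), ← List.toFinset_card_of_nodup h]
  refine (card_le_card fun X hX => ?_).trans (card_filter_card_le (2 * n) D)
  simpa using hD X (List.mem_toFinset.1 hX)

/-! ### The greedy colouring -/

/-- One step of the greedy selection of disjoint terms: `st.1` is the union of the terms selected so
far, `st.2.1` collects the rejected terms, and `st.2.2` the selected ones. -/
def selectStep {n : ℕ}
    (st : Finset (Fin (2 * n)) × List (Finset (Fin (2 * n)) × ℂ) × List (Finset (Fin (2 * n)) × ℂ))
    (m : Finset (Fin (2 * n)) × ℂ) :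
    Finset (Fin (2 * n)) × List (Finset (Fin (2 * n)) × ℂ) × List (Finset (Fin (2 * n)) × ℂ) :=
  if (m.1 ∩ st.1).card = 0 then (symmDiff m.1 st.1, st.2.1, m :: st.2.2)
  else (st.1, m :: st.2.1, st.2.2)

/-- Move a maximal family of disjoint terms from the list `st.1` to the list `st.2`. -/
def selectRound {n : ℕ}
    (st : List (Finset (Fin (2 * n)) × ℂ) × List (Finset (Fin (2 * n)) × ℂ)) :
    List (Finset (Fin (2 * n)) × ℂ) × List (Finset (Fin (2 * n)) × ℂ) :=
  (st.1.foldl selectStep (∅, [], st.2)).2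

/-- The terms of the Hamiltonian in the order in which a Trotter step applies them: group after
group, each group being a greedily chosen maximal family of disjoint terms. -/
def schedule {n : ℕ} (LH : List (Finset (Fin (2 * n)) × ℂ)) : List (Finset (Fin (2 * n)) × ℂ) :=
  ((selectRound^[LH.length] (LH, [])).2).reverse

/-- The greedy selection splits off a family `sel` of disjoint terms, such that every rejected term
meets the union `U'` of the selected ones. -/
lemma foldl_selectStep {n : ℕ} (l : List (Finset (Fin (2 * n)) × ℂ)) (U : Finset (Fin (2 * n)))
    (rest out : List (Finset (Fin (2 * n)) × ℂ)) :
    ∃ (U' : Finset (Fin (2 * n))) (rest' sel : List (Finset (Fin (2 * n)) × ℂ)),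
      l.foldl selectStep (U, rest, out) = (U', rest', sel.reverse ++ out) ∧
      (sel ++ rest').Perm (l ++ rest) ∧ (sel.map Prod.fst).Pairwise Disjoint ∧
      (∀ m ∈ sel, Disjoint m.1 U) ∧
      (∀ x, x ∈ U' ↔ x ∈ U ∨ ∃ m ∈ sel, x ∈ m.1) ∧
      (∀ m ∈ rest', m ∈ rest ∨ ¬ Disjoint m.1 U') := by
  induction l generalizing U rest out with
  | nil => exact ⟨U, rest, [], rfl, by simp, by simp, by simp, by simp, fun m hm => Or.inl hm⟩
  | cons m l ih =>
    rw [List.foldl_cons]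
    by_cases h : (m.1 ∩ U).card = 0
    · have hd : Disjoint m.1 U := disjoint_iff_inter_eq_empty.2 (card_eq_zero.1 h)
      have hmem : ∀ x, x ∈ symmDiff m.1 U ↔ x ∈ m.1 ∨ x ∈ U := fun x => by
        rw [mem_symmDiff]
        have : x ∈ m.1 → x ∉ U := fun h1 => disjoint_left.1 hd h1
        tauto
      obtain ⟨U', rest', sel, h1, h2, h3, h4, h5, h6⟩ := ih (symmDiff m.1 U) rest (m :: out)
      refine ⟨U', rest', m :: sel, ?_, ?_, ?_, ?_, ?_, h6⟩
      · rw [selectStep, if_pos h, h1]; simp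
      · simpa using h2
      · rw [List.map_cons, List.pairwise_cons]
        refine ⟨fun Y hY => ?_, h3⟩
        obtain ⟨m', hm', rfl⟩ := List.mem_map.1 hY
        have := h4 m' hm'
        rw [disjoint_left] at this ⊢
        exact fun a ha hb => this hb ((hmem a).2 (Or.inl ha))
      · intro m' hm'
        rcases List.mem_cons.1 hm' with rfl | hm'
        · exact hd
        · have := h4 m' hm'
          rw [disjoint_left] at this ⊢
          exact fun a ha hb => this ha ((hmem a).2 (Or.inr hb))
      · intro x
        rw [h5, hmem]
        simp only [List.mem_cons, exists_eq_or_imp]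
        tauto
    · obtain ⟨U', rest', sel, h1, h2, h3, h4, h5, h6⟩ := ih U (m :: rest) out
      refine ⟨U', rest', sel, ?_, ?_, h3, h4, h5, ?_⟩
      · rw [selectStep, if_neg h, h1]
      · exact h2.trans List.perm_middle
      · intro m' hm'
        rcases h6 m' hm' with h7 | h7
        · rcases List.mem_cons.1 h7 with rfl | h8
          · refine Or.inr fun hd => h ?_
            rw [card_eq_zero, ← disjoint_iff_inter_eq_empty]
            rw [disjoint_left] at hd ⊢
            exact fun a ha hb => hd ha ((h5 a).2 (Or.inl hb))
          · exact Or.inl h8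
        · exact Or.inr h7

lemma selectRound_spec {n : ℕ} (rem out : List (Finset (Fin (2 * n)) × ℂ)) :
    ∃ sel rest' : List (Finset (Fin (2 * n)) × ℂ),
      selectRound (rem, out) = (rest', sel.reverse ++ out) ∧ (sel ++ rest').Perm rem ∧
      (sel.map Prod.fst).Pairwise Disjoint ∧
      ∀ m ∈ rest', ∃ m' ∈ sel, ¬ Disjoint m.1 m'.1 := by
  obtain ⟨U', rest', sel, h1, h2, h3, -, h5, h6⟩ := foldl_selectStep rem ∅ [] out
  refine ⟨sel, rest', by rw [selectRound, h1], by simpa using h2, h3, fun m hm => ?_⟩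
  have := (h6 m hm).resolve_left (by simp)
  obtain ⟨a, ha, hb⟩ := not_disjoint_iff.1 this
  obtain ⟨m', hm', hc⟩ := ((h5 a).1 hb).resolve_left (by simp)
  exact ⟨m', hm', not_disjoint_iff.2 ⟨a, ha, hc⟩⟩

open Classical in
/-- The state after `k` rounds: a term that remains meets a term of every group, and hence there are
fewer than `b` groups as long as terms remain, if no term meets more than `b` terms. -/
lemma selectRound_iterate {n b : ℕ} (LH : List (Finset (Fin (2 * n)) × ℂ))
    (hne : ∀ m ∈ LH, m.1.Nonempty)
    (hb : ∀ m ∈ LH, LH.countP (fun m' => ¬ Disjoint m.1 m'.1) ≤ b) (k : ℕ) :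
    ∃ (rem : List (Finset (Fin (2 * n)) × ℂ)) (gs : List (List (Finset (Fin (2 * n)) × ℂ))),
      selectRound^[k] (LH, []) = (rem, gs.flatten.reverse) ∧ (gs.flatten ++ rem).Perm LH ∧
      (∀ g ∈ gs, (g.map Prod.fst).Pairwise Disjoint) ∧
      (∀ m ∈ rem, ∀ g ∈ gs, ∃ m' ∈ g, ¬ Disjoint m.1 m'.1) ∧ gs.length ≤ b ∧
      rem.length ≤ LH.length - k := by
  induction k with
  | zero => exact ⟨LH, [], rfl, by simp, by simp, by simp, by simp, by simp⟩
  | succ k ih =>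
    obtain ⟨rem, gs, h1, h2, h3, h4, h5, h6⟩ := ih
    obtain ⟨sel, rest', s1, s2, s3, s4⟩ := selectRound_spec rem gs.flatten.reverse
    rw [Function.iterate_succ_apply', h1, s1]
    rcases rem with _ | ⟨m, rem⟩
    · have := s2.length_eq
      simp only [List.length_append, List.length_nil, Nat.add_eq_zero_iff,
        List.length_eq_zero_iff] at this
      obtain ⟨rfl, rfl⟩ := this
      exact ⟨[], gs, by simp, h2, h3, by simp, h5, by simp⟩
    · refine ⟨rest', gs ++ [sel], by simp, ?_, ?_, ?_, ?_, ?_⟩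
      · simp only [List.flatten_append, List.flatten_cons, List.flatten_nil, List.append_nil,
          List.append_assoc]
        exact (s2.append_left _).trans h2
      · intro g hg
        rcases List.mem_append.1 hg with hg | hg
        · exact h3 g hg
        · rw [List.mem_singleton.1 hg]; exact s3
      · intro m' hm' g hg
        rcases List.mem_append.1 hg with hg | hg
        · exact h4 m' (s2.subset (List.mem_append_right _ hm')) g hg
        · rw [List.mem_singleton.1 hg]; exact s4 m' hm'
      · have hm : m ∈ LH := h2.subset (List.mem_append_right _ List.mem_cons_self)
        have hc := hb m hm
        rw [← h2.countP_eq, List.countP_append, List.countP_flatten, List.countP_cons] at hc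
        have hself : ¬ Disjoint m.1 m.1 := by
          rw [disjoint_self_iff_empty]; exact (hne m hm).ne_empty
        simp only [hself, not_false_eq_true, decide_true, if_true] at hc
        have hlen : gs.length ≤ (gs.map (List.countP fun m' => ¬ Disjoint m.1 m'.1)).sum := by
          have h7 := fun g hg => h4 m List.mem_cons_self g hg
          clear hc h1 h2 h3 h4 h5 s1
          induction gs with
          | nil => simp
          | cons g gs ih =>
            obtain ⟨m', hm', hd⟩ := h7 g List.mem_cons_self
            have hp : 0 < g.countP (fun m' => ¬ Disjoint m.1 m'.1) :=
              List.countP_pos_iff.2 ⟨m', hm', by simpa using hd⟩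
            have := ih (fun g' hg' => h7 g' (List.mem_cons_of_mem _ hg'))
            rw [List.length_cons, List.map_cons, List.sum_cons]
            omega
        rw [List.length_append, List.length_singleton]
        omega
      · have hsel : sel ≠ [] := by
          rintro rfl
          cases rest' with
          | nil => simpa using s2.length_eq
          | cons m' rest' => simpa using s4 m' List.mem_cons_self
        have h7 := s2.length_eq
        have := List.length_pos_iff.2 hsel
        rw [List.length_append, List.length_cons] at h7
        rw [List.length_cons] at h6
        omega

/-- At most `Δ |W|` terms meet `W`. -/
lemma IsMonomialList.countP_le {n Δ : ℕ} {h : Finset (Fin (2 * n)) → ℂ}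
    {LH : List (Finset (Fin (2 * n)) × ℂ)} (hL : IsMonomialList LH h) (hs : IsSparse Δ h)
    (p : Finset (Fin (2 * n)) → Prop) [DecidablePred p] (W : Finset (Fin (2 * n)))
    (hW : ∀ X, p X → ¬ Disjoint W X) : LH.countP (fun m => p m.1) ≤ Δ * W.card := by
  have hmap : LH.countP (fun m => p m.1) = ((LH.map Prod.fst).filter p).length := by
    rw [← List.countP_eq_length_filter, List.countP_map]; rfl
  rw [hmap, ← List.toFinset_card_of_nodup (hL.nodup_keys.filter _)]
  have hsub : ((LH.map Prod.fst).filter p).toFinset ⊆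
      W.biUnion (fun i => (terms h).filter (fun X => i ∈ X)) := by
    intro X hX
    rw [List.mem_toFinset, List.mem_filter] at hX
    obtain ⟨m, hm, rfl⟩ := List.mem_map.1 hX.1
    obtain ⟨i, hi, hi'⟩ := not_disjoint_iff.1 (hW m.1 (by simpa using hX.2))
    have h1 := (hL.2 m.1 m.2).1 hm
    exact mem_biUnion.2 ⟨i, hi, mem_filter.2 ⟨mem_filter.2 ⟨mem_univ _, h1.1 ▸ h1.2⟩, hi'⟩⟩
  refine (card_le_card hsub).trans (card_biUnion_le.trans ?_)
  refine (Finset.sum_le_sum fun i _ => hs i).trans ?_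
  simp [mul_comm]

lemma IsMonomialList.mem_terms {n : ℕ} {h : Finset (Fin (2 * n)) → ℂ}
    {LH : List (Finset (Fin (2 * n)) × ℂ)} (hL : IsMonomialList LH h)
    {m : Finset (Fin (2 * n)) × ℂ} (hm : m ∈ LH) : m.1 ∈ terms h := by
  have := (hL.2 m.1 m.2).1 hm
  exact mem_filter.2 ⟨mem_univ _, this.1 ▸ this.2⟩

lemma IsMonomialList.length_le {n Δ : ℕ} {h : Finset (Fin (2 * n)) → ℂ}
    {LH : List (Finset (Fin (2 * n)) × ℂ)} (hL : IsMonomialList LH h) (hq : IsQuartic h)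
    (hs : IsSparse Δ h) : LH.length ≤ Δ * (2 * n) := by
  have h1 := hL.countP_le hs (fun X => ¬ Disjoint univ X) univ (fun X hX => hX)
  rw [card_univ, Fintype.card_fin] at h1
  refine le_trans (le_of_eq ?_) h1
  rw [eq_comm, List.countP_eq_length]
  intro m hm
  have hc := hq.card_eq m.1 (hL.mem_terms hm)
  have : m.1.Nonempty := card_pos.1 (by omega)
  obtain ⟨a, ha⟩ := this
  exact decide_eq_true (not_disjoint_iff.2 ⟨a, mem_univ a, ha⟩)

/-- The groups of the greedy colouring. -/
lemma exists_groups {n Δ : ℕ} {h : Finset (Fin (2 * n)) → ℂ}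
    {LH : List (Finset (Fin (2 * n)) × ℂ)} (hL : IsMonomialList LH h) (hq : IsQuartic h)
    (hs : IsSparse Δ h) : ∃ gs : List (List (Finset (Fin (2 * n)) × ℂ)),
      schedule LH = gs.flatten ∧ gs.flatten.Perm LH ∧
      (∀ g ∈ gs, (g.map Prod.fst).Pairwise Disjoint) ∧ gs.length ≤ 4 * Δ := by
  classical
  have hcard : ∀ m ∈ LH, m.1.card = 2 ∨ m.1.card = 4 := fun m hm => hq.card_eq _ (hL.mem_terms hm)
  obtain ⟨rem, gs, h1, h2, h3, -, h5, h6⟩ := selectRound_iterate (b := 4 * Δ) LH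
    (fun m hm => card_pos.1 (by have := hcard m hm; omega))
    (fun m hm => by
      refine (hL.countP_le hs (fun X => ¬ Disjoint m.1 X) m.1 fun X hX => hX).trans ?_
      rw [mul_comm]
      exact Nat.mul_le_mul_right _ (by have := hcard m hm; omega)) LH.length
  rw [Nat.sub_self, Nat.le_zero, List.length_eq_zero_iff] at h6
  subst h6
  rw [List.append_nil] at h2
  exact ⟨gs, by rw [schedule, h1, List.reverse_reverse], h2, h3, h5⟩

/-- Evolution under the terms of a list, the first one innermost. -/
def evolveTerms {n : ℕ} (R : List (Finset (Fin (2 * n)) × ℂ)) (s : ℝ) (A : FockOp n) : FockOp n :=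
  R.foldl (fun B r => evolve (r.2 • majoranaString r.1) s B) A

/-- Disjoint terms of even size commute, so that the evolution under their sum factorizes. -/
lemma evolve_denote_eq {n : ℕ} (g : List (Finset (Fin (2 * n)) × ℂ))
    (hg : (g.map Prod.fst).Pairwise Disjoint) (hc : ∀ m ∈ g, Even m.1.card) (s : ℝ)
    (A : FockOp n) : evolve (denote g) s A = evolveTerms g s A := by
  induction g generalizing A with
  | nil => simp [evolve, evolveTerms]
  | cons m g ih =>
    rw [List.map_cons, List.pairwise_cons] at hg
    have hcomm : Commute (m.2 • majoranaString m.1) (denote g) := by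
      have hm := hc m List.mem_cons_self
      have h1 := hg.1
      clear ih hc hg
      induction g with
      | nil => exact Commute.zero_right _
      | cons m' g ih =>
        rw [denote_cons]
        refine Commute.add_right ?_ (ih fun Y hY => h1 Y (by simp at hY ⊢; right; exact hY))
        have hd := h1 m'.1 (by simp)
        have := majoranaString_comm m.1 m'.1 hm
        rw [disjoint_iff_inter_eq_empty.1 hd, card_empty, pow_zero, one_smul] at this
        exact (Commute.smul_left this _).smul_right _
    rw [denote_cons, evolve_comp_of_commute hcomm,
      ih hg.2 (fun m' hm' => hc m' (List.mem_cons_of_mem _ hm'))]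
    rfl

/-- The greedy groups form a valid colouring, for which a Trotter step is the evolution under the
terms in the scheduled order. -/
lemma exists_colouring {n Δ : ℕ} {h : Finset (Fin (2 * n)) → ℂ}
    {LH : List (Finset (Fin (2 * n)) × ℂ)} (hL : IsMonomialList LH h) (hq : IsQuartic h)
    (hs : IsSparse Δ h) : ∃ (G : ℕ) (c : Finset (Fin (2 * n)) → ℕ), G ≤ 4 * Δ ∧
      IsColouring h G c ∧ ∀ s A, trotter h G c s A = evolveTerms (schedule LH) s A := by
  classical
  obtain ⟨gs, h1, h2, h3, h4⟩ := exists_groups hL hq hs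
  set ks := gs.map (List.map Prod.fst) with hks
  have hnd : ks.flatten.Nodup := by
    rw [hks, ← List.map_flatten]; exact (h2.map _).nodup_iff.2 hL.nodup_keys
  obtain ⟨hnd1, hnd2⟩ := List.nodup_flatten.1 hnd
  have hkmem : ∀ X, X ∈ ks.flatten ↔ X ∈ terms h := fun X => by
    rw [hks, ← List.map_flatten, (h2.map _).mem_iff]
    constructor
    · intro hX
      obtain ⟨m, hm, rfl⟩ := List.mem_map.1 hX
      exact hL.mem_terms hm
    · intro hX
      exact List.mem_map.2 ⟨(X, h X), (hL.2 X _).2 ⟨rfl, (mem_filter.1 hX).2⟩, rfl⟩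
  set c : Finset (Fin (2 * n)) → ℕ := fun X => ks.findIdx (fun k => decide (X ∈ k)) with hc
  have hlen : ks.length = gs.length := by simp [hks]
  have hfind : ∀ X (i : ℕ) (hi : i < ks.length), X ∈ ks[i] → c X = i := by
    intro X i hi hX
    rw [hc]
    refine (List.findIdx_eq hi).2 ⟨by simpa using hX, fun j hj => ?_⟩
    have := List.pairwise_iff_getElem.1 hnd2 j i (hj.trans hi) hi hj
    simpa using fun hX' => this hX' hX
  have hmemc : ∀ X ∈ terms h, ∃ hi : c X < ks.length, X ∈ ks[c X] := by
    intro X hX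
    obtain ⟨k, hk, hXk⟩ := List.mem_flatten.1 ((hkmem X).2 hX)
    obtain ⟨i, hi, rfl⟩ := List.mem_iff_getElem.1 hk
    have := hfind X i hi hXk
    rw [this]; exact ⟨hi, hXk⟩
  refine ⟨gs.length, c, h4, ⟨fun X hX => hlen ▸ (hmemc X hX).1, ?_⟩, ?_⟩
  · intro X hX Y hY hne he
    obtain ⟨i1, hX1⟩ := hmemc X hX
    obtain ⟨i2, hY1⟩ := hmemc Y hY
    simp only [← he] at hY1
    have hp : (ks[c X]).Pairwise Disjoint := by
      have : ks[c X] ∈ ks := List.getElem_mem _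
      obtain ⟨g, hg, hg'⟩ := List.mem_map.1 this
      rw [← hg']; exact h3 g hg
    exact hp.forall hX1 hY1 hne
  · intro s A
    have hgroup : ∀ (i : ℕ) (hi : i < gs.length), groupHam h c i = denote gs[i] := by
      intro i hi
      have hi' : i < ks.length := hlen ▸ hi
      have e : ks[i] = gs[i].map Prod.fst := by simp [hks]
      have hset : (terms h).filter (fun X => c X = i) = (ks[i]).toFinset := by
        ext X
        rw [mem_filter, List.mem_toFinset]
        constructor
        · rintro ⟨hX, rfl⟩; exact (hmemc X hX).2
        · intro hX
          exact ⟨(hkmem X).1 (List.mem_flatten.2 ⟨_, List.getElem_mem _, hX⟩),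
            hfind X i hi' hX⟩
      rw [groupHam, hset, List.sum_toFinset _ (hnd1 _ (List.getElem_mem _)), denote, e,
        List.map_map]
      congr 1
      refine List.map_congr_left fun m hm => ?_
      have : m ∈ LH := h2.subset (List.mem_flatten.2 ⟨_, List.getElem_mem hi, hm⟩)
      rw [((hL.2 m.1 m.2).1 this).1]; rfl
    have hev : ∀ g ∈ gs, ∀ m ∈ g, Even m.1.card := fun g hg m hm => by
      have : m ∈ LH := h2.subset (List.mem_flatten.2 ⟨g, hg, hm⟩)
      rcases hq.card_eq _ (hL.mem_terms this) with h | h <;> rw [h] <;> decide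
    have hmap : (List.range gs.length).map (groupHam h c) = gs.map denote := by
      refine List.ext_getElem (by simp) fun i hi1 hi2 => ?_
      simp only [List.getElem_map, List.getElem_range]
      exact hgroup i (by simpa using hi2)
    rw [trotter_eq, hmap, h1, evolveList, evolveTerms, List.foldl_flatten, List.foldl_map]
    refine List.foldl_ext _ _ _ fun B g hg => ?_
    exact evolve_denote_eq g (h3 g hg) (hev g hg) s B

/-! ### Running programs within a step bound -/

/-- The program `p` turns `v` into `w` within at most `b` steps. -/
def Ev (p : Program) (v w : Value) (b : ℕ) : Prop := ∃ k ≤ b, Runs p v w k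

lemma Runs.ev {p : Program} {v w w' : Value} {k b : ℕ} (h : Runs p v w' k) (hw : w' = w)
    (hk : k ≤ b) : Ev p v w b := ⟨k, hk, hw ▸ h⟩

lemma Ev.mono {p : Program} {v w : Value} {b b' : ℕ} (h : Ev p v w b) (hb : b ≤ b') :
    Ev p v w b' := let ⟨k, hk, hr⟩ := h; ⟨k, hk.trans hb, hr⟩

/-- Iterate `b` over a list: on `(list, state)`, replace the state by the value of `b` at
`(element, state)` for each element in turn. -/
def foldP (b : Program) : Program :=
  .loop .fst (.pair (.comp .snd .fst) (.comp b (.pair (.comp .fst .fst) .snd)))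

/-- Evaluation of a loop over a list, with an invariant `I` that may depend on the elements still
to come. -/
lemma foldP_ev {α σ : Type} {f : α → Value} {e : σ → Value} {g : σ → α → σ}
    {b : Program} {B : ℕ} (I : List α → σ → Prop)
    (hstep : ∀ a l s, I (a :: l) s →
      I l (g s a) ∧ Ev b (.cons (f a) (e s)) (e (g s a)) B) (l : List α) (s : σ) (hI : I l s) :
    Ev (foldP b) (.cons (encodeList f l) (e s)) (.cons .nil (e (l.foldl g s)))
      (l.length * (B + 12) + 2) := by
  induction l generalizing s with
  | nil => exact ⟨2, by simp, Runs.loop_done (Runs.fst _ _)⟩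
  | cons a l ih =>
    obtain ⟨h1, k, hk, hr⟩ := hstep a l s hI
    obtain ⟨k', hk', hr'⟩ := ih (g s a) h1
    refine Runs.ev (Runs.loop_step (Runs.fst _ _) (by simp [encodeList])
      (Runs.pair (Runs.comp (Runs.fst _ _) (Runs.snd _ _))
        (Runs.comp (Runs.pair (Runs.comp (Runs.fst _ _) (Runs.fst _ _)) (Runs.snd _ _)) hr))
      hr') rfl ?_
    rw [List.length_cons, add_mul]
    omega

/-- Branching on a comparison. -/
def ifLe (p q a b : Program) : Program := .cond (.comp .le (.pair p q)) a b

lemma ifLe_ev {p q a b : Program} {v w : Value} {x y : ℝ} {B i j : ℕ}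
    (hp : Ev p v (.num x) i) (hq : Ev q v (.num y) j) (ha : x ≤ y → Ev a v w B)
    (hb : ¬ x ≤ y → Ev b v w B) : Ev (ifLe p q a b) v w (i + j + B + 4) := by
  obtain ⟨i', hi, hp⟩ := hp
  obtain ⟨j', hj, hq⟩ := hq
  by_cases h : x ≤ y
  · obtain ⟨k, hk, hr⟩ := ha h
    exact Runs.ev (Runs.cond_true (Runs.comp (Runs.pair hp hq) (Runs.le_true _ _ h)) (by simp) hr)
      rfl (by omega)
  · obtain ⟨k, hk, hr⟩ := hb h
    exact Runs.ev (Runs.cond_false (Runs.comp (Runs.pair hp hq) (Runs.le_false _ _ h)) hr)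
      rfl (by omega)

lemma cond_nil_ev {c p q : Program} {v w : Value} {i j : ℕ} (hc : Ev c v .nil i)
    (hq : Ev q v w j) : Ev (.cond c p q) v w (i + j + 1) := by
  obtain ⟨i', hi, hc⟩ := hc
  obtain ⟨j', hj, hq⟩ := hq
  exact Runs.ev (Runs.cond_false hc hq) rfl (by omega)

lemma cond_cons_ev {c p q : Program} {v w a b : Value} {i j : ℕ} (hc : Ev c v (.cons a b) i)
    (hp : Ev p v w j) : Ev (.cond c p q) v w (i + j + 1) := by
  obtain ⟨i', hi, hc⟩ := hc
  obtain ⟨j', hj, hp⟩ := hp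
  exact Runs.ev (Runs.cond_true hc (by simp) hp) rfl (by omega)

lemma comp_ev {p q : Program} {v a b : Value} {i j : ℕ} (hp : Ev p v a i) (hq : Ev q a b j) :
    Ev (.comp q p) v b (i + j + 1) := by
  obtain ⟨i', hi, hp⟩ := hp
  obtain ⟨j', hj, hq⟩ := hq
  exact Runs.ev (Runs.comp hp hq) rfl (by omega)

/-- The component number `1` of a right-nested tuple, counted from `0`. -/
abbrev get1 : Program := .comp .fst .snd

/-- A right-nested tuple without its first two components. -/
abbrev tail2 : Program := .comp .snd .snd

/-- The component number `2` of a right-nested tuple, counted from `0`. -/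
abbrev get2 : Program := .comp .fst tail2

/-- A right-nested tuple without its first three components. -/
abbrev tail3 : Program := .comp .snd tail2

/-- The component number `3` of a right-nested tuple, counted from `0`. -/
abbrev get3 : Program := .comp .fst tail3

/-- A right-nested tuple without its first four components. -/
abbrev tail4 : Program := .comp .snd tail3

/-- Reverse the first list onto the second one. -/
def revOntoP : Program := .comp .snd (foldP .id)

lemma revOntoP_ev {α : Type} (f : α → Value) (l acc : List α) :
    Ev revOntoP (.cons (encodeList f l) (encodeList f acc)) (encodeList f (l.reverse ++ acc))
      (l.length * 13 + 4) := by
  obtain ⟨k, hk, hr⟩ := foldP_ev (f := f) (e := encodeList f) (g := fun s a => a :: s) (b := .id)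
    (B := 1) (fun _ _ => True) (fun a l s _ => ⟨trivial, 1, le_rfl, Runs.id _⟩) l acc trivial
  refine Runs.ev (Runs.comp hr (Runs.snd _ _)) ?_ (by omega)
  congr 1
  have : ∀ (l acc : List α), l.foldl (fun s a => a :: s) acc = l.reverse ++ acc := by
    intro l
    induction l with
    | nil => intro acc; rfl
    | cons a l ih => intro acc; rw [List.foldl_cons, ih]; simp
  exact this l acc

/-! ### Programs for sets of modes -/

/-- The encoding of a mode. -/
def encMode {n : ℕ} (x : Fin (2 * n)) : Value := .num (x.val : ℝ)

/-- One step of the toggling of a mode: the state consists of the mode, as a list that is emptied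
once its position has been found, the reversed initial segment, the sign and the counter. -/
def toggleStep {n : ℕ} (st : List (Fin (2 * n)) × List (Fin (2 * n)) × ℝ × ℕ) (y : Fin (2 * n)) :
    List (Fin (2 * n)) × List (Fin (2 * n)) × ℝ × ℕ :=
  match st.1 with
  | [] => ([], y :: st.2.1, st.2.2.1, st.2.2.2)
  | x :: p => if x ≤ y then
      (if y ≤ x then ([], st.2.1, st.2.2.1, st.2.2.2 + 1)
        else ([], y :: x :: st.2.1, st.2.2.1, st.2.2.2))
      else (x :: p, y :: st.2.1, 0 - st.2.2.1, st.2.2.2)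

/-- After the whole list, the mode is still in the first component if it exceeds all elements, and
has to be appended. -/
lemma foldl_toggleStep {n : ℕ} (l acc p : List (Fin (2 * n))) (x : Fin (2 * n)) (s : ℝ) (m : ℕ)
    (hp : p = []) :
    ((l.foldl toggleStep (x :: p, acc, s, m)).2.1.reverse ++
        (l.foldl toggleStep (x :: p, acc, s, m)).1 = acc.reverse ++ toggle x l) ∧
      (l.foldl toggleStep (x :: p, acc, s, m)).2.2 = (s * toggleSign x l, m + toggleCount x l) ∧
      (l.foldl toggleStep (x :: p, acc, s, m)).2.1.length ≤ acc.length + l.length + 1 := by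
  subst hp
  have hnil : ∀ (l acc : List (Fin (2 * n))) (s : ℝ) (m : ℕ),
      l.foldl toggleStep ([], acc, s, m) = ([], l.reverse ++ acc, s, m) := by
    intro l
    induction l with
    | nil => intros; rfl
    | cons y l ih => intro acc s m; rw [List.foldl_cons, toggleStep]; dsimp only; rw [ih]; simp
  induction l generalizing acc s m with
  | nil => simp [toggle, toggleSign, toggleCount]
  | cons y l ih =>
    rw [List.foldl_cons, toggleStep]
    dsimp only
    simp only [toggle, toggleSign, toggleCount]
    split_ifs with h1 h2
    · rw [hnil]; simp; omega
    · rw [hnil]; simp; omega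
    · obtain ⟨i1, i2, i3⟩ := ih (y :: acc) (0 - s) m
      refine ⟨by rw [i1]; simp, by rw [i2]; simp, ?_⟩
      rw [List.length_cons] at i3 ⊢; omega

/-- The program of `toggleStep`. -/
def toggleStepP : Program :=
  .cond get1
    (ifLe (.comp .fst get1) .fst
      (ifLe .fst (.comp .fst get1)
        (.pair .nil (.pair get2 (.pair get3 (.comp .add (.pair tail4 .one)))))
        (.pair .nil (.pair (.pair .fst (.pair (.comp .fst get1) get2)) tail3)))
      (.pair get1 (.pair (.pair .fst get2) (.pair (.comp .sub (.pair .zero get3)) tail4))))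
    (.pair .nil (.pair (.pair .fst get2) tail3))

/-- The encoding of the state of `toggleStep`. -/
def encToggle {n : ℕ} (st : List (Fin (2 * n)) × List (Fin (2 * n)) × ℝ × ℕ) : Value :=
  .cons (encodeList encMode st.1) (.cons (encodeList encMode st.2.1)
    (.cons (.num st.2.2.1) (.num (st.2.2.2 : ℝ))))

lemma toggleStepP_ev {n : ℕ} (st : List (Fin (2 * n)) × List (Fin (2 * n)) × ℝ × ℕ)
    (y : Fin (2 * n)) :
    Ev toggleStepP (.cons (encMode y) (encToggle st)) (encToggle (toggleStep st y)) 100 := by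
  obtain ⟨p, acc, s, m⟩ := st
  rcases p with _ | ⟨x, p⟩
  · exact (cond_nil_ev (i := 3) (j := 40)
      (Runs.ev (by repeat' constructor) rfl (by norm_num))
      (Runs.ev (by repeat' constructor) rfl (by norm_num))).mono (by norm_num)
  · have hx : Ev (.comp .fst get1) (.cons (encMode y) (encToggle (x :: p, acc, s, m)))
        (.num (x.val : ℝ)) 5 := Runs.ev (by repeat' constructor) rfl (by norm_num)
    have hy : Ev .fst (.cons (encMode y) (encToggle (x :: p, acc, s, m))) (.num (y.val : ℝ)) 1 :=
      Runs.ev (by repeat' constructor) rfl (by norm_num)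
    refine (cond_cons_ev (i := 3) (a := encMode x) (b := encodeList encMode p)
      (Runs.ev (by repeat' constructor) rfl (by norm_num))
      (ifLe_ev (B := 60) hx hy (fun h1 => (ifLe_ev (B := 40) hy hx
        (fun h2 => ?_) (fun h2 => ?_)).mono (by norm_num)) (fun h1 => ?_))).mono (by norm_num)
    · have h1' : x ≤ y := by exact_mod_cast h1
      have h2' : y ≤ x := by exact_mod_cast h2
      exact Runs.ev (by repeat' constructor) (by simp [toggleStep, h1', h2', encToggle, encodeList])
        (by norm_num)
    · have h1' : x ≤ y := by exact_mod_cast h1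
      have h2' : ¬ y ≤ x := fun h => h2 (by exact_mod_cast h)
      exact Runs.ev (by repeat' constructor) (by simp [toggleStep, h1', h2', encToggle, encodeList])
        (by norm_num)
    · have h1' : ¬ x ≤ y := fun h => h1 (by exact_mod_cast h)
      exact Runs.ev (by repeat' constructor) (by simp [toggleStep, h1', encToggle, encodeList])
        (by norm_num)

/-- Toggle a mode: `(x, (l, (s, m)))` becomes `(l', (s', m'))`. -/
def toggleP : Program :=
  .comp
    (.pair (.comp revOntoP (.pair (.comp .fst tail2) get1)) tail3)
    (.comp (foldP toggleStepP)
      (.pair get1 (.pair (.pair .fst .nil) (.pair .nil tail2))))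

lemma toggleP_ev {n V : ℕ} (x : Fin (2 * n)) (l : List (Fin (2 * n))) (s : ℝ) (m : ℕ)
    (hl : l.length ≤ V) :
    Ev toggleP (.cons (encMode x) (.cons (encodeList encMode l) (.cons (.num s) (.num (m : ℝ)))))
      (.cons (encodeList encMode (toggle x l))
        (.cons (.num (s * toggleSign x l)) (.num ((m + toggleCount x l : ℕ) : ℝ))))
      (125 * V + 80) := by
  obtain ⟨h1, h2, h3⟩ := foldl_toggleStep l [] [] x s m rfl
  obtain ⟨k1, hk1, r1⟩ := foldP_ev (f := encMode) (e := encToggle) (g := toggleStep)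
    (b := toggleStepP) (B := 100) (fun _ _ => True)
    (fun y l st _ => ⟨trivial, toggleStepP_ev st y⟩) l ([x], [], s, m) trivial
  set st := l.foldl toggleStep ([x], [], s, m) with hst
  obtain ⟨k2, hk2, r2⟩ := revOntoP_ev encMode st.2.1 st.1
  rw [h1] at r2
  have e : st = (st.1, st.2.1, s * toggleSign x l, m + toggleCount x l) := by rw [← h2]
  rw [e] at r1
  refine Runs.ev (by repeat' first | exact r1 | exact r2 | constructor) rfl ?_
  simp only [List.length_nil, zero_add] at h3
  have : k1 ≤ V * 112 + 2 := hk1.trans (by have := Nat.mul_le_mul_right 112 hl; omega)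
  omega

/-- Toggle all modes of a set: `(X, (Y, (1, 0)))` becomes `(X ∆ Y, (mulSign X Y, |X ∩ Y|))`. -/
def toggleSetP : Program :=
  .comp .snd (.comp (foldP toggleP) (.pair .fst (.pair .snd (.pair .one .zero))))

lemma length_sort_le {n : ℕ} (X : Finset (Fin (2 * n))) :
    (X.sort (· ≤ ·)).length ≤ 2 * n + 1 := by
  rw [length_sort]
  exact (card_le_univ X).trans (by simp)

lemma toggleSetP_ev {n : ℕ} (X Y : Finset (Fin (2 * n))) :
    Ev toggleSetP (.cons (encodeSet X) (encodeSet Y))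
      (.cons (encodeSet (symmDiff X Y))
        (.cons (.num (mulSign X Y)) (.num ((X ∩ Y).card : ℝ))))
      (300 * (2 * n + 1) ^ 2) := by
  set V := 2 * n + 1 with hV
  obtain ⟨k1, hk1, r1⟩ := foldP_ev (f := encMode)
    (e := fun st : List (Fin (2 * n)) × ℝ × ℕ =>
      .cons (encodeList encMode st.1) (.cons (.num st.2.1) (.num (st.2.2 : ℝ))))
    (g := fun st x => (toggle x st.1, st.2.1 * toggleSign x st.1, st.2.2 + toggleCount x st.1))
    (b := toggleP) (B := 125 * V + 80)
    (fun _ st => ∃ Z : Finset (Fin (2 * n)), st.1 = Z.sort (· ≤ ·))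
    (fun x l st ⟨Z, hZ⟩ => ⟨⟨symmDiff Z {x}, by dsimp only; rw [hZ, (toggle_sort x Z).1]⟩,
      toggleP_ev x st.1 st.2.1 st.2.2 (by rw [hZ]; exact length_sort_le Z)⟩)
    (X.sort (· ≤ ·)) (Y.sort (· ≤ ·), 1, 0) ⟨Y, rfl⟩
  have h := toggleList_finset X Y
  rw [toggleList] at h
  rw [h] at r1
  have e0 : Value.num ((0 : ℕ) : ℝ) = Value.num 0 := by simp
  simp only [e0] at r1
  refine Runs.ev (by repeat' first | exact r1 | constructor) rfl ?_
  have h1 := Nat.mul_le_mul_right (125 * V + 80 + 12) (length_sort_le X)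
  have h2 : 1 ≤ V := by omega
  nlinarith

/-- Length of a list and exponent `r` for sets of this length. -/
def lengthP : Program :=
  .comp (.pair get1 get2) (.comp
    (foldP (.pair (.comp .add (.pair get1 .one))
      (.pair (.comp .snd tail2) (.comp .sub (.pair .one get2)))))
    (.pair .id (.pair .zero (.pair .zero .zero))))

lemma phaseExp_add_two (k : ℕ) : (phaseExp (k + 2) : ℝ) = 1 - phaseExp k := by
  unfold phaseExp
  split_ifs <;> first | omega | norm_num

lemma lengthP_ev {n : ℕ} (X : Finset (Fin (2 * n))) :
    Ev lengthP (encodeSet X) (.cons (.num (X.card : ℝ)) (.num (phaseExp X.card : ℝ)))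
      (100 * (2 * n + 1)) := by
  obtain ⟨k1, hk1, r1⟩ := foldP_ev (f := encMode) (α := Fin (2 * n))
    (e := fun k : ℕ => .cons (.num (k : ℝ))
      (.cons (.num (phaseExp k : ℝ)) (.num (phaseExp (k + 1) : ℝ))))
    (g := fun k _ => k + 1)
    (b := .pair (.comp .add (.pair get1 .one))
      (.pair (.comp .snd tail2) (.comp .sub (.pair .one get2)))) (B := 50)
    (fun _ _ => True)
    (fun x l k _ => ⟨trivial, Runs.ev (by repeat' constructor)
      (by rw [phaseExp_add_two]; push_cast; rfl) (by norm_num)⟩)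
    (X.sort (· ≤ ·)) 0 trivial
  have hfold : (X.sort (· ≤ ·)).foldl (fun k _ => k + 1) 0 = X.card := by
    rw [← length_sort (s := X) (· ≤ ·)]
    generalize X.sort (· ≤ ·) = l
    have : ∀ (l : List (Fin (2 * n))) (k : ℕ), l.foldl (fun k _ => k + 1) k = k + l.length := by
      intro l
      induction l with
      | nil => intro k; rfl
      | cons a l ih => intro k; rw [List.foldl_cons, ih, List.length_cons]; omega
    rw [this, zero_add]
  rw [hfold] at r1
  have e1 : (phaseExp 0 : ℝ) = 0 := by simp [phaseExp]
  have e2 : (phaseExp (0 + 1) : ℝ) = 0 := by simp [phaseExp]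
  simp only [e1, e2, Nat.cast_zero] at r1
  refine Runs.ev (by repeat' first | exact r1 | constructor) rfl ?_
  have h1 := Nat.mul_le_mul_right (50 + 12) (length_sort_le X)
  omega

/-! ### Programs for polynomials -/

/-- The encoding of a monomial. -/
def encMono {n : ℕ} (m : Finset (Fin (2 * n)) × ℂ) : Value :=
  .cons (encodeSet m.1) (.cons (.num m.2.re) (.num m.2.im))

/-- The program of `addStep`, on `(m, (current monomial, output))`. -/
def addStepP : Program :=
  .comp
    (.cond (.comp .fst .fst)
      (.pair (.comp .fst tail2) (.pair get1 (.comp .snd tail2)))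
      (.pair
        (.pair (.comp .fst (.comp .fst tail2))
          (.pair
            (.comp .add (.pair (.comp get1 (.comp .fst tail2)) (.comp get1 get1)))
            (.comp .add (.pair (.comp tail2 (.comp .fst tail2)) (.comp tail2 get1)))))
        (.comp .snd tail2)))
    (.pair (.comp toggleSetP (.pair (.comp .fst .fst) (.comp .fst get1))) .id)

/-- The encoding of the state of `addStep`. -/
def encAdd {n : ℕ} (st : (Finset (Fin (2 * n)) × ℂ) × List (Finset (Fin (2 * n)) × ℂ)) : Value :=
  .cons (encMono st.1) (encodeList encMono st.2)

lemma addStepP_ev {n : ℕ} (st : (Finset (Fin (2 * n)) × ℂ) × List (Finset (Fin (2 * n)) × ℂ))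
    (m : Finset (Fin (2 * n)) × ℂ) :
    Ev addStepP (.cons (encMono m) (encAdd st)) (encAdd (addStep st m))
      (300 * (2 * n + 1) ^ 2 + 100) := by
  have r1 := toggleSetP_ev m.1 st.1.1
  have hpre : Ev (.pair (.comp toggleSetP (.pair (.comp .fst .fst) (.comp .fst get1))) .id)
      (.cons (encMono m) (encAdd st))
      (.cons (.cons (encodeSet (symmDiff m.1 st.1.1))
        (.cons (.num (mulSign m.1 st.1.1)) (.num ((m.1 ∩ st.1.1).card : ℝ))))
        (.cons (encMono m) (encAdd st))) (300 * (2 * n + 1) ^ 2 + 12) := by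
    obtain ⟨k1, hk1, r1⟩ := r1
    exact Runs.ev (by repeat' first | exact r1 | constructor) rfl (by omega)
  refine (comp_ev (j := 80) hpre ?_).mono (by omega)
  by_cases h : m.1 = st.1.1
  · have e : encodeSet (symmDiff m.1 st.1.1) = .nil := by
      rw [h]; simp [encodeSet, encodeList]
    rw [e]
    refine (cond_nil_ev (i := 3) (j := 70) (Runs.ev (by repeat' constructor) rfl (by norm_num))
      (Runs.ev (by repeat' constructor) ?_ (by norm_num))).mono (by norm_num)
    simp [addStep, h, encAdd, encMono]
  · obtain ⟨a, b, e⟩ : ∃ a b, encodeSet (symmDiff m.1 st.1.1) = .cons a b := by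
      unfold encodeSet
      rcases hl : (symmDiff m.1 st.1.1).sort (· ≤ ·) with _ | ⟨x, l⟩
      · have := congrArg List.length hl
        rw [length_sort, List.length_nil, card_eq_zero] at this
        exact absurd (symmDiff_eq_bot.1 this) h
      · exact ⟨_, _, rfl⟩
    rw [e]
    refine (cond_cons_ev (i := 3) (j := 70) (Runs.ev (by repeat' constructor) rfl (by norm_num))
      (Runs.ev (by repeat' constructor) ?_ (by norm_num))).mono (by norm_num)
    simp [addStep, h, encAdd, encodeList]

/-- Add a monomial to a polynomial: the program of `addMono`, on `(m, L)`. -/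
def addMonoP : Program := .comp .snd (.comp (foldP addStepP) (.pair .snd (.pair .fst .nil)))

lemma addMonoP_ev {n M : ℕ} (L : List (Finset (Fin (2 * n)) × ℂ))
    (m : Finset (Fin (2 * n)) × ℂ) (hL : L.length ≤ M) :
    Ev addMonoP (.cons (encMono m) (encodeList encMono L)) (encodeList encMono (addMono L m))
      (500 * (2 * n + 1) ^ 2 * (M + 1)) := by
  obtain ⟨k1, hk1, r1⟩ := foldP_ev (f := encMono) (e := encAdd) (g := addStep) (b := addStepP)
    (B := 300 * (2 * n + 1) ^ 2 + 100) (fun _ _ => True)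
    (fun m L st _ => ⟨trivial, addStepP_ev st m⟩) L (m, []) trivial
  refine Runs.ev (by repeat' first | exact r1 | constructor) rfl ?_
  have h1 := Nat.mul_le_mul_right (300 * (2 * n + 1) ^ 2 + 100 + 12) hL
  have h2 : 1 ≤ (2 * n + 1) ^ 2 := Nat.one_le_pow _ _ (by omega)
  nlinarith

/-- The coefficient of the new monomial of `rotateStep`, on `((X ∆ Y, (sign, |X ∩ Y|)),
((Y, z), (X, (cos φ, (sin φ, acc)))))`. -/
def rotCoeffP : Program :=
  .comp .mul (.pair (.comp .fst tail4) (.comp .mul (.pair (.comp get1 .fst)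
    (.comp .add (.pair
      (.comp .sub (.pair (.comp .snd (.comp lengthP get2))
        (.comp .snd (.comp lengthP (.comp .fst get1)))))
      (.comp .snd (.comp lengthP (.comp .fst .fst))))))))

/-- The square of `(|X ∩ Y| - 1) (|X ∩ Y| - 3)`, for the same input. As `|X ∩ Y| ≤ 4`, it is at most
`0` if and only if `|X ∩ Y|` is odd. -/
def oddTestP : Program :=
  .comp (.comp .mul (.pair .id .id)) (.comp .mul (.pair
    (.comp .sub (.pair (.comp tail2 .fst) .one))
    (.comp .sub (.pair (.comp tail2 .fst)
      (.comp .add (.pair .one (.comp .add (.pair .one .one))))))))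

/-- The program of `rotateStep`, on `((Y, z), (X, (cos φ, (sin φ, acc))))`. -/
def rotateStepP : Program :=
  .comp
    (.pair get2 (.pair get3 (.pair (.comp .fst tail4)
      (ifLe oddTestP .zero
        (.comp addMonoP (.pair
          (.pair (.comp .fst .fst)
            (.pair (.comp .mul (.pair rotCoeffP (.comp get1 get1)))
              (.comp .mul (.pair rotCoeffP (.comp tail2 get1)))))
          (.comp addMonoP (.pair
            (.pair (.comp .fst get1)
              (.pair (.comp .mul (.pair get3 (.comp get1 get1)))
                (.comp .mul (.pair get3 (.comp tail2 get1)))))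
            (.comp .snd tail4)))))
        (.comp addMonoP (.pair get1 (.comp .snd tail4)))))))
    (.pair (.comp toggleSetP (.pair get1 (.comp .fst .fst))) .id)

/-- The encoding of the state of `rotateStep`. -/
def encRot {n : ℕ} (X : Finset (Fin (2 * n))) (φ : ℝ) (acc : List (Finset (Fin (2 * n)) × ℂ)) :
    Value :=
  .cons (encodeSet X) (.cons (.num (Real.cos φ)) (.cons (.num (Real.sin φ))
    (encodeList encMono acc)))

lemma rotateStepP_ev {n M : ℕ} {X : Finset (Fin (2 * n))} (hX : X.card = 2 ∨ X.card = 4) (φ : ℝ)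
    (acc : List (Finset (Fin (2 * n)) × ℂ)) (m : Finset (Fin (2 * n)) × ℂ)
    (hacc : acc.length ≤ M) :
    Ev rotateStepP (.cons (encMono m) (encRot X φ acc)) (encRot X φ (rotateStep X φ acc m))
      (3000 * (2 * n + 1) ^ 2 * (M + 1)) := by
  obtain ⟨Y, z⟩ := m
  set V := 2 * n + 1 with hV
  have hV2 : V ≤ V ^ 2 := Nat.le_self_pow (by norm_num) V
  have hV1 : 1 ≤ V := by omega
  have hVM : V ^ 2 ≤ V ^ 2 * (M + 1) := Nat.le_mul_of_pos_right _ (by omega)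
  set t : Value := .cons (.cons (encodeSet (symmDiff X Y))
    (.cons (.num (mulSign X Y)) (.num ((X ∩ Y).card : ℝ))))
    (.cons (encMono (Y, z)) (encRot X φ acc)) with ht
  have hpre : Ev (.pair (.comp toggleSetP (.pair get1 (.comp .fst .fst))) .id)
      (.cons (encMono (Y, z)) (encRot X φ acc)) t (300 * V ^ 2 + 12) := by
    obtain ⟨k1, hk1, r1⟩ := toggleSetP_ev X Y
    rw [← hV] at hk1
    exact Runs.ev (by repeat' first | exact r1 | constructor) rfl (by omega)
  have hodd : Ev oddTestP t (.num ((((X ∩ Y).card : ℝ) - 1) * ((X ∩ Y).card - (1 + (1 + 1))) *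
      ((((X ∩ Y).card : ℝ) - 1) * ((X ∩ Y).card - (1 + (1 + 1)))))) 50 :=
    Runs.ev (by repeat' constructor) rfl (by norm_num)
  have hiff : (((X ∩ Y).card : ℝ) - 1) * ((X ∩ Y).card - (1 + (1 + 1))) *
      ((((X ∩ Y).card : ℝ) - 1) * ((X ∩ Y).card - (1 + (1 + 1)))) ≤ 0 ↔ Odd (X ∩ Y).card := by
    have hle : (X ∩ Y).card ≤ 4 :=
      (card_le_card inter_subset_left).trans (by rcases hX with h | h <;> omega)
    generalize (X ∩ Y).card = c at hle
    interval_cases c <;> norm_num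
  have hcoef : Ev rotCoeffP t (.num (Real.sin φ * rotSign X Y)) (300 * V + 60) := by
    obtain ⟨k1, hk1, r1⟩ := lengthP_ev X
    obtain ⟨k2, hk2, r2⟩ := lengthP_ev Y
    obtain ⟨k3, hk3, r3⟩ := lengthP_ev (symmDiff X Y)
    exact Runs.ev (by repeat' first | exact r1 | exact r2 | exact r3 | constructor) rfl (by omega)
  have hnew : Ev (ifLe oddTestP .zero
        (.comp addMonoP (.pair
          (.pair (.comp .fst .fst)
            (.pair (.comp .mul (.pair rotCoeffP (.comp get1 get1)))
              (.comp .mul (.pair rotCoeffP (.comp tail2 get1)))))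
          (.comp addMonoP (.pair
            (.pair (.comp .fst get1)
              (.pair (.comp .mul (.pair get3 (.comp get1 get1)))
                (.comp .mul (.pair get3 (.comp tail2 get1)))))
            (.comp .snd tail4)))))
        (.comp addMonoP (.pair get1 (.comp .snd tail4)))) t
      (encodeList encMono (rotateStep X φ acc (Y, z)))
      (500 * V ^ 2 * (M + 1 + 1) + 500 * V ^ 2 * (M + 1) + 600 * V + 400) := by
    refine (ifLe_ev hodd (y := 0) (j := 1) ⟨1, le_rfl, Runs.zero _⟩ (fun h => ?_)
      (fun h => ?_)).mono (b := 50 + 1 + (500 * V ^ 2 * (M + 1 + 1) + 500 * V ^ 2 * (M + 1)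
        + 600 * V + 300) + 4) (by omega)
    · have ho := hiff.1 h
      obtain ⟨k1, hk1, r1⟩ := hcoef
      obtain ⟨k2, hk2, r2⟩ := addMonoP_ev acc (Y, (Real.cos φ : ℂ) * z) hacc
      obtain ⟨k3, hk3, r3⟩ := addMonoP_ev (addMono acc (Y, (Real.cos φ : ℂ) * z))
        (symmDiff X Y, ((Real.sin φ * rotSign X Y : ℝ) : ℂ) * z)
        (M := M + 1) ((length_addMono_le _ _).trans (Nat.succ_le_succ hacc))
      rw [← hV] at hk2 hk3
      simp only [encMono, Complex.re_ofReal_mul, Complex.im_ofReal_mul] at r2 r3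
      refine Runs.ev (by repeat' first | exact r1 | exact r2 | exact r3 | constructor) ?_ ?_
      · rw [rotateStep, if_pos ho]
      · omega
    · have ho : ¬ Odd (X ∩ Y).card := fun h' => h (hiff.2 h')
      obtain ⟨k2, hk2, r2⟩ := addMonoP_ev acc (Y, z) hacc
      rw [← hV] at hk2
      refine Runs.ev (by repeat' first | exact r2 | constructor) ?_ ?_
      · rw [rotateStep, if_neg ho]
      · omega
  have hpost : Ev (.pair get2 (.pair get3 (.pair (.comp .fst tail4) (ifLe oddTestP .zero
        (.comp addMonoP (.pair
          (.pair (.comp .fst .fst)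
            (.pair (.comp .mul (.pair rotCoeffP (.comp get1 get1)))
              (.comp .mul (.pair rotCoeffP (.comp tail2 get1)))))
          (.comp addMonoP (.pair
            (.pair (.comp .fst get1)
              (.pair (.comp .mul (.pair get3 (.comp get1 get1)))
                (.comp .mul (.pair get3 (.comp tail2 get1)))))
            (.comp .snd tail4)))))
        (.comp addMonoP (.pair get1 (.comp .snd tail4))))))) t
      (encRot X φ (rotateStep X φ acc (Y, z)))
      (500 * V ^ 2 * (M + 1 + 1) + 500 * V ^ 2 * (M + 1) + 600 * V + 450) := by
    obtain ⟨k1, hk1, r1⟩ := hnew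
    exact Runs.ev (by repeat' first | exact r1 | constructor) rfl (by omega)
  refine (comp_ev hpre hpost).mono ?_
  have e : 500 * V ^ 2 * (M + 1 + 1) = 500 * (V ^ 2 * (M + 1)) + 500 * V ^ 2 := by ring
  have e2 : 500 * V ^ 2 * (M + 1) = 500 * (V ^ 2 * (M + 1)) := by ring
  have e3 : 3000 * V ^ 2 * (M + 1) = 3000 * (V ^ 2 * (M + 1)) := by ring
  omega

/-- Rotation of a polynomial: the program of `rotate`, on `(X, (φ, L))`. -/
def rotateP : Program :=
  .comp tail4 (.comp (foldP rotateStepP)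
    (.pair tail2 (.pair .fst (.pair (.comp .cos get1) (.pair (.comp .sin get1) .nil)))))

lemma rotateP_ev {n M : ℕ} {X : Finset (Fin (2 * n))} (hX : X.card = 2 ∨ X.card = 4) (φ : ℝ)
    (L : List (Finset (Fin (2 * n)) × ℂ)) (hL : L.length ≤ M) :
    Ev rotateP (.cons (encodeSet X) (.cons (.num φ) (encodeList encMono L)))
      (encodeList encMono (rotate X φ L)) (7000 * (2 * n + 1) ^ 2 * (M + 1) ^ 2) := by
  obtain ⟨k1, hk1, r1⟩ := foldP_ev (f := encMono) (e := encRot X φ) (g := rotateStep X φ)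
    (b := rotateStepP) (B := 3000 * (2 * n + 1) ^ 2 * (2 * M + 1))
    (fun rem acc => acc.length + 2 * rem.length ≤ 2 * M)
    (fun m rem acc h => by
      rw [List.length_cons] at h
      have := length_rotateStep_le X φ acc m
      exact ⟨by omega, rotateStepP_ev hX φ acc m (by omega)⟩)
    L [] (by simpa using hL)
  refine Runs.ev (by repeat' first | exact r1 | constructor) rfl ?_
  have h1 := Nat.mul_le_mul_right (3000 * (2 * n + 1) ^ 2 * (2 * M + 1) + 12) hL
  have h2 : 1 ≤ (2 * n + 1) ^ 2 := Nat.one_le_pow _ _ (by omega)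
  generalize (2 * n + 1) ^ 2 = v at *
  have h3 : M ≤ v * M := Nat.le_mul_of_pos_left _ h2
  nlinarith

/-! ### Programs for the steps of Majorana Propagation -/

/-- The rotations of a Trotter step, applied one after the other to a polynomial. -/
def rotateAll {n : ℕ} (s : ℝ) (R L : List (Finset (Fin (2 * n)) × ℂ)) :
    List (Finset (Fin (2 * n)) × ℂ) :=
  R.foldl (fun L r => rotate r.1 (s * r.2.re + s * r.2.re) L) L

lemma denote_rotateAll {n : ℕ} (s : ℝ) (R L : List (Finset (Fin (2 * n)) × ℂ))
    (hR : ∀ r ∈ R, (r.1.card = 2 ∨ r.1.card = 4) ∧ (r.2.re : ℂ) = r.2) :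
    denote (rotateAll s R L) = evolveTerms R s (denote L) := by
  induction R generalizing L with
  | nil => rfl
  | cons r R ih =>
    obtain ⟨h1, h2⟩ := hR r List.mem_cons_self
    have := ih (rotate r.1 (s * r.2.re + s * r.2.re) L)
      (fun r' hr' => hR r' (List.mem_cons_of_mem _ hr'))
    rw [denote_rotate h1, h2] at this
    exact this

/-- The keys are distinct and cannot reach a degree above `D` in the rotations to come. -/
def SpreadBound {n : ℕ} (D : ℕ) (R L : List (Finset (Fin (2 * n)) × ℂ)) : Prop :=
  (L.map Prod.fst).Nodup ∧ ∀ Y ∈ L.map Prod.fst, spread (R.map Prod.fst) Y ≤ D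

lemma SpreadBound.length_le {n D : ℕ} {R L : List (Finset (Fin (2 * n)) × ℂ)}
    (h : SpreadBound D R L) : L.length ≤ (2 * n + 1) ^ D :=
  length_le_of_card_le h.1 fun X hX => (card_le_spread _ X).trans (h.2 X hX)

lemma SpreadBound.rotate {n D : ℕ} {r : Finset (Fin (2 * n)) × ℂ}
    {R L : List (Finset (Fin (2 * n)) × ℂ)} (h : SpreadBound D (r :: R) L) (φ : ℝ) :
    SpreadBound D R (rotate r.1 φ L) :=
  ⟨nodup_rotate _ _ _, spread_rotate_le h.2⟩

lemma SpreadBound.rotateAll {n D : ℕ} {R L : List (Finset (Fin (2 * n)) × ℂ)}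
    (h : SpreadBound D R L) (s : ℝ) : SpreadBound D [] (rotateAll s R L) := by
  induction R generalizing L with
  | nil => exact h
  | cons r R ih => exact ih (h.rotate _)

/-- One rotation, on `((X, h_X), (s, L))`. -/
def rotateAllStepP : Program :=
  .pair get1 (.comp rotateP (.pair (.comp .fst .fst) (.pair
    (.comp .add (.pair (.comp .mul (.pair get1 (.comp get1 .fst)))
      (.comp .mul (.pair get1 (.comp get1 .fst))))) tail2)))

/-- The program of `truncStep`, on `(m, (ℓ, acc))`. -/
def truncStepP : Program :=
  ifLe (.comp .fst (.comp lengthP (.comp .fst .fst))) get1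
    (ifLe (.comp .add (.pair (.comp .mul (.pair (.comp get1 .fst) (.comp get1 .fst)))
        (.comp .mul (.pair (.comp tail2 .fst) (.comp tail2 .fst))))) .zero
      .snd (.pair get1 (.pair .fst tail2)))
    .snd

lemma truncStepP_ev {n : ℕ} (ℓ : ℕ) (acc : List (Finset (Fin (2 * n)) × ℂ))
    (m : Finset (Fin (2 * n)) × ℂ) :
    Ev truncStepP (.cons (encMono m) (.cons (.num (ℓ : ℝ)) (encodeList encMono acc)))
      (.cons (.num (ℓ : ℝ)) (encodeList encMono (truncStep ℓ acc m)))
      (100 * (2 * n + 1) + 100) := by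
  obtain ⟨k1, hk1, r1⟩ := lengthP_ev m.1
  have hz : m.2.re * m.2.re + m.2.im * m.2.im ≤ 0 ↔ m.2 = 0 := by
    rw [← Complex.normSq_apply, ← Complex.normSq_eq_zero]
    exact ⟨fun h => le_antisymm h (Complex.normSq_nonneg _), fun h => h.le⟩
  refine (ifLe_ev (x := (m.1.card : ℝ)) (y := (ℓ : ℝ)) (i := 100 * (2 * n + 1) + 10) (j := 3)
    (B := 60)
    (Runs.ev (by repeat' first | exact r1 | constructor) rfl (by omega))
    (Runs.ev (by repeat' constructor) rfl (by norm_num))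
    (fun h1 => (ifLe_ev (x := m.2.re * m.2.re + m.2.im * m.2.im) (y := 0) (i := 30) (j := 1)
      (B := 20) (Runs.ev (by repeat' constructor) rfl (by norm_num)) ⟨1, le_rfl, Runs.zero _⟩
      (fun h2 => ?_) (fun h2 => ?_)).mono (by norm_num)) (fun h1 => ?_)).mono (by omega)
  · rw [truncStep, if_neg (fun h => h.2 (hz.1 h2))]
    exact Runs.ev (by repeat' constructor) rfl (by norm_num)
  · rw [truncStep, if_pos ⟨by exact_mod_cast h1, fun h => h2 (hz.2 h)⟩]
    exact Runs.ev (by repeat' constructor) rfl (by norm_num)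
  · rw [truncStep, if_neg (fun h => h1 (by exact_mod_cast h.1))]
    exact Runs.ev (by repeat' constructor) rfl (by norm_num)

/-- One Trotter step followed by a truncation, on `(s, (ℓ, (R, L)))`. -/
def stepP : Program :=
  .comp tail2 (.comp (foldP truncStepP)
    (.pair (.comp tail2 (.comp (foldP rotateAllStepP) (.pair get2 (.pair .fst tail3))))
      (.pair get1 .nil)))

/-- The number of steps that `stepP` may take. -/
def stepCost (n T D : ℕ) : ℕ := 8000 * (T + 1) * (2 * n + 1) ^ 2 * ((2 * n + 1) ^ D + 1) ^ 2

lemma stepP_ev {n D : ℕ} (ℓ : ℕ) (s : ℝ) (R L : List (Finset (Fin (2 * n)) × ℂ))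
    (hR : ∀ r ∈ R, r.1.card = 2 ∨ r.1.card = 4) (h : SpreadBound D R L) :
    Ev stepP (.cons (.num s) (.cons (.num (ℓ : ℝ)) (.cons (encodeList encMono R)
      (encodeList encMono L)))) (encodeList encMono (truncList ℓ (rotateAll s R L)))
      (stepCost n R.length D) := by
  set M := (2 * n + 1) ^ D with hM
  set V := 2 * n + 1 with hV
  obtain ⟨k1, hk1, r1⟩ := foldP_ev (f := encMono)
    (e := fun L : List (Finset (Fin (2 * n)) × ℂ) => .cons (.num s) (encodeList encMono L))
    (g := fun L r => rotate r.1 (s * r.2.re + s * r.2.re) L)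
    (b := rotateAllStepP) (B := 7000 * V ^ 2 * (M + 1) ^ 2 + 50)
    (fun R' L' => SpreadBound D R' L' ∧ ∀ r ∈ R', r.1.card = 2 ∨ r.1.card = 4)
    (fun r R' L' h => by
      refine ⟨⟨h.1.rotate _, fun r' hr' => h.2 r' (List.mem_cons_of_mem _ hr')⟩, ?_⟩
      obtain ⟨k, hk, hr⟩ := rotateP_ev (h.2 r List.mem_cons_self) (s * r.2.re + s * r.2.re) L'
        h.1.length_le
      rw [← hV, ← hM] at hk
      exact Runs.ev (by repeat' first | exact hr | constructor) rfl (by omega)) R L ⟨h, hR⟩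
  obtain ⟨k2, hk2, r2⟩ := foldP_ev (f := encMono)
    (e := fun L : List (Finset (Fin (2 * n)) × ℂ) => .cons (.num (ℓ : ℝ)) (encodeList encMono L))
    (g := truncStep ℓ) (b := truncStepP) (B := 100 * V + 100) (fun _ _ => True)
    (fun m _ acc _ => ⟨trivial, truncStepP_ev ℓ acc m⟩) (rotateAll s R L) [] trivial
  have hlen := (h.rotateAll s).length_le
  rw [← hM] at hlen
  refine Runs.ev (by repeat' first | exact r1 | exact r2 | constructor) rfl ?_
  have h2 := Nat.mul_le_mul_right (100 * V + 100 + 12) hlen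
  have hV1 : 1 ≤ V := by omega
  have hM1 : 1 ≤ M := Nat.one_le_pow _ _ hV1
  have h3 : k1 + k2 ≤ R.length * (7000 * V ^ 2 * (M + 1) ^ 2 + 50 + 12) +
      M * (100 * V + 100 + 12) + 4 := by omega
  have h4 : V * M ≤ V ^ 2 * (M + 1) ^ 2 := Nat.mul_le_mul (by nlinarith) (by nlinarith)
  have h5 : M ≤ V ^ 2 * (M + 1) ^ 2 := by nlinarith
  have h6 : 1 ≤ V ^ 2 * (M + 1) ^ 2 := by nlinarith
  have h7 : R.length ≤ R.length * (V ^ 2 * (M + 1) ^ 2) := Nat.le_mul_of_pos_right _ h6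
  have e : stepCost n R.length D = 8000 * (R.length * (V ^ 2 * (M + 1) ^ 2)) +
      8000 * (V ^ 2 * (M + 1) ^ 2) := by rw [stepCost]; ring
  have e2 : R.length * (7000 * V ^ 2 * (M + 1) ^ 2 + 50 + 12) + M * (100 * V + 100 + 12) + 4 =
      7000 * (R.length * (V ^ 2 * (M + 1) ^ 2)) + 62 * R.length + 100 * (V * M) + 112 * M + 4 := by
    ring
  rw [e]
  rw [e2] at h3
  omega

/-! ### The program for the greedy colouring -/

/-- The program of `selectStep`, on `(m, (U, (rejected, selected)))`. -/
def selectStepP : Program :=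
  .comp
    (ifLe (.comp tail2 .fst) .zero
      (.pair (.comp .fst .fst) (.pair get3 (.pair get1 tail4)))
      (.pair get2 (.pair (.pair get1 get3) tail4)))
    (.pair (.comp toggleSetP (.pair (.comp .fst .fst) get1)) .id)

/-- The encoding of the state of `selectStep`. -/
def encSelect {n : ℕ} (st : Finset (Fin (2 * n)) × List (Finset (Fin (2 * n)) × ℂ) ×
    List (Finset (Fin (2 * n)) × ℂ)) : Value :=
  .cons (encodeSet st.1) (.cons (encodeList encMono st.2.1) (encodeList encMono st.2.2))

lemma selectStepP_ev {n : ℕ} (st : Finset (Fin (2 * n)) × List (Finset (Fin (2 * n)) × ℂ) ×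
    List (Finset (Fin (2 * n)) × ℂ)) (m : Finset (Fin (2 * n)) × ℂ) :
    Ev selectStepP (.cons (encMono m) (encSelect st)) (encSelect (selectStep st m))
      (300 * (2 * n + 1) ^ 2 + 70) := by
  obtain ⟨U, rest, out⟩ := st
  obtain ⟨k1, hk1, r1⟩ := toggleSetP_ev m.1 U
  refine (comp_ev (i := 300 * (2 * n + 1) ^ 2 + 12) (j := 50)
    (a := .cons (.cons (encodeSet (symmDiff m.1 U))
      (.cons (.num (mulSign m.1 U)) (.num ((m.1 ∩ U).card : ℝ))))
      (.cons (encMono m) (encSelect (U, rest, out))))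
    (Runs.ev (by repeat' first | exact r1 | constructor) rfl (by omega)) ?_).mono (by omega)
  refine (ifLe_ev (x := ((m.1 ∩ U).card : ℝ)) (y := 0) (i := 5) (j := 1) (B := 40)
    (Runs.ev (by repeat' constructor) rfl (by norm_num)) ⟨1, le_rfl, Runs.zero _⟩
    (fun h => ?_) (fun h => ?_)).mono (by norm_num)
  · have h' : (m.1 ∩ U).card = 0 := by
      have : (m.1 ∩ U).card ≤ 0 := by exact_mod_cast h
      omega
    rw [selectStep, if_pos h']
    exact Runs.ev (by repeat' constructor) rfl (by norm_num)
  · have h' : ¬ (m.1 ∩ U).card = 0 := fun h' => h (by rw [h']; simp)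
    rw [selectStep, if_neg h']
    exact Runs.ev (by repeat' constructor) rfl (by norm_num)

/-- The program of `selectRound`, on `(remaining, selected)`. -/
def selectRoundP : Program :=
  .comp tail2 (.comp (foldP selectStepP) (.pair .fst (.pair .nil (.pair .nil .snd))))

lemma selectRoundP_ev {n T : ℕ} (rem out : List (Finset (Fin (2 * n)) × ℂ))
    (hT : rem.length ≤ T) :
    Ev selectRoundP (.cons (encodeList encMono rem) (encodeList encMono out))
      (.cons (encodeList encMono (selectRound (rem, out)).1)
        (encodeList encMono (selectRound (rem, out)).2)) (400 * (2 * n + 1) ^ 2 * (T + 1)) := by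
  obtain ⟨k1, hk1, r1⟩ := foldP_ev (f := encMono) (e := encSelect) (g := selectStep)
    (b := selectStepP) (B := 300 * (2 * n + 1) ^ 2 + 70) (fun _ _ => True)
    (fun m _ st _ => ⟨trivial, selectStepP_ev st m⟩) rem (∅, [], out) trivial
  have e : encodeSet (∅ : Finset (Fin (2 * n))) = .nil := by simp [encodeSet, encodeList]
  simp only [encSelect, e] at r1
  refine Runs.ev (by repeat' first | exact r1 | constructor) rfl ?_
  have h1 := Nat.mul_le_mul_right (300 * (2 * n + 1) ^ 2 + 70 + 12) hT
  have h2 : 1 ≤ (2 * n + 1) ^ 2 := Nat.one_le_pow _ _ (by omega)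
  nlinarith

/-- The program of `schedule`. -/
def scheduleP : Program :=
  .comp revOntoP (.pair
    (.comp tail2 (.comp (foldP (.comp selectRoundP .snd)) (.pair .id (.pair .id .nil)))) .nil)

lemma length_selectRound {n : ℕ} (rem out : List (Finset (Fin (2 * n)) × ℂ)) :
    (selectRound (rem, out)).1.length + (selectRound (rem, out)).2.length =
      rem.length + out.length := by
  obtain ⟨sel, rest', h1, h2, -⟩ := selectRound_spec rem out
  have := h2.length_eq
  rw [List.length_append] at this
  rw [h1]
  dsimp only
  rw [List.length_append, List.length_reverse]
  omega

lemma scheduleP_ev {n : ℕ} (LH : List (Finset (Fin (2 * n)) × ℂ)) :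
    Ev scheduleP (encodeList encMono LH) (encodeList encMono (schedule LH))
      (500 * (2 * n + 1) ^ 2 * (LH.length + 1) ^ 2) := by
  set T := LH.length with hT
  obtain ⟨k1, hk1, r1⟩ := foldP_ev (f := encMono)
    (e := fun st : List (Finset (Fin (2 * n)) × ℂ) × List (Finset (Fin (2 * n)) × ℂ) =>
      .cons (encodeList encMono st.1) (encodeList encMono st.2))
    (g := fun st _ => selectRound st) (b := .comp selectRoundP .snd)
    (B := 400 * (2 * n + 1) ^ 2 * (T + 1) + 2) (fun _ st => st.1.length + st.2.length = T)
    (fun m _ st h => by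
      refine ⟨(length_selectRound st.1 st.2).trans h, ?_⟩
      obtain ⟨k, hk, hr⟩ := selectRoundP_ev (T := T) st.1 st.2 (by omega)
      exact Runs.ev (by repeat' first | exact hr | constructor) rfl (by omega)) LH (LH, [])
    (by simp [hT])
  have hfold : ∀ (l : List (Finset (Fin (2 * n)) × ℂ))
      (st : List (Finset (Fin (2 * n)) × ℂ) × List (Finset (Fin (2 * n)) × ℂ)),
      l.foldl (fun st _ => selectRound st) st = selectRound^[l.length] st := by
    intro l
    induction l with
    | nil => intro st; rfl
    | cons m l ih => intro st; rw [List.foldl_cons, ih, List.length_cons,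
        Function.iterate_succ_apply]
  have hinv : ∀ k,
      (selectRound^[k] (LH, [])).1.length + (selectRound^[k] (LH, [])).2.length = T := by
    intro k
    induction k with
    | zero => simp [hT]
    | succ k ih => rw [Function.iterate_succ_apply']; exact (length_selectRound _ _).trans ih
  rw [hfold] at r1
  obtain ⟨k2, hk2, r2⟩ := revOntoP_ev encMono (selectRound^[LH.length] (LH, [])).2 []
  have h3 := hinv LH.length
  rw [List.append_nil] at r2
  refine Runs.ev (by repeat' first | exact r1 | exact r2 | constructor) rfl ?_
  have h2 : 1 ≤ (2 * n + 1) ^ 2 := Nat.one_le_pow _ _ (by omega)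
  rw [← hT] at hk1
  have hk2' : k2 ≤ T * 13 + 4 := by omega
  generalize (2 * n + 1) ^ 2 = v at *
  have h4 : T ≤ v * T := Nat.le_mul_of_pos_left _ h2
  nlinarith

/-! ### Majorana Propagation as a program -/

/-- The time steps: as long as `δt ≤ t`, replace `(t, (δt, (ℓ, (R, L))))` by the state with
remaining time `t - δt`. -/
def timeLoopP : Program :=
  .loop (.comp .le (.pair get1 .fst))
    (.pair (.comp .sub (.pair .fst get1))
      (.pair get1 (.pair get2 (.pair get3 (.comp stepP (.pair get1 tail2))))))

/-- The program of Majorana Propagation. -/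
def propagationP : Program :=
  .comp (.comp stepP (.pair .fst tail2)) (.comp timeLoopP
    (.pair get3 (.pair (.comp .fst tail4) (.pair (.comp .snd tail4)
      (.pair (.comp scheduleP get1) get2)))))

/-- A polynomial with distinct keys of size at most `ℓ`. -/
def IsPolyOfDegree {n : ℕ} (ℓ : ℕ) (L : List (Finset (Fin (2 * n)) × ℂ)) : Prop :=
  (L.map Prod.fst).Nodup ∧ ∀ Y ∈ L.map Prod.fst, Y.card ≤ ℓ

lemma isPolyOfDegree_truncList {n ℓ : ℕ} {L : List (Finset (Fin (2 * n)) × ℂ)}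
    (h : (L.map Prod.fst).Nodup) : IsPolyOfDegree ℓ (truncList ℓ L) := by
  refine ⟨nodup_truncList h, fun Y hY => ?_⟩
  obtain ⟨m, hm, rfl⟩ := List.mem_map.1 hY
  exact (mem_truncList hm).1

lemma nodup_rotateAll {n : ℕ} (s : ℝ) (R : List (Finset (Fin (2 * n)) × ℂ))
    {L : List (Finset (Fin (2 * n)) × ℂ)} (h : (L.map Prod.fst).Nodup) :
    ((rotateAll s R L).map Prod.fst).Nodup := by
  induction R generalizing L with
  | nil => exact h
  | cons r R ih => exact ih (nodup_rotate _ _ _)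

/-- The encoding of the state of the time loop. -/
def encState {n : ℕ} (t δt : ℝ) (ℓ : ℕ) (R L : List (Finset (Fin (2 * n)) × ℂ)) : Value :=
  .cons (.num t) (.cons (.num δt) (.cons (.num (ℓ : ℝ)) (.cons (encodeList encMono R)
    (encodeList encMono L))))

lemma timeLoopP_ev {n D ℓ : ℕ} {R : List (Finset (Fin (2 * n)) × ℂ)} (δt : ℝ)
    (hR : ∀ r ∈ R, r.1.card = 2 ∨ r.1.card = 4)
    (hD : ∀ Y, Y.card ≤ ℓ → spread (R.map Prod.fst) Y ≤ D) (k : ℕ) (t : ℝ)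
    (L : List (Finset (Fin (2 * n)) × ℂ)) (hL : IsPolyOfDegree ℓ L) (h1 : k * δt ≤ t)
    (h2 : t < (k + 1) * δt) (hδ : 0 < δt) :
    Ev timeLoopP (encState t δt ℓ R L)
      (encState (t - k * δt) δt ℓ R ((fun L => truncList ℓ (rotateAll δt R L))^[k] L))
      (k * (stepCost n R.length D + 50) + 10) := by
  induction k generalizing t L with
  | zero =>
    have h : ¬ δt ≤ t := by push_cast at h2; linarith
    refine Runs.ev (Runs.loop_done (Runs.comp (Runs.pair (by repeat' constructor) (Runs.fst _ _))
      (Runs.le_false δt t h))) (by simp) (by norm_num)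
  | succ k ih =>
    push_cast at h1 h2
    have h : δt ≤ t := by nlinarith
    obtain ⟨k1, hk1, r1⟩ := stepP_ev ℓ δt R L hR ⟨hL.1, fun Y hY => hD Y (hL.2 Y hY)⟩
    obtain ⟨k2, hk2, r2⟩ := ih (t - δt) (truncList ℓ (rotateAll δt R L))
      (isPolyOfDegree_truncList (nodup_rotateAll _ _ hL.1)) (by linarith) (by linarith)
    refine Runs.ev (Runs.loop_step (Runs.comp (Runs.pair (by repeat' constructor) (Runs.fst _ _))
      (Runs.le_true δt t h)) (by simp)
      (by repeat' first | exact r1 | constructor) r2) ?_ ?_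
    · have e : t - δt - k * δt = t - (k + 1 : ℕ) * δt := by push_cast; ring
      rw [Function.iterate_succ_apply, ← e]
    · rw [add_mul (k : ℕ) 1]; omega

lemma propagationP_ev {n D ℓ K : ℕ} {LH : List (Finset (Fin (2 * n)) × ℂ)} (t δt : ℝ)
    (hR : ∀ r ∈ schedule LH, r.1.card = 2 ∨ r.1.card = 4)
    (hlen : (schedule LH).length = LH.length)
    (hD : ∀ Y, Y.card ≤ ℓ → spread ((schedule LH).map Prod.fst) Y ≤ D)
    (L : List (Finset (Fin (2 * n)) × ℂ)) (hL : IsPolyOfDegree ℓ L) (h1 : K * δt ≤ t)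
    (h2 : t < (K + 1) * δt) (hδ : 0 < δt) :
    Ev propagationP (encodeInput LH L t δt ℓ)
      (encodePoly (truncList ℓ (rotateAll (t - K * δt) (schedule LH)
        ((fun L => truncList ℓ (rotateAll δt (schedule LH) L))^[K] L))))
      ((K + 1) * (500 * (2 * n + 1) ^ 2 * (LH.length + 1) ^ 2 +
        stepCost n LH.length D + 100)) := by
  set F := fun L => truncList ℓ (rotateAll δt (schedule LH) L) with hF
  obtain ⟨k1, hk1, r1⟩ := scheduleP_ev LH
  obtain ⟨k2, hk2, r2⟩ := timeLoopP_ev δt hR hD K t L hL h1 h2 hδ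
  have hP : IsPolyOfDegree ℓ (F^[K] L) := by
    clear r2 hk2 h1 h2
    induction K with
    | zero => exact hL
    | succ K ih =>
      rw [Function.iterate_succ_apply']
      exact isPolyOfDegree_truncList (nodup_rotateAll _ _ ih.1)
  obtain ⟨k3, hk3, r3⟩ := stepP_ev ℓ (t - K * δt) (schedule LH) (F^[K] L) hR
    ⟨hP.1, fun Y hY => hD Y (hP.2 Y hY)⟩
  rw [hlen] at hk2 hk3
  refine Runs.ev (by repeat' first | exact r1 | exact r2 | exact r3 | constructor) rfl ?_
  generalize stepCost n LH.length D = S at *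
  generalize 500 * (2 * n + 1) ^ 2 * (LH.length + 1) ^ 2 = P at *
  have e : (K + 1) * (P + S + 100) = K * (S + 50) + K * P + K * 50 + P + S + 100 := by ring
  rw [e]
  omega

/-- The step count is polynomial in the number of modes, with an exponent linear in `ℓ`. -/
lemma cost_le {n Δ ℓ T : ℕ} (hn : 0 < n) (hT : T ≤ Δ * (2 * n)) :
    500 * (2 * n + 1) ^ 2 * (T + 1) ^ 2 + stepCost n T (3 ^ (4 * Δ) * ℓ) + 100 ≤
      (2 * n) ^ ((24 + 2 * Δ + 4 * 3 ^ (4 * Δ)) * max ℓ 1) := by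
  set N := 2 * n with hN
  set D := 3 ^ (4 * Δ) * ℓ with hD
  set m := max ℓ 1 with hm
  have hN2 : 2 ≤ N := by omega
  have hV : N + 1 ≤ N ^ 2 := by nlinarith
  have hT1 : T + 1 ≤ 2 ^ Δ * (N + 1) := by
    have h1 : Δ + 1 ≤ 2 ^ Δ := Nat.lt_two_pow_self
    calc T + 1 ≤ (Δ + 1) * (N + 1) := by nlinarith
      _ ≤ _ := Nat.mul_le_mul_right _ h1
  have hM : (N + 1) ^ D + 1 ≤ 2 * (N + 1) ^ D := by
    have := Nat.one_le_pow D (N + 1) (by omega); omega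
  have h1 : 500 * (N + 1) ^ 2 * (T + 1) ^ 2 + stepCost n T D + 100 ≤
      9000 * ((T + 1) ^ 2 * (N + 1) ^ 2 * ((N + 1) ^ D + 1) ^ 2) := by
    rw [stepCost, ← hN]
    set a := (T + 1) with ha
    set b := (N + 1) ^ 2 with hb
    set c := ((N + 1) ^ D + 1) ^ 2 with hc
    have ha1 : 1 ≤ a := by omega
    have hb1 : 1 ≤ b := Nat.one_le_pow _ _ (by omega)
    have hc1 : 1 ≤ c := Nat.one_le_pow _ _ (by omega)
    have e1 : b * a ^ 2 ≤ a ^ 2 * b * c := by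
      rw [mul_comm b]; exact Nat.le_mul_of_pos_right _ hc1
    have e2 : a * b * c ≤ a ^ 2 * b * c := by
      rw [pow_two]
      exact Nat.mul_le_mul_right _ (Nat.mul_le_mul_right _ (Nat.le_mul_of_pos_right _ ha1))
    have e3 : 1 ≤ a ^ 2 * b * c := Nat.mul_pos (Nat.mul_pos (by positivity) hb1) hc1
    have e4 : 500 * b * a ^ 2 = 500 * (b * a ^ 2) := by ring
    have e5 : 8000 * a * b * c = 8000 * (a * b * c) := by ring
    rw [e4, e5]
    omega
  have hDm : D ≤ 3 ^ (4 * Δ) * m := Nat.mul_le_mul_left _ (le_max_left _ _)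
  have hm1 : 1 ≤ m := le_max_right _ _
  calc _ ≤ _ := h1
    _ ≤ 9000 * ((2 ^ Δ * (N + 1)) ^ 2 * (N + 1) ^ 2 * (2 * (N + 1) ^ D) ^ 2) := by gcongr
    _ = 36000 * 2 ^ (2 * Δ) * (N + 1) ^ (4 + 2 * D) := by
      rw [mul_pow, mul_pow, ← pow_mul, ← pow_mul, mul_comm Δ, mul_comm D, pow_add]; ring
    _ ≤ 2 ^ 16 * 2 ^ (2 * Δ) * (N ^ 2) ^ (4 + 2 * D) := by gcongr; norm_num
    _ ≤ N ^ 16 * N ^ (2 * Δ) * (N ^ 2) ^ (4 + 2 * D) := by gcongr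
    _ = N ^ (24 + 2 * Δ + 4 * D) := by rw [← pow_mul, ← pow_add, ← pow_add]; congr 1; ring
    _ ≤ N ^ ((24 + 2 * Δ + 4 * 3 ^ (4 * Δ)) * m) := by
      refine Nat.pow_le_pow_right (by omega) ?_
      calc 24 + 2 * Δ + 4 * D ≤ (24 + 2 * Δ) * m + 4 * (3 ^ (4 * Δ) * m) :=
            Nat.add_le_add (Nat.le_mul_of_pos_right _ hm1) (Nat.mul_le_mul_left _ hDm)
        _ = _ := by ring

/-- Majorana Propagation has a program with a polynomial running time. With the greedy colouring of
at most `4 Δ` groups, the intermediate degrees stay below `3 ^ (4 Δ) ℓ`, so that the lists of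
monomials have polynomial length. -/
theorem exists_program : ∃ p : Program, ∀ Δ : ℕ, ∃ C : ℕ,
    ∀ (n : ℕ) (h : Finset (Fin (2 * n)) → ℂ) (LH : List (Finset (Fin (2 * n)) × ℂ)),
      0 < n → IsQuartic h → IsSparse Δ h → IsMonomialList LH h →
      ∃ (G : ℕ) (c : Finset (Fin (2 * n)) → ℕ), G ≤ 4 * Δ ∧ IsColouring h G c ∧
        ∀ (A : FockOp n) (LA : List (Finset (Fin (2 * n)) × ℂ)) (t δt : ℝ) (ℓ : ℕ),
          IsMonomialList LA (coeff A) → 0 ≤ t → 0 < δt → degree A ≤ ℓ →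
          ∃ (L : List (Finset (Fin (2 * n)) × ℂ)) (k : ℕ),
            IsMonomialList L (coeff (majoranaPropagation h G c A t δt ℓ)) ∧
            Runs p (encodeInput LH LA t δt ℓ) (encodePoly L) k ∧
            (k : ℝ) ≤ (t / δt + 1) * ((2 * n : ℕ) : ℝ) ^ (C * max ℓ 1) := by
  refine ⟨propagationP, fun Δ => ⟨24 + 2 * Δ + 4 * 3 ^ (4 * Δ),
    fun n h LH hn hq hs hLH => ?_⟩⟩
  obtain ⟨G, c, hG, hc, htr⟩ := exists_colouring hLH hq hs
  obtain ⟨gs, g1, g2, g3, g4⟩ := exists_groups hLH hq hs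
  refine ⟨G, c, hG, hc, fun A LA t δt ℓ hLA ht hδ hA => ?_⟩
  have hperm : (schedule LH).Perm LH := g1 ▸ g2
  have hR : ∀ r ∈ schedule LH, (r.1.card = 2 ∨ r.1.card = 4) ∧ (r.2.re : ℂ) = r.2 := by
    intro r hr
    have hr' := hperm.subset hr
    refine ⟨hq.card_eq _ (hLH.mem_terms hr'), ?_⟩
    rw [((hLH.2 r.1 r.2).1 hr').1, ← Complex.conj_eq_iff_re]
    exact hq.conj_eq _
  have hspread : ∀ Y : Finset (Fin (2 * n)), Y.card ≤ ℓ →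
      spread ((schedule LH).map Prod.fst) Y ≤ 3 ^ (4 * Δ) * ℓ := by
    intro Y hY
    have h1 := spread_flatten_le (gs.map (List.map Prod.fst))
      (fun g hg => by
        obtain ⟨g', hg', rfl⟩ := List.mem_map.1 hg
        exact g3 g' hg')
      (fun g hg X hX => by
        obtain ⟨g', hg', rfl⟩ := List.mem_map.1 hg
        obtain ⟨m, hm, rfl⟩ := List.mem_map.1 hX
        have := (hR m (g1 ▸ List.mem_flatten.2 ⟨g', hg', hm⟩)).1
        omega) Y
    rw [← List.map_flatten, ← g1, List.length_map] at h1
    exact h1.trans (Nat.mul_le_mul (Nat.pow_le_pow_right (by norm_num) g4) hY)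
  have hpoly : IsPolyOfDegree ℓ LA := by
    refine ⟨hLA.nodup_keys, fun Y hY => ?_⟩
    obtain ⟨m, hm, rfl⟩ := List.mem_map.1 hY
    have := (hLA.2 m.1 m.2).1 hm
    exact degree_le_iff.1 hA _ (this.1 ▸ this.2)
  set K := ⌊t / δt⌋₊ with hK
  have hKle : (K : ℝ) ≤ t / δt := Nat.floor_le (by positivity)
  have h1 : K * δt ≤ t := (le_div_iff₀ hδ).1 hKle
  have h2 : t < (K + 1) * δt := (div_lt_iff₀ hδ).1 (Nat.lt_floor_add_one _)
  obtain ⟨k, hk, hrun⟩ := propagationP_ev t δt (fun r hr => (hR r hr).1) hperm.length_eq hspread LA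
    hpoly h1 h2 hδ
  set F := fun L => truncList ℓ (rotateAll δt (schedule LH) L) with hF
  have hstep : ∀ s L, denote (truncList ℓ (rotateAll s (schedule LH) L)) =
      trunc ℓ (trotter h G c s (denote L)) := fun s L => by
    rw [denote_truncList, denote_rotateAll s _ _ hR, htr]
  have hiter : ∀ k, (((F^[k] LA).map Prod.fst).Nodup) ∧
      denote (F^[k] LA) = (fun B => trunc ℓ (trotter h G c δt B))^[k] A := by
    intro k
    induction k with
    | zero => exact ⟨hLA.nodup_keys, hLA.denote_eq⟩
    | succ k ih =>
      rw [Function.iterate_succ_apply', Function.iterate_succ_apply', ← ih.2]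
      exact ⟨nodup_truncList (nodup_rotateAll _ _ ih.1), hstep _ _⟩
  refine ⟨truncList ℓ (rotateAll (t - K * δt) (schedule LH) (F^[K] LA)), k, ?_, hrun, ?_⟩
  · have hMP : majoranaPropagation h G c A t δt ℓ =
        denote (truncList ℓ (rotateAll (t - K * δt) (schedule LH) (F^[K] LA))) := by
      rw [hstep, (hiter K).2]; rfl
    rw [hMP]
    exact isMonomialList_denote (nodup_truncList (nodup_rotateAll _ _ (hiter K).1))
      (fun m hm => (mem_truncList hm).2)
  · have hcost := cost_le (ℓ := ℓ) hn (hLH.length_le hq hs)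
    have h3 := hk.trans (Nat.mul_le_mul_left (K + 1) hcost)
    calc (k : ℝ) ≤ (((K + 1) * (2 * n) ^ ((24 + 2 * Δ + 4 * 3 ^ (4 * Δ)) * max ℓ 1) : ℕ) : ℝ) :=
          by exact_mod_cast h3
      _ = ((K : ℝ) + 1) * ((2 * n : ℕ) : ℝ) ^ ((24 + 2 * Δ + 4 * 3 ^ (4 * Δ)) * max ℓ 1) := by
          push_cast; ring
      _ ≤ _ := by gcongr

end MajoranaProp

end

open MajoranaProp in
theorem theorem3p5 :
    -- (i) running time
    (∃ p : Program, ∀ Δ : ℕ, ∃ C : ℕ,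
      ∀ (n : ℕ) (h : Finset (Fin (2 * n)) → ℂ) (LH : List (Finset (Fin (2 * n)) × ℂ)),
        0 < n → IsQuartic h → IsSparse Δ h → IsMonomialList LH h →
        ∃ (G : ℕ) (c : Finset (Fin (2 * n)) → ℕ), G ≤ 4 * Δ ∧ IsColouring h G c ∧
          ∀ (A : FockOp n) (LA : List (Finset (Fin (2 * n)) × ℂ)) (t δt : ℝ) (ℓ : ℕ),
            IsMonomialList LA (coeff A) → 0 ≤ t → 0 < δt → degree A ≤ ℓ →
            ∃ (L : List (Finset (Fin (2 * n)) × ℂ)) (k : ℕ),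
              IsMonomialList L (coeff (majoranaPropagation h G c A t δt ℓ)) ∧
              Runs p (encodeInput LH LA t δt ℓ) (encodePoly L) k ∧
              (k : ℝ) ≤ (t / δt + 1) * ((2 * n : ℕ) : ℝ) ^ (C * max ℓ 1)) ∧
    -- (ii) error bound
    (∀ (n Δ : ℕ) (h : Finset (Fin (2 * n)) → ℂ) (G : ℕ) (c : Finset (Fin (2 * n)) → ℕ)
      (A : FockOp n) (t δt : ℝ) (ℓ : ℕ),
        IsQuartic h → IsSparse Δ h → G ≤ 4 * Δ → IsColouring h G c →
        0 ≤ t → 0 < δt → degree A ≤ ℓ →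
        frobNorm (majoranaPropagation h G c A t δt ℓ - evolve (hamiltonian h) t A) ≤
          34 * t * δt * (Δ : ℝ) ^ 2 * ((ℓ : ℝ) + 2) ^ 2 * frobNorm A +
            (⌈t / δt⌉₊ : ℝ) * bestError (hamiltonian h) A t ℓ) := by
  exact ⟨exists_program, fun n Δ h G c A t δt ℓ hq hs hG hc ht hδ hA =>
    frobNorm_majoranaPropagation_sub_le n Δ h G c A t δt ℓ hq hs hG hc ht hδ hA⟩
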